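/- Let $m\ge n\ge r\ge 1$ be integers and let $X=X_{m,n,r}\subset\mathbb{C}^{m\times n}$ be the affine variety of complex $m\times n$ matrices of rank at most $r$, with smooth locus $X^{\mathrm{sm}}$. Let $$\mathcal{E}_X=\{(u,x)\in\mathbb{C}^{m\times n}\times X^{\mathrm{sm}} \mid x-u\in (T_xX)^{\perp}\},\qquad \pi:\mathcal{E}_X\to\mathbb{C}^{m\times n},\ (u,x)\mapsto u,$$ be the Euclidean distance correspondence and its projection, where $\perp$ is taken with respect to the bilinear form $\langle v,w\rangle=\sum_{i,j}v_{ij}w_{ij}$. Then $\pi$ is a branched cover: $\mathcal{E}_X$ is irreducible, of the same dimension as $\mathbb{C}^{m\times n}$, and $\pi$ is dominant. Moreover: 1. The ED degree of $X$ is $\binom{n}{r}$: for all $u$ in a nonempty Zariski-open subset of $\mathbb{C}^{m\times n}$, the fiber $\pi^{-1}(u)$ consists of exactly $\binom{n}{r}$ points. 2. Let $f$ be the minimal polynomial over $\mathbb{C}(u)$ of any primitive element of the extension of function fields $\mathbb{C}(\mathcal{E}_X)/\mathbb{C}(u)$. The Galois/monodromy group $\mathrm{Gal}(\pi)$, i.e.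 the Galois group of $f$ over $\mathbb{C}(u)$ as a group of permutations of the roots of $f$, is isomorphic as a permutation group to the symmetric group $S_n$ acting on the set $\binom{[n]}{r}$ of $r$-element subsets of $[n]=\{1,\dots,n\}$ (that is, to the image of $S_n$ in the group of permutations of $\binom{[n]}{r}$). 3. Define the Galois width of a finite group $G$ to be the minimum, over all maximal chains of subgroups $G=H_0>\dots>H_k=\{1\}$, of the largest index $[H_i:H_{i+1}]$ (with value $1$ for the trivial group). If $r<n$, then the Galois width of $\mathrm{Gal}(\pi)$ is $n$ when $n\neq 4$, and $3$ when $n=4$. If $r=n$, then $\mathrm{Gal}(\pi)$ is trivial and its Galois width is $1$. -/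

import Mathlib

open MvPolynomial

noncomputable section

/-! ### Galois width of a finite group -/

/-- `c` is the cost of the maximal subgroup chain `G = H 0 > ⋯ > H k = 1`. A chain from `G` to `1`
is maximal exactly when each `H (i + 1)` is covered by `H i` in the lattice of subgroups, and the
cost is the largest index `[H i : H (i + 1)]` (the cost of the chain of length `0` is `1`). -/
def IsMaximalChainCost (G : Type*) [Group G] (c : ℕ) : Prop :=
  ∃ (k : ℕ) (H : Fin (k + 1) → Subgroup G),
    H 0 = ⊤ ∧ H (Fin.last k) = ⊥ ∧ (∀ i : Fin k, H i.succ ⋖ H i.castSucc) ∧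
    c = max 1 (Finset.univ.sup fun i : Fin k => (H i.succ).relIndex (H i.castSucc))

/-- The Galois width of a finite group: the minimum cost of a maximal chain of subgroups. -/
def galoisWidth (G : Type*) [Group G] : ℕ :=
  sInf {c | IsMaximalChainCost G c}

/-! ### Permutation groups -/

/-- Two permutation groups are isomorphic as permutation groups: a bijection of the underlying
sets carries one group onto the other. -/
def PermGroupIso {α β : Type*} (G : Subgroup (Equiv.Perm α)) (H : Subgroup (Equiv.Perm β)) :
    Prop :=
  ∃ e : α ≃ β, G.map e.permCongrHom.toMonoidHom = H

/-- The symmetric group on `n` letters acting on the `r`-element subsets of the letters, as a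
group of permutations of the set of these subsets. -/
def symmOnSubsets (n r : ℕ) : Subgroup (Equiv.Perm (Set.powersetCard (Fin n) r)) :=
  (MulAction.toPermHom (Equiv.Perm (Fin n)) (Set.powersetCard (Fin n) r)).range

/-! ### Branched covers of affine space

`W` is a set of pairs (problem, solution) in `ℂ^ι × ℂ^κ`, with projection `(u, x) ↦ u`. -/

section BranchedCover

variable {ι κ : Type} (W : Set ((ι → ℂ) × (κ → ℂ)))

/-- The ideal of the polynomials in the parameters and the unknowns that vanish on `W`. -/
def idealOf : Ideal (MvPolynomial (ι ⊕ κ) ℂ) :=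
  vanishingIdeal ℂ ((fun p : (ι → ℂ) × (κ → ℂ) => Sum.elim p.1 p.2) '' W)

/-- The coordinate ring of (the Zariski closure of) `W`. -/
abbrev CoordRing : Type := MvPolynomial (ι ⊕ κ) ℂ ⧸ idealOf W

/-- The pullback `ℂ[u] → ℂ[W]` along the projection to the parameters. -/
instance coordRingAlgebra : Algebra (MvPolynomial ι ℂ) (CoordRing W) :=
  ((Ideal.Quotient.mk (idealOf W)).comp
    (rename (R := ℂ) (Sum.inl : ι → ι ⊕ κ)).toRingHom).toAlgebra

/-- The projection `(u, x) ↦ u` from `W` to `ℂ^ι` is a branched cover: `W` is irreducible, the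
projection is dominant, and `W` has the same dimension as `ℂ^ι`, that is, `ℂ[W]` is algebraic over
the polynomial ring `ℂ[u]` of the base. -/
class IsBranchedCover : Prop where
  irreducible : (idealOf W).IsPrime
  dominant : Function.Injective (algebraMap (MvPolynomial ι ℂ) (CoordRing W))
  equidimensional : Algebra.IsAlgebraic (MvPolynomial ι ℂ) (CoordRing W)

/-- The degree of the branched cover is `d`: for all `u` in a nonempty Zariski-open subset of
`ℂ^ι`, the fiber over `u` consists of exactly `d` points. -/
def HasDegree (d : ℕ) : Prop :=
  ∃ g : MvPolynomial ι ℂ, g ≠ 0 ∧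
    ∀ u : ι → ℂ, eval u g ≠ 0 → {x : κ → ℂ | (u, x) ∈ W}.encard = d

/-- The function field `ℂ(u)` of the base. -/
abbrev BaseField (ι : Type) : Type := FractionRing (MvPolynomial ι ℂ)

/-- The function field `ℂ(W)`. -/
def CoverField : Type := FractionRing (CoordRing W)

instance : CommRing (CoverField W) := inferInstanceAs (CommRing (FractionRing (CoordRing W)))

instance : Algebra (CoordRing W) (CoverField W) :=
  inferInstanceAs (Algebra (CoordRing W) (FractionRing (CoordRing W)))

instance : IsFractionRing (CoordRing W) (CoverField W) :=
  inferInstanceAs (IsFractionRing (CoordRing W) (FractionRing (CoordRing W)))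

variable [IsBranchedCover W]

instance : IsDomain (CoordRing W) :=
  (Ideal.Quotient.isDomain_iff_prime (idealOf W)).mpr IsBranchedCover.irreducible

instance : Field (CoverField W) := inferInstanceAs (Field (FractionRing (CoordRing W)))

theorem base_injective : Function.Injective
    ((algebraMap (CoordRing W) (CoverField W)).comp
      (algebraMap (MvPolynomial ι ℂ) (CoordRing W))) :=
  (IsFractionRing.injective (CoordRing W) (CoverField W)).comp IsBranchedCover.dominant

/-- The field extension `ℂ(W) / ℂ(u)` induced by the projection. -/
instance : Algebra (BaseField ι) (CoverField W) :=
  (IsFractionRing.lift (base_injective W)).toAlgebra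

/-- `f` is the minimal polynomial over `ℂ(u)` of a primitive element of `ℂ(W) / ℂ(u)`. -/
def IsEliminant (f : Polynomial (BaseField ι)) : Prop :=
  ∃ y : CoverField W,
    IntermediateField.adjoin (BaseField ι) {y} = ⊤ ∧ f = minpoly (BaseField ι) y

/-- Every branched cover has an eliminant. -/
theorem exists_isEliminant [Finite ι] [Finite κ] : ∃ f, IsEliminant W f := by
  let A := MvPolynomial ι ℂ
  let : Algebra A (CoverField W) :=
    ((algebraMap (CoordRing W) (CoverField W)).comp (algebraMap A (CoordRing W))).toAlgebra
  have : IsScalarTower A (CoordRing W) (CoverField W) := .of_algebraMap_eq' rfl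
  have : IsScalarTower A (BaseField ι) (CoverField W) := .of_algebraMap_eq fun x =>
    (IsFractionRing.lift_algebraMap (base_injective W) x).symm
  have : IsScalarTower ℂ A (CoordRing W) := .of_algebraMap_eq fun x => by
    change _ = Ideal.Quotient.mk (idealOf W) (rename Sum.inl (C x))
    rw [rename_C]; rfl
  have : Algebra.EssFiniteType A (CoordRing W) := .of_comp ℂ A (CoordRing W)
  have : Algebra.EssFiniteType (CoordRing W) (CoverField W) :=
    .of_isLocalization _ (nonZeroDivisors (CoordRing W))
  have : Algebra.EssFiniteType A (CoverField W) := .comp A (CoordRing W) (CoverField W)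
  have : Algebra.EssFiniteType (BaseField ι) (CoverField W) := .of_comp A _ _
  have : Algebra.IsAlgebraic A (CoordRing W) := IsBranchedCover.equidimensional
  have : Algebra.IsAlgebraic (CoordRing W) (CoverField W) :=
    IsLocalization.isAlgebraic _ (nonZeroDivisors (CoordRing W))
  have : Algebra.IsAlgebraic A (CoverField W) := Algebra.IsAlgebraic.trans A (CoordRing W) _
  have : Algebra.IsAlgebraic (BaseField ι) (CoverField W) :=
    Algebra.IsAlgebraic.extendScalars (R := A) (IsFractionRing.injective A (BaseField ι))
  have : Module.Finite (BaseField ι) (CoverField W) :=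
    Algebra.finite_of_essFiniteType_of_isAlgebraic
  obtain ⟨y, hy⟩ := Field.exists_primitive_element (BaseField ι) (CoverField W)
  exact ⟨_, y, hy, rfl⟩

end BranchedCover

/-- The Galois/monodromy group given by an eliminant `f` of a branched cover: the Galois group of
`f` over `ℂ(u)`, as a group of permutations of the roots of `f` in its splitting field. -/
def galoisMonodromyGroup {ι : Type} (f : Polynomial (BaseField ι)) :
    Subgroup (Equiv.Perm (f.rootSet f.SplittingField)) :=
  haveI : Fact ((f.map (algebraMap (BaseField ι) f.SplittingField)).Splits) :=
    ⟨Polynomial.SplittingField.splits f⟩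
  (Polynomial.Gal.galActionHom f f.SplittingField).range

/-! ### The Euclidean distance correspondence -/

section EuclideanDistance

variable {ι : Type} [Fintype ι]

/-- The Zariski tangent space at `x` of the variety `X`: the common kernel of the differentials at
`x` of all polynomials vanishing on `X`. -/
def tangentSpace (X : Set (ι → ℂ)) (x : ι → ℂ) : Submodule ℂ (ι → ℂ) where
  carrier := {v | ∀ f ∈ vanishingIdeal ℂ X, ∑ i, eval x (pderiv i f) * v i = 0}
  zero_mem' := by simp
  add_mem' := by
    intro v w hv hw f hf
    simp [mul_add, Finset.sum_add_distrib, hv f hf, hw f hf]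
  smul_mem' := by
    intro c v hv f hf
    have h := congrArg (c * ·) (hv f hf)
    simpa [Finset.mul_sum, mul_left_comm] using h

/-- The smooth points of an irreducible variety `X`: those at which the dimension of the tangent
space takes its minimum over `X` (for irreducible `X` this minimum is `dim X`). -/
def smoothLocus (X : Set (ι → ℂ)) : Set (ι → ℂ) :=
  {x ∈ X | ∀ y ∈ X, Module.finrank ℂ (tangentSpace X x) ≤ Module.finrank ℂ (tangentSpace X y)}

/-- The Euclidean distance correspondence of `X`: the pairs `(u, x)` with `x` a smooth point of `X`
and `x - u` orthogonal to the tangent space at `x`, for the bilinear form `∑ i, v i * w i`. -/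
def edCorrespondence (X : Set (ι → ℂ)) : Set ((ι → ℂ) × (ι → ℂ)) :=
  {p | p.2 ∈ smoothLocus X ∧ ∀ v ∈ tangentSpace X p.2, (p.2 - p.1) ⬝ᵥ v = 0}

end EuclideanDistance

/-- The variety of complex `m × n` matrices of rank at most `r`, in the affine space `ℂ^(m × n)`. -/
def rankVariety (m n r : ℕ) : Set (Fin m × Fin n → ℂ) :=
  {x | (Matrix.of fun i j => x (i, j)).rank ≤ r}

end

open MvPolynomial

noncomputable section

/-! For generic `u` the symmetric matrix `uᵀ u` has distinct nonzero eigenvalues `l₁, …, lₙ`, hence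
`uᵀ u = V diag(l) Vᵀ` with `V` complex orthogonal. The normal space at a point `x` of rank `r` is
cut out by `xᵀ d = 0` and `d xᵀ = 0`. Solving these equations in the eigenbasis gives the
Eckart–Young description (`mem_edCorrespondence_iff_of_mem_eigenSet`): the fibre over `u` consists
of the points `u V P_I Vᵀ`, where `P_I` is the coordinate projection for an `r`-subset `I` of the
labels. This gives the degree.

For the monodromy, the correspondence is dominated by the set `eigenSet` of pairs `(u, l)`, on which
`Sₙ` acts by relabelling. This set is irreducible, so its ring of regular functions `eigenRing` is a
domain. Its fraction field is the splitting field over `ℂ(u)` of the characteristic polynomial of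
`uᵀ u`, and its automorphisms are the relabellings. The spectral projection `V P_I Vᵀ` is a Lagrange
polynomial in `uᵀ u`, so the critical point for `I` has coordinates in `eigenRing`. Taking `I` to be
the first `r` labels embeds the coordinate ring of the correspondence in `eigenRing`, and a
permutation fixes the image pointwise exactly when it preserves `I`
(`smul_coordRingToEigenRing_eq_iff`). The conjugates of a primitive element thus form the `Sₙ`-set
of `r`-subsets (`permGroupIso_galoisMonodromyGroup_of_permuted_roots`).

Both irreducibility statements come from joining any two points by a polynomial curve that lies in
the set for all but finitely many parameters. For the correspondence, lines in a parameter space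
`(G, H, Z)` suffice. For `eigenSet`, orthogonal factors of singular value decompositions are joined
by division-free Gram–Schmidt.

For `1 ≤ r < n` the action on `r`-subsets is faithful, so the width is that of `Sₙ`. Stabilizer
chains bound it above by `n`, and a chain of 2-groups gives `3` when `n = 4`. The lower bound comes
from simplicity of the alternating group for `n ≥ 5` and from prime divisors of `n!` for smaller
`n`. -/

/-! ### Chains of subgroups of bounded index -/

/-- `K` is joined to the trivial subgroup by a maximal chain of subgroups in which all the successive
indices are at most `c`. -/
inductive BoundedChain {G : Type*} [Group G] (c : ℕ) : Subgroup G → Prop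
  | bot : BoundedChain c ⊥
  | step {H K : Subgroup G} : H ⋖ K → H.relIndex K ≤ c → BoundedChain c H → BoundedChain c K

section GaloisWidth

variable {G : Type*} [Group G]

theorem IsMaximalChainCost.one_le {c : ℕ} (h : IsMaximalChainCost G c) : 1 ≤ c := by
  obtain ⟨k, H, -, -, -, rfl⟩ := h
  exact le_max_left _ _

theorem IsMaximalChainCost.boundedChain {c : ℕ} (h : IsMaximalChainCost G c) :
    BoundedChain c (⊤ : Subgroup G) := by
  obtain ⟨k, H, h0, hk, hcov, hc⟩ := h
  rw [← h0]
  have key : ∀ i : Fin (k + 1), BoundedChain c (H i) := by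
    intro i
    induction i using Fin.reverseInduction with
    | last => rw [hk]; exact .bot
    | cast i ih =>
      refine .step (hcov i) ?_ ih
      rw [hc]
      exact (Finset.le_sup (f := fun i : Fin k => (H i.succ).relIndex (H i.castSucc))
        (Finset.mem_univ i)).trans (le_max_right _ _)
  exact key 0

theorem BoundedChain.exists_fin {c : ℕ} {K : Subgroup G} (h : BoundedChain c K) :
    ∃ (k : ℕ) (H : Fin (k + 1) → Subgroup G),
      H 0 = K ∧ H (Fin.last k) = ⊥ ∧ (∀ i : Fin k, H i.succ ⋖ H i.castSucc) ∧
      ∀ i : Fin k, (H i.succ).relIndex (H i.castSucc) ≤ c := by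
  induction h with
  | bot => exact ⟨0, fun _ => ⊥, rfl, rfl, fun i => i.elim0, fun i => i.elim0⟩
  | @step H K hcov hle _ ih =>
    obtain ⟨k, F, h0, hk, hc, hb⟩ := ih
    refine ⟨k + 1, Fin.cons K F, rfl, ?_, ?_, ?_⟩
    · rw [← Fin.succ_last, Fin.cons_succ, hk]
    · intro i
      cases i using Fin.cases with
      | zero => simpa [h0] using hcov
      | succ i => simpa [← Fin.succ_castSucc] using hc i
    · intro i
      cases i using Fin.cases with
      | zero => simpa [h0] using hle
      | succ i => simpa [← Fin.succ_castSucc] using hb i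

theorem galoisWidth_le {c : ℕ} (hc : 1 ≤ c) (h : BoundedChain c (⊤ : Subgroup G)) :
    galoisWidth G ≤ c := by
  obtain ⟨k, H, h0, hk, hcov, hb⟩ := h.exists_fin
  have hmem : IsMaximalChainCost G _ := ⟨k, H, h0, hk, hcov, rfl⟩
  refine (Nat.sInf_le hmem).trans ?_
  exact max_le hc (Finset.sup_le fun i _ => hb i)

theorem galoisWidth_eq {N : ℕ} (hN : 1 ≤ N) (h : BoundedChain N (⊤ : Subgroup G))
    (hlow : ∀ c, 1 ≤ c → BoundedChain c (⊤ : Subgroup G) → N ≤ c) : galoisWidth G = N := by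
  refine le_antisymm (galoisWidth_le hN h) ?_
  obtain ⟨k, H, h0, hk, hcov, hb⟩ := h.exists_fin
  -- The infimum of an empty set of naturals is `0`, so attainment needs a chain; the one given for
  -- `N` supplies it.
  have hne : {c | IsMaximalChainCost G c}.Nonempty := ⟨_, k, H, h0, hk, hcov, rfl⟩
  have hmem : IsMaximalChainCost G (galoisWidth G) := Nat.sInf_mem hne
  exact hlow _ hmem.one_le hmem.boundedChain

theorem BoundedChain.map_equiv {G' : Type*} [Group G'] (e : G ≃* G') {c : ℕ} {K : Subgroup G}
    (h : BoundedChain c K) : BoundedChain c (K.map e.toMonoidHom) := by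
  induction h with
  | bot => rw [Subgroup.map_bot]; exact .bot
  | @step H K hcov hle _ ih =>
    refine .step ?_ ?_ ih
    · exact (apply_covBy_apply_iff e.mapSubgroup).2 hcov
    · rwa [Subgroup.relIndex_map_map_of_injective _ _ e.injective]

theorem boundedChain_top_congr {G' : Type*} [Group G'] (e : G ≃* G') {c : ℕ}
    (h : BoundedChain c (⊤ : Subgroup G)) : BoundedChain c (⊤ : Subgroup G') := by
  have := h.map_equiv e
  rwa [Subgroup.map_top_of_surjective _ e.surjective] at this

theorem galoisWidth_of_subsingleton [Subsingleton G] : galoisWidth G = 1 := by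
  refine galoisWidth_eq le_rfl ?_ fun c hc _ => hc
  rw [Subsingleton.elim (⊤ : Subgroup G) ⊥]
  exact .bot

theorem Subgroup.relIndex_ne_zero_of_finite [Finite G] (H K : Subgroup G) : H.relIndex K ≠ 0 :=
  Subgroup.index_ne_zero_of_finite

/-- A chain of subgroups refines to a maximal one without increasing the indices. -/
theorem BoundedChain.of_le [Finite G] {c : ℕ} {H : Subgroup G} (hH : BoundedChain c H) :
    ∀ {K : Subgroup G}, H ≤ K → H.relIndex K ≤ c → BoundedChain c K := by
  suffices ∀ N : ℕ, ∀ K : Subgroup G, Nat.card K = N → H ≤ K → H.relIndex K ≤ c →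
      BoundedChain c K from fun {K} => this _ K rfl
  intro N
  induction N using Nat.strong_induction_on with
  | _ N ih =>
    rintro K rfl hHK hc
    rcases hHK.eq_or_lt with rfl | hlt
    · exact hH
    -- `M` is a maximal proper subgroup of `K` above `H`. Since `[K : H] = [K : M] [M : H]`, neither
    -- factor exceeds `c`, and `M` is smaller than `K`.
    obtain ⟨M, hHM, hMK⟩ := exists_le_covBy_of_lt hlt
    have hmul := Subgroup.relIndex_mul_relIndex H M K hHM hMK.le
    have h1 : H.relIndex M ≠ 0 := Subgroup.relIndex_ne_zero_of_finite H M
    have h2 : M.relIndex K ≠ 0 := Subgroup.relIndex_ne_zero_of_finite M K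
    refine .step hMK ?_ (ih _ ?_ M rfl hHM ?_)
    · exact (Nat.le_mul_of_pos_left _ (Nat.pos_of_ne_zero h1)).trans (hmul.le.trans hc)
    · exact Set.ncard_lt_ncard (s := (M : Set G)) (t := (K : Set G)) hMK.lt (Set.toFinite _)
    · exact (Nat.le_mul_of_pos_right _ (Nat.pos_of_ne_zero h2)).trans (hmul.le.trans hc)

/-- A maximal chain contains an index divisible by a given prime factor of the group order. -/
theorem BoundedChain.prime_le [Finite G] {p c : ℕ} (hp : p.Prime) {K : Subgroup G}
    (h : BoundedChain c K) (hdvd : p ∣ Nat.card K) : p ≤ c := by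
  induction h with
  | bot => simp [hp.ne_one] at hdvd
  | @step H K hcov hle _ ih =>
    have hcard : Nat.card H * H.relIndex K = Nat.card K := by
      have := Subgroup.card_mul_index (H.subgroupOf K)
      rwa [Nat.card_congr (Subgroup.subgroupOfEquivOfLe hcov.le).toEquiv] at this
    rw [← hcard] at hdvd
    rcases hp.dvd_mul.1 hdvd with h | h
    · exact ih h
    · exact (Nat.le_of_dvd (Nat.pos_of_ne_zero (Subgroup.relIndex_ne_zero_of_finite H K)) h).trans hle

end GaloisWidth

/-! ### Galois width of the symmetric group -/

/-- In the chain of pointwise stabilizers of `{k, …, n - 1}`, each group is a point stabilizer in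
the next, so its index there is an orbit length, at most `n`. -/
theorem boundedChain_perm_fin (n : ℕ) : BoundedChain n (⊤ : Subgroup (Equiv.Perm (Fin n))) := by
  let F : ℕ → Subgroup (Equiv.Perm (Fin n)) := fun k =>
    { carrier := {σ | ∀ i : Fin n, k ≤ i.val → σ i = i}
      one_mem' := fun _ _ => rfl
      mul_mem' := fun {a b} ha hb i hi => by rw [Equiv.Perm.mul_apply, hb i hi, ha i hi]
      inv_mem' := fun {a} ha i hi => by rw [Equiv.Perm.inv_eq_iff_eq, ha i hi] }
  have key : ∀ k, k ≤ n → BoundedChain n (F k) := by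
    intro k
    induction k with
    | zero =>
      intro _
      have : F 0 = ⊥ := by
        rw [eq_bot_iff]
        intro σ hσ
        exact Equiv.ext fun i => hσ i (Nat.zero_le _)
      rw [this]; exact .bot
    | succ k ih =>
      intro hk
      refine (ih (Nat.le_of_succ_le hk)).of_le (fun σ hσ i hi => hσ i (Nat.le_of_succ_le hi)) ?_
      have hst : (F k).subgroupOf (F (k + 1)) =
          MulAction.stabilizer (F (k + 1)) (⟨k, hk⟩ : Fin n) := by
        ext σ
        rw [Subgroup.mem_subgroupOf, MulAction.mem_stabilizer_iff]
        constructor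
        · intro h; exact h ⟨k, hk⟩ le_rfl
        · intro h i hi
          rcases hi.eq_or_lt with h' | h'
          · have : i = ⟨k, hk⟩ := Fin.ext h'.symm
            rw [this]; exact h
          · exact σ.2 i h'
      rw [Subgroup.relIndex, hst, MulAction.index_stabilizer]
      exact (Set.ncard_le_card _).trans (by simp)
  have : F n = ⊤ := by
    rw [eq_top_iff]
    intro σ _ i hi
    exact absurd i.2 (not_lt.2 hi)
  rw [← this]
  exact key n le_rfl

/-- Since `24 = 2³ · 3`, Sylow theory gives nested subgroups of orders `1, 2, 4, 8, 24`, with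
indices `2, 2, 2, 3`. This avoids the index `4` of a point stabilizer. -/
theorem boundedChain_perm_fin_four : BoundedChain 3 (⊤ : Subgroup (Equiv.Perm (Fin 4))) := by
  have hG : Nat.card (Equiv.Perm (Fin 4)) = 24 := by
    rw [Nat.card_perm, Nat.card_fin]; rfl
  have : Fact (Nat.Prime 2) := ⟨Nat.prime_two⟩
  have hrel : ∀ {H K : Subgroup (Equiv.Perm (Fin 4))}, H ≤ K →
      Nat.card H * H.relIndex K = Nat.card K := by
    intro H K hle
    have := Subgroup.card_mul_index (H.subgroupOf K)
    rwa [Nat.card_congr (Subgroup.subgroupOfEquivOfLe hle).toEquiv] at this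
  obtain ⟨A, hA, -⟩ := Sylow.exists_subgroup_card_pow_prime_le 2 (n := 0) (m := 1)
    (by rw [hG]; norm_num) (⊥ : Subgroup (Equiv.Perm (Fin 4))) (by simp) (by norm_num)
  obtain ⟨B, hB, hAB⟩ := Sylow.exists_subgroup_card_pow_prime_le 2 (n := 1) (m := 2)
    (by rw [hG]; norm_num) A hA (by norm_num)
  obtain ⟨C, hC, hBC⟩ := Sylow.exists_subgroup_card_pow_prime_le 2 (n := 2) (m := 3)
    (by rw [hG]; norm_num) B hB (by norm_num)
  have h1 := hrel (bot_le (a := A))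
  have h2 := hrel hAB
  have h3 := hrel hBC
  have h4 := hrel (le_top (a := C))
  rw [Subgroup.card_top, hG] at h4
  rw [Subgroup.card_bot] at h1
  have a1 : BoundedChain 3 A := BoundedChain.bot.of_le bot_le (by omega)
  have a2 : BoundedChain 3 B := a1.of_le hAB (by rw [hA, hB] at h2; omega)
  have a3 : BoundedChain 3 C := a2.of_le hBC (by rw [hB, hC] at h3; omega)
  exact a3.of_le le_top (by rw [hC] at h4; omega)

/-- If all indices were below `n`, the chain could never leave the groups containing `Aₙ`. Indeed
`Aₙ` would act on fewer than `n` cosets of the next group; it is simple and `n!/2 > (n - 1)!`, so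
the action is trivial and `Aₙ` stays inside. -/
theorem BoundedChain.le_of_alternatingGroup_le {n c : ℕ} (hn : 5 ≤ n)
    {K : Subgroup (Equiv.Perm (Fin n))} (h : BoundedChain c K) (hK : alternatingGroup (Fin n) ≤ K) :
    n ≤ c := by
  have hsimple : IsSimpleGroup (alternatingGroup (Fin n)) :=
    alternatingGroup.isSimpleGroup (by simpa using hn)
  have : Nontrivial (Fin n) := Fin.nontrivial_iff_two_le.2 (by omega)
  have hcard : 2 * Nat.card (alternatingGroup (Fin n)) = n.factorial := by
    rw [two_mul_nat_card_alternatingGroup, Nat.card_perm, Nat.card_fin]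
  induction h with
  | bot =>
    have : Nontrivial (alternatingGroup (Fin n)) := hsimple.toNontrivial
    exact absurd (le_bot_iff.1 hK) (Subgroup.nontrivial_iff_ne_bot _ |>.1 this)
  | @step H K hcov hle _ ih =>
    by_contra! hc
    refine absurd (ih ?_) (not_le.2 hc)
    let φ : alternatingGroup (Fin n) →* Equiv.Perm (K ⧸ H.subgroupOf K) :=
      (MulAction.toPermHom K (K ⧸ H.subgroupOf K)).comp (Subgroup.inclusion hK)
    have hker : φ.ker = ⊤ := by
      refine (hsimple.eq_bot_or_eq_top_of_normal φ.ker inferInstance).resolve_left fun hbot => ?_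
      have hinj : Function.Injective φ := (MonoidHom.ker_eq_bot_iff φ).1 hbot
      have h1 := Nat.card_le_card_of_injective _ hinj
      have h2 : Nat.card (K ⧸ H.subgroupOf K) ≤ n - 1 := by
        have : Nat.card (K ⧸ H.subgroupOf K) = H.relIndex K := rfl
        omega
      rw [Nat.card_perm] at h1
      have h3 := Nat.factorial_le h2
      have h4 : n.factorial = n * (n - 1).factorial := (Nat.mul_factorial_pred (by omega)).symm
      have h5 : 0 < (n - 1).factorial := Nat.factorial_pos _
      nlinarith
    intro σ hσ
    have h1 : φ ⟨σ, hσ⟩ = 1 := by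
      rw [← MonoidHom.mem_ker, hker]; trivial
    -- Acting trivially on the coset of `1` means lying in `H`.
    have h2 := congrArg (fun f => f ((1 : K) : K ⧸ H.subgroupOf K)) h1
    have h3 : (((⟨σ, hK hσ⟩ : K) * 1 : K) : K ⧸ H.subgroupOf K) = ((1 : K) : K ⧸ H.subgroupOf K) :=
      h2
    rw [mul_one, QuotientGroup.eq] at h3
    simpa [Subgroup.mem_subgroupOf] using h3

theorem galoisWidth_of_mulEquiv_perm {G : Type*} [Group G] {n : ℕ} (hn : 2 ≤ n)
    (e : G ≃* Equiv.Perm (Fin n)) : galoisWidth G = if n = 4 then 3 else n := by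
  have hcard : Nat.card (⊤ : Subgroup (Equiv.Perm (Fin n))) = n.factorial := by
    rw [Subgroup.card_top, Nat.card_perm, Nat.card_fin]
  refine galoisWidth_eq (by split_ifs <;> omega) (boundedChain_top_congr e.symm ?_) ?_
  · split_ifs with h
    · subst h; exact boundedChain_perm_fin_four
    · exact boundedChain_perm_fin n
  · intro c _ hb
    have hb' := boundedChain_top_congr e hb
    by_cases h5 : 5 ≤ n
    · rw [if_neg (by omega)]
      exact hb'.le_of_alternatingGroup_le h5 le_top
    · have hprime : ∀ p, p.Prime → p ≤ n → p ≤ c := fun p hp hpn =>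
        hb'.prime_le hp (by rw [hcard]; exact Nat.dvd_factorial hp.pos hpn)
      interval_cases n
      · exact hprime 2 Nat.prime_two le_rfl
      · exact hprime 3 Nat.prime_three le_rfl
      · exact hprime 3 Nat.prime_three (by norm_num)

/-! ### Galois groups acting on the conjugates of an element -/

/-- Only the images are compared, so no homomorphism between the two groups is required. This
absorbs the kernels of both actions. -/
theorem PermGroupIso.of_equivariant {G G' α β : Type*} [Group G] [Group G']
    {φ : G →* Equiv.Perm α} {ψ : G' →* Equiv.Perm β} (e : α ≃ β)
    (h₁ : ∀ g : G, ∃ g' : G', ∀ x, e (φ g x) = ψ g' (e x))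
    (h₂ : ∀ g' : G', ∃ g : G, ∀ x, e (φ g x) = ψ g' (e x)) :
    PermGroupIso φ.range ψ.range := by
  refine ⟨e, ?_⟩
  have key : ∀ (g : G) (g' : G'), (∀ x, e (φ g x) = ψ g' (e x)) →
      e.permCongrHom (φ g) = ψ g' := by
    intro g g' h
    ext y
    have := h (e.symm y)
    simpa [Equiv.permCongrHom, Equiv.permCongr_apply] using this
  ext σ
  simp only [Subgroup.mem_map, MonoidHom.mem_range]
  constructor
  · rintro ⟨_, ⟨g, rfl⟩, rfl⟩
    obtain ⟨g', h⟩ := h₁ g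
    exact ⟨g', (key g g' h).symm⟩
  · rintro ⟨g', rfl⟩
    obtain ⟨g, h⟩ := h₂ g'
    exact ⟨_, ⟨g, rfl⟩, key g g' h⟩

/-- If a group `G` maps onto `Gal(F/K)` with `F/K` normal, and `y ∈ F` is a root of an irreducible
`f` whose stabilizer in `G` is that of a point `a` of a transitive `G`-set `α`, then the Galois group
of `f` acts on the roots of `f` as `G` acts on `α`. -/
theorem permGroupIso_galoisMonodromyGroup {ι : Type} {F G α : Type*} [Field F]
    [Algebra (BaseField ι) F] [Normal (BaseField ι) F] [Group G] [MulAction G α]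
    [MulAction.IsPretransitive G α] {f : Polynomial (BaseField ι)} (hf : Irreducible f)
    (ρ : G →* (F ≃ₐ[BaseField ι] F)) (hρ : Function.Surjective ρ) {y : F}
    (hy : Polynomial.aeval y f = 0) (a : α) (hstab : ∀ g : G, ρ g y = y ↔ g • a = a) :
    PermGroupIso (galoisMonodromyGroup f) (MulAction.toPermHom G α).range := by
  have hne : f ≠ 0 := hf.ne_zero
  have hminpoly : (minpoly (BaseField ι) y).map (algebraMap (BaseField ι) F) |>.Splits :=
    Normal.splits inferInstance y
  have hint : IsIntegral (BaseField ι) y := Normal.isIntegral inferInstance y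
  have hsplitF : Fact ((f.map (algebraMap (BaseField ι) F)).Splits) := by
    refine ⟨?_⟩
    have hm := minpoly.eq_of_irreducible hf hy
    rw [← hm, Polynomial.map_mul, Polynomial.map_C] at hminpoly
    refine Polynomial.Splits.of_dvd hminpoly ?_ (Dvd.intro _ rfl)
    rw [← Polynomial.map_C, ← Polynomial.map_mul, hm]
    exact Polynomial.map_ne_zero (minpoly.ne_zero hint)
  have hsplit : Fact ((f.map (algebraMap (BaseField ι) f.SplittingField)).Splits) :=
    ⟨Polynomial.SplittingField.splits f⟩
  have hroot : ∀ g : G, ρ g y ∈ f.rootSet F := fun g => by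
    rw [Polynomial.mem_rootSet]
    refine ⟨hne, ?_⟩
    rw [← AlgEquiv.coe_toAlgHom, Polynomial.aeval_algHom_apply, hy, map_zero]
  have heq : ∀ g h : G, ρ g y = ρ h y ↔ g • a = h • a := by
    intro g h
    have h₁ : g • a = h • a ↔ (h⁻¹ * g) • a = a := by rw [mul_smul, inv_smul_eq_iff]
    rw [h₁, ← hstab, map_mul, map_inv, AlgEquiv.mul_apply]
    exact (AlgEquiv.symm_apply_eq (ρ h)).symm
  choose s hs using fun b : α => MulAction.exists_smul_eq G a b
  -- The orbit map `g • a ↦ ρ g y`, through the section `s`. By `heq` the choice of `s` does not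
  -- matter.
  let E : α → f.rootSet F := fun b => ⟨ρ (s b) y, hroot _⟩
  have hE : ∀ g : G, (E (g • a) : F) = ρ g y := fun g => (heq _ _).2 (hs _)
  have hEsmul : ∀ (g : G) (b : α), (E (g • b) : F) = ρ g (E b) := by
    intro g b
    rw [← hs b, smul_smul, hE, hE, map_mul, AlgEquiv.mul_apply]
  have hbij : Function.Bijective E := by
    constructor
    · intro b c hbc
      have := (heq (s b) (s c)).1 (congrArg Subtype.val hbc)
      rwa [hs, hs] at this
    · rintro ⟨x, hx⟩
      have hx' := (Polynomial.mem_rootSet.1 hx).2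
      -- In a normal extension, elements with the same minimal polynomial are conjugate, so every
      -- root is reached.
      obtain ⟨φ, hφ⟩ := (Normal.minpoly_eq_iff_mem_orbit (F := BaseField ι) (E := F)).1
        ((minpoly.eq_of_irreducible hf hx').symm.trans (minpoly.eq_of_irreducible hf hy))
      obtain ⟨g, rfl⟩ := hρ φ
      refine ⟨g • a, Subtype.ext ?_⟩
      rw [hE]
      exact hφ
  -- The abstract splitting field and `F` have the same roots as `f.Gal`-sets, so the computation
  -- can be done in `F`.
  let e₁ : f.rootSet f.SplittingField ≃ f.rootSet F :=
    (Polynomial.Gal.rootsEquivRoots f f.SplittingField).symm.trans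
      (Polynomial.Gal.rootsEquivRoots f F)
  have he₁ : ∀ (γ : f.Gal) (x : f.rootSet f.SplittingField), 
      e₁ (Polynomial.Gal.galActionHom f f.SplittingField γ x) =
        Polynomial.Gal.galActionHom f F γ (e₁ x) := by
    intro γ x
    change e₁ (Polynomial.Gal.rootsEquivRoots f f.SplittingField _) =
      Polynomial.Gal.rootsEquivRoots f F _
    simp [e₁]
  let e := e₁.trans (Equiv.ofBijective E hbij).symm
  have hkey : ∀ g : G, ∀ x, 
      e (Polynomial.Gal.galActionHom f f.SplittingField (Polynomial.Gal.restrict f F (ρ g)) x) =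
        MulAction.toPermHom G α g (e x) := by
    intro g x
    simp only [e, Equiv.trans_apply]
    rw [Equiv.symm_apply_eq, he₁]
    refine Subtype.ext ?_
    rw [Polynomial.Gal.galActionHom_restrict]
    change _ = (E (g • _) : F)
    rw [hEsmul]
    congr 1
    exact congrArg Subtype.val (Equiv.apply_symm_apply (Equiv.ofBijective E hbij) (e₁ x)).symm
  refine PermGroupIso.of_equivariant e (fun γ => ?_) (fun g => ⟨_, hkey g⟩)
  obtain ⟨φ, rfl⟩ := Polynomial.Gal.restrict_surjective f F γ
  obtain ⟨g, rfl⟩ := hρ φ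
  exact ⟨g, hkey g⟩

theorem PermGroupIso.nonempty_mulEquiv {α β : Type*} {G : Subgroup (Equiv.Perm α)}
    {H : Subgroup (Equiv.Perm β)} (h : PermGroupIso G H) : Nonempty (G ≃* H) := by
  obtain ⟨e, rfl⟩ := h
  exact ⟨G.equivMapOfInjective _ e.permCongrHom.injective⟩

/-- For `0 < r < n` only the identity fixes every `r`-subset, so `Sₙ` is isomorphic to its image. -/
theorem galoisWidth_of_permGroupIso_symmOnSubsets {α : Type*} {G : Subgroup (Equiv.Perm α)}
    {n r : ℕ} (hr : 1 ≤ r) (hrn : r < n) (h : PermGroupIso G (symmOnSubsets n r)) :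
    galoisWidth G = if n = 4 then 3 else n := by
  obtain ⟨e⟩ := h.nonempty_mulEquiv
  have hfaith : FaithfulSMul (Equiv.Perm (Fin n)) (Set.powersetCard (Fin n) r) :=
    Set.powersetCard.faithfulSMul hr (by simpa using hrn)
  have hinj : Function.Injective
      (MulAction.toPermHom (Equiv.Perm (Fin n)) (Set.powersetCard (Fin n) r)) :=
    MulAction.toPerm_injective
  exact galoisWidth_of_mulEquiv_perm (by omega) (e.trans (MonoidHom.ofInjective hinj).symm)

theorem galoisWidth_of_permGroupIso_symmOnSubsets_self {α : Type*} {G : Subgroup (Equiv.Perm α)}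
    {n : ℕ} (h : PermGroupIso G (symmOnSubsets n n)) : galoisWidth G = 1 := by
  obtain ⟨e⟩ := h.nonempty_mulEquiv
  have : Subsingleton (Set.powersetCard (Fin n) n) := by
    refine ⟨fun s t => Subtype.ext ?_⟩
    rw [(Finset.card_eq_iff_eq_univ _).1 (s.2.trans (Fintype.card_fin n).symm),
      (Finset.card_eq_iff_eq_univ _).1 (t.2.trans (Fintype.card_fin n).symm)]
  have : Subsingleton G := e.toEquiv.subsingleton
  exact galoisWidth_of_subsingleton

/-! ### Rank normal form of a rectangular matrix -/

/-- The `m × n` matrix with `r` ones on the main diagonal, and zeros elsewhere. -/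
def rankForm (k : Type*) [Zero k] [One k] (m n r : ℕ) : Matrix (Fin m) (Fin n) k :=
  Matrix.of fun i j => if i.val = j.val ∧ i.val < r then 1 else 0

section RankForm

variable {k : Type*}

theorem rankForm_mul [CommRing k] {m n p r s : ℕ} (hr : r ≤ n) :
    rankForm k m n r * rankForm k n p s = rankForm k m p (min r s) := by
  ext i j
  simp only [Matrix.mul_apply, rankForm, Matrix.of_apply, ite_mul, one_mul, zero_mul]
  by_cases hi : i.val < r
  · rw [Finset.sum_eq_single (⟨i.val, hi.trans_le hr⟩ : Fin n)]
    · simp [hi]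
    · intro b _ hb
      rw [if_neg]
      rintro ⟨h, -⟩
      exact hb (Fin.ext h.symm)
    · simp
  · rw [Finset.sum_eq_zero]
    · rw [if_neg]
      rintro ⟨-, h⟩
      exact hi (h.trans_le (min_le_left _ _))
    · intro b _
      rw [if_neg]
      rintro ⟨-, h⟩
      exact hi h

theorem rankForm_self [CommRing k] (n : ℕ) : rankForm k n n n = 1 := by
  ext i j
  simp [rankForm, Matrix.one_apply, Fin.ext_iff]

theorem rankForm_transpose [CommRing k] (m n r : ℕ) :
    (rankForm k m n r).transpose = rankForm k n m r := by
  ext i j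
  simp only [rankForm, Matrix.transpose_apply, Matrix.of_apply]
  congr 1
  ext
  constructor <;> rintro ⟨h, h'⟩ <;> exact ⟨h.symm, by omega⟩

theorem rank_rankForm [Field k] {m n r : ℕ} (hm : r ≤ m) (hn : r ≤ n) :
    (rankForm k m n r).rank = r := by
  refine le_antisymm ?_ ?_
  · have h : rankForm k m n r = rankForm k m r r * rankForm k r n r := by
      rw [rankForm_mul le_rfl, min_self]
    rw [h]
    exact (Matrix.rank_mul_le_left _ _).trans (Matrix.rank_le_width _)
  · have h : rankForm k r m r * (rankForm k m n r * rankForm k n r r) = 1 := by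
      rw [rankForm_mul hn, min_self, rankForm_mul hm, min_self, rankForm_self]
    have h1 := Matrix.rank_mul_le_right (rankForm k r m r) (rankForm k m n r * rankForm k n r r)
    rw [h, Matrix.rank_one, Fintype.card_fin] at h1
    exact h1.trans (Matrix.rank_mul_le_left _ _)

/-- A complement of the kernel maps isomorphically onto the range. A basis of it and the image of
that basis open the two adapted bases. -/
theorem exists_basis_rankForm [Field k] {V W : Type*} [AddCommGroup V] [Module k V]
    [AddCommGroup W] [Module k W] [FiniteDimensional k V] [FiniteDimensional k W] {m n r : ℕ}
    (hV : Module.finrank k V = n) (hW : Module.finrank k W = m) (f : V →ₗ[k] W)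
    (hf : Module.finrank k (LinearMap.range f) = r) :
    ∃ (b : Module.Basis (Fin n) k V) (c : Module.Basis (Fin m) k W),
      LinearMap.toMatrix b c f = rankForm k m n r := by
  obtain ⟨Q, hQ⟩ := Submodule.exists_isCompl (LinearMap.ker f)
  obtain ⟨C, hC⟩ := Submodule.exists_isCompl (LinearMap.range f)
  let eQ := LinearMap.kerComplementEquivRange f hQ.symm
  have hQr : Module.finrank k Q = r := by rw [← hf]; exact eQ.finrank_eq
  have h1 := Submodule.finrank_add_eq_of_isCompl hQ.symm
  have h2 := Submodule.finrank_add_eq_of_isCompl hC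
  rw [hQr, hV] at h1
  rw [hf, hW] at h2
  let bQ : Module.Basis (Fin r) k Q := Module.finBasisOfFinrankEq k Q hQr
  let bK := Module.finBasis k (LinearMap.ker f)
  let bC := Module.finBasis k C
  let en := finSumFinEquiv.trans (finCongr h1)
  let em := finSumFinEquiv.trans (finCongr h2)
  let b := ((bQ.prod bK).map (Submodule.prodEquivOfIsCompl Q _ hQ.symm)).reindex en
  let c := (((bQ.map eQ).prod bC).map (Submodule.prodEquivOfIsCompl _ C hC)).reindex em
  refine ⟨b, c, ?_⟩
  ext i j
  rw [LinearMap.toMatrix_apply]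
  obtain ⟨j', rfl⟩ := en.surjective j
  rcases j' with j' | j'
  · have hb : f (b (en (Sum.inl j'))) = c (em (Sum.inl j')) := by
      simp only [b, c, Module.Basis.reindex_apply, Equiv.symm_apply_apply, Module.Basis.map_apply]
      simp [eQ, LinearMap.kerComplementEquivRange]
    rw [hb, Module.Basis.repr_self, Finsupp.single_apply]
    simp only [rankForm, Matrix.of_apply]
    congr 1
    simp only [em, en, Fin.ext_iff, Equiv.trans_apply, finSumFinEquiv_apply_left, finCongr_apply,
      Fin.val_cast, Fin.val_castAdd, eq_iff_iff]
    have := j'.2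
    omega
  · have hb : f (b (en (Sum.inr j'))) = 0 := by
      simp only [b, Module.Basis.reindex_apply, Equiv.symm_apply_apply, Module.Basis.map_apply]
      simp
    rw [hb, map_zero]
    simp only [rankForm, Matrix.of_apply]
    rw [if_neg]
    · rfl
    simp [en, finSumFinEquiv_apply_right]
    omega

theorem exists_eq_mul_rankForm_mul [Field k] {m n r : ℕ} {x : Matrix (Fin m) (Fin n) k}
    (hx : x.rank = r) : ∃ (g g' : Matrix (Fin m) (Fin m) k) (h h' : Matrix (Fin n) (Fin n) k),
      g * g' = 1 ∧ g' * g = 1 ∧ h * h' = 1 ∧ h' * h = 1 ∧ x = g * rankForm k m n r * h := by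
  obtain ⟨b, c, hbc⟩ := exists_basis_rankForm (r := r) (Module.finrank_fin_fun k)
    (Module.finrank_fin_fun k) (Matrix.toLin' x) (by rw [← hx]; rfl)
  let b₀ := Pi.basisFun k (Fin n)
  let c₀ := Pi.basisFun k (Fin m)
  refine ⟨c₀.toMatrix c, c.toMatrix c₀, b.toMatrix b₀, b₀.toMatrix b,
    c₀.toMatrix_mul_toMatrix_flip c, c.toMatrix_mul_toMatrix_flip c₀,
    b.toMatrix_mul_toMatrix_flip b₀, b₀.toMatrix_mul_toMatrix_flip b, ?_⟩
  rw [← hbc, basis_toMatrix_mul_linearMap_toMatrix_mul_basis_toMatrix]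
  ext i j
  simp [b₀, c₀, LinearMap.toMatrix_apply]

end RankForm

/-! ### Tangent spaces and polynomial curves -/

theorem derivative_aeval_polynomial {ι : Type*} [Fintype ι] (γ : ι → Polynomial ℂ)
    (f : MvPolynomial ι ℂ) : Polynomial.derivative (aeval γ f) =
      ∑ i, aeval γ (pderiv i f) * Polynomial.derivative (γ i) := by
  classical
  induction f using MvPolynomial.induction_on with
  | C a => simp [Polynomial.algebraMap_eq]
  | add p q hp hq => simp [hp, hq, add_mul, Finset.sum_add_distrib]
  | mul_X p j hp =>
    have hi : ∀ i, aeval γ (pderiv i (p * X j)) * Polynomial.derivative (γ i) =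
        aeval γ (pderiv i p) * Polynomial.derivative (γ i) * γ j +
          if i = j then aeval γ p * Polynomial.derivative (γ j) else 0 := by
      intro i
      rw [pderiv_mul, map_add, map_mul, map_mul, aeval_X, pderiv_X]
      split_ifs with h
      · subst h
        rw [Pi.single_eq_same, map_one]
        ring
      · rw [Pi.single_eq_of_ne (Ne.symm h), map_zero]
        ring
    rw [Finset.sum_congr rfl fun i _ => hi i, Finset.sum_add_distrib, ← Finset.sum_mul, ← hp,
      Finset.sum_ite_eq' Finset.univ j, if_pos (Finset.mem_univ j), map_mul, aeval_X,
      Polynomial.derivative_mul]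

theorem eval_aeval_polynomial {ι : Type*} (γ : ι → Polynomial ℂ) (f : MvPolynomial ι ℂ) (t : ℂ) :
    (aeval γ f).eval t = eval (fun i => (γ i).eval t) f := by
  have : (Polynomial.evalRingHom t).comp (aeval γ).toRingHom =
      eval (fun i => (γ i).eval t) := by
    ext <;> simp
  exact congrArg (fun φ => φ f) this

/-- The chain rule along `x + t v` turns tangency into a question on one-variable polynomials, where
determinants can be differentiated directly. -/
theorem sum_pderiv_mul_eq {ι : Type*} [Fintype ι] (x v : ι → ℂ) (f : MvPolynomial ι ℂ) :
    ∑ i, eval x (pderiv i f) * v i = (Polynomial.derivative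
      (aeval (fun i => Polynomial.C (x i) + Polynomial.X * Polynomial.C (v i)) f)).eval 0 := by
  rw [derivative_aeval_polynomial, Polynomial.eval_finsetSum]
  refine Finset.sum_congr rfl fun i _ => ?_
  rw [Polynomial.eval_mul, eval_aeval_polynomial]
  simp

theorem mem_tangentSpace_of_line {ι : Type} [Fintype ι] {X : Set (ι → ℂ)} {x v : ι → ℂ}
    (h : ∀ t : ℂ, x + t • v ∈ X) : v ∈ tangentSpace X x := by
  intro f hf
  rw [sum_pderiv_mul_eq]
  have : aeval (fun i => Polynomial.C (x i) + Polynomial.X * Polynomial.C (v i)) f = 0 := by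
    refine Polynomial.funext fun t => ?_
    rw [eval_aeval_polynomial, Polynomial.eval_zero, ← mem_vanishingIdeal_iff.1 hf _ (h t),
      aeval_eq_eval]
    refine congrArg (fun y => eval y f) (funext fun i => ?_)
    simp [mul_comm t]
  rw [this]
  simp

/-! ### The tangent spaces of the rank variety -/

/-- A vector indexed by pairs, as a matrix. -/
def matOf (R : Type*) [CommSemiring R] (m n : ℕ) :
    (Fin m × Fin n → R) ≃ₗ[R] Matrix (Fin m) (Fin n) R where
  toFun x := Matrix.of fun i j => x (i, j)
  invFun M p := M p.1 p.2
  map_add' _ _ := rfl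
  map_smul' _ _ := rfl
  left_inv _ := rfl
  right_inv _ := rfl

section RankVariety

variable {m n r : ℕ}

theorem matOf_apply {R : Type*} [CommSemiring R] (x : Fin m × Fin n → R) (i : Fin m) (j : Fin n) :
    matOf R m n x i j = x (i, j) := rfl

theorem mem_rankVariety {x : Fin m × Fin n → ℂ} :
    x ∈ rankVariety m n r ↔ (matOf ℂ m n x).rank ≤ r := Iff.rfl

theorem dotProduct_eq_trace (x y : Fin m × Fin n → ℂ) :
    x ⬝ᵥ y = ((matOf ℂ m n x).transpose * matOf ℂ m n y).trace := by
  simp only [dotProduct, Matrix.trace, Matrix.diag, Matrix.mul_apply, Matrix.transpose_apply,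
    matOf_apply]
  rw [Fintype.sum_prod_type_right]

theorem det_updateRow_block {R : Type*} [CommRing R] {κ : Type*} [Fintype κ] [DecidableEq κ]
    (N : Matrix (κ ⊕ Unit) (κ ⊕ Unit) R) :
    ((Matrix.fromBlocks 1 0 0 0 : Matrix (κ ⊕ Unit) (κ ⊕ Unit) R).updateRow (Sum.inr ())
      (N (Sum.inr ()))).det = N (Sum.inr ()) (Sum.inr ()) := by
  have : (Matrix.fromBlocks 1 0 0 0 : Matrix (κ ⊕ Unit) (κ ⊕ Unit) R).updateRow (Sum.inr ())
      (N (Sum.inr ())) = Matrix.fromBlocks 1 0 N.toBlocks₂₁ N.toBlocks₂₂ := by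
    ext i j
    rcases i with i | i
    · rw [Matrix.updateRow_ne (by simp)]
      rcases j with j | j <;> rfl
    · rw [Matrix.updateRow_self]
      rcases j with j | j <;> rfl
  rw [this, Matrix.det_fromBlocks_zero₁₂, Matrix.det_one, one_mul, Matrix.det_unique]
  rfl

/-- The differential of the determinant at `diag(1, …, 1, 0)` is the last diagonal entry. -/
theorem eval_derivative_det_block {κ : Type*} [Fintype κ] [DecidableEq κ]
    (N : Matrix (κ ⊕ Unit) (κ ⊕ Unit) ℂ) :
    (Polynomial.derivative ((Matrix.fromBlocks 1 0 0 0 : Matrix (κ ⊕ Unit) (κ ⊕ Unit) ℂ).map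
      Polynomial.C + (Polynomial.X : Polynomial ℂ) • N.map Polynomial.C).det).eval 0 =
    N (Sum.inr ()) (Sum.inr ()) := by
  set D := (Matrix.fromBlocks 1 0 0 0 : Matrix (κ ⊕ Unit) (κ ⊕ Unit) ℂ).map
      Polynomial.C + (Polynomial.X : Polynomial ℂ) • N.map Polynomial.C with hD
  have hrow : D = D.updateRow (Sum.inr ())
      ((Polynomial.X : Polynomial ℂ) • (N.map Polynomial.C) (Sum.inr ())) := by
    conv_lhs => rw [← Matrix.updateRow_eq_self D (Sum.inr ())]
    congr 1
    ext1 j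
    rcases j with j | j <;> simp [hD]
  rw [hrow, Matrix.det_updateRow_smul, Polynomial.derivative_mul, Polynomial.derivative_X, one_mul,
    Polynomial.eval_add, Polynomial.eval_mul, Polynomial.eval_X, zero_mul, add_zero,
    ← Polynomial.coe_evalRingHom, RingHom.map_det, ← det_updateRow_block N]
  congr 1
  ext i j
  simp only [RingHom.mapMatrix_apply, Matrix.map_apply, Matrix.updateRow_apply]
  split_ifs
  · simp
  · simp [hD]

/-- The test function is the determinant of size `r + 1` of `y ↦ B y A`, with `B` the rows of `a`
together with `p`, and `A` the columns of `b` together with `q`. It vanishes on rank at most `r`. At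
`x` the matrix is `diag(1, …, 1, 0)`, so the derivative along `v` is the corner entry `p · v q`. -/
theorem dotProduct_mulVec_eq_zero_of_mem_tangentSpace {x v : Fin m × Fin n → ℂ}
    (hv : v ∈ tangentSpace (rankVariety m n r) x) (a : Matrix (Fin r) (Fin m) ℂ)
    (b : Matrix (Fin n) (Fin r) ℂ) (hab : a * matOf ℂ m n x * b = 1)
    {p : Fin m → ℂ} {q : Fin n → ℂ} (hp : Matrix.vecMul p (matOf ℂ m n x) = 0)
    (hq : (matOf ℂ m n x).mulVec q = 0) : p ⬝ᵥ (matOf ℂ m n v).mulVec q = 0 := by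
  let B : Matrix (Fin r ⊕ Unit) (Fin m) ℂ := Matrix.fromRows a (Matrix.replicateRow Unit p)
  let A : Matrix (Fin n) (Fin r ⊕ Unit) ℂ := Matrix.fromCols b (Matrix.replicateCol Unit q)
  let f : MvPolynomial (Fin m × Fin n) ℂ :=
    ((B.map C : Matrix (Fin r ⊕ Unit) (Fin m) (MvPolynomial (Fin m × Fin n) ℂ)) *
      matOf (MvPolynomial (Fin m × Fin n) ℂ) m n X *
      (A.map C : Matrix (Fin n) (Fin r ⊕ Unit) (MvPolynomial (Fin m × Fin n) ℂ))).det
  have hf : f ∈ vanishingIdeal ℂ (rankVariety m n r) := by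
    rw [mem_vanishingIdeal_iff]
    intro y hy
    have h1 : aeval y f = (B * matOf ℂ m n y * A).det := by
      change (aeval y).toRingHom f = _
      rw [RingHom.map_det, RingHom.mapMatrix_apply, Matrix.map_mul, Matrix.map_mul]
      congr 3 <;> ext i j <;> simp [matOf_apply]
    rw [h1]
    by_contra hne
    have h2 := Matrix.rank_of_det_ne_zero hne
    have h3 := (Matrix.rank_mul_le_left (B * matOf ℂ m n y) A).trans
      (Matrix.rank_mul_le_right B (matOf ℂ m n y))
    rw [h2] at h3
    have h4 := h3.trans (mem_rankVariety.1 hy)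
    simp at h4
  have h := hv f hf
  rw [sum_pderiv_mul_eq] at h
  have hN : aeval (fun i => Polynomial.C (x i) + Polynomial.X * Polynomial.C (v i)) f =
      ((Matrix.fromBlocks 1 0 0 0 : Matrix (Fin r ⊕ Unit) (Fin r ⊕ Unit) ℂ).map
      Polynomial.C + (Polynomial.X : Polynomial ℂ) •
        (B * matOf ℂ m n v * A).map Polynomial.C).det := by
    change (aeval _).toRingHom f = _
    rw [RingHom.map_det, RingHom.mapMatrix_apply, Matrix.map_mul, Matrix.map_mul]
    congr 1
    have hx : B * matOf ℂ m n x * A = Matrix.fromBlocks 1 0 0 0 := by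
      simp only [B, A]
      rw [Matrix.fromRows_mul, Matrix.fromRows_mul_fromCols, hab, ← Matrix.replicateRow_vecMul, hp,
        Matrix.mul_assoc, ← Matrix.replicateCol_mulVec, hq]
      congr 1
      · ext; simp
      · ext; simp
      · ext; simp
    rw [← hx, Matrix.map_mul, Matrix.map_mul, Matrix.map_mul, Matrix.map_mul, ← Matrix.smul_mul,
      ← Matrix.mul_smul, ← Matrix.add_mul, ← Matrix.mul_add]
    refine congrArg₂ (· * ·) (congrArg₂ (· * ·) ?_ ?_) ?_
    · ext i j; simp
    · ext i j; simp [matOf_apply]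
    · ext i j; simp
  rw [hN, eval_derivative_det_block] at h
  rw [← h, Matrix.dotProduct_mulVec]
  simp [B, A, Matrix.mul_apply, dotProduct, Matrix.vecMul]

end RankVariety

/-! ### The Euclidean distance correspondence of the rank variety -/

section EDCorrespondence

variable {m n r : ℕ}

theorem mul_mem_tangentSpace_rankVariety {x : Fin m × Fin n → ℂ} (hx : x ∈ rankVariety m n r)
    (A : Matrix (Fin m) (Fin m) ℂ) :
    (matOf ℂ m n).symm (A * matOf ℂ m n x) ∈ tangentSpace (rankVariety m n r) x := by
  refine mem_tangentSpace_of_line fun t => ?_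
  rw [mem_rankVariety, map_add, map_smul, LinearEquiv.apply_symm_apply]
  have : matOf ℂ m n x + t • (A * matOf ℂ m n x) = (1 + t • A) * matOf ℂ m n x := by
    rw [Matrix.add_mul, Matrix.one_mul, Matrix.smul_mul]
  rw [this]
  exact (Matrix.rank_mul_le_right _ _).trans hx

theorem mul_mem_tangentSpace_rankVariety' {x : Fin m × Fin n → ℂ} (hx : x ∈ rankVariety m n r)
    (B : Matrix (Fin n) (Fin n) ℂ) :
    (matOf ℂ m n).symm (matOf ℂ m n x * B) ∈ tangentSpace (rankVariety m n r) x := by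
  refine mem_tangentSpace_of_line fun t => ?_
  rw [mem_rankVariety, map_add, map_smul, LinearEquiv.apply_symm_apply]
  have : matOf ℂ m n x + t • (matOf ℂ m n x * B) = matOf ℂ m n x * (1 + t • B) := by
    rw [Matrix.mul_add, Matrix.mul_one, Matrix.mul_smul]
  rw [this]
  exact (Matrix.rank_mul_le_left _ _).trans hx

/-- In coordinates where `x` is the normal form, tangency means that the block complementary to the
ones vanishes. Determinants of size `r + 1` give necessity. Conversely such a `v` has the form `x B
+ A x`, a sum of directions of lines inside the variety. -/
theorem mem_tangentSpace_rankVariety_iff (hrn : r ≤ n) (hrm : r ≤ m) {x v : Fin m × Fin n → ℂ}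
    {g g' : Matrix (Fin m) (Fin m) ℂ} {h h' : Matrix (Fin n) (Fin n) ℂ} (hgg' : g * g' = 1)
    (hg'g : g' * g = 1) (hhh' : h * h' = 1) (hh'h : h' * h = 1)
    (hx : matOf ℂ m n x = g * rankForm ℂ m n r * h) :
    v ∈ tangentSpace (rankVariety m n r) x ↔
      (1 - rankForm ℂ m m r) * (g' * matOf ℂ m n v * h') * (1 - rankForm ℂ n n r) = 0 := by
  have hE₁ : rankForm ℂ m m r * rankForm ℂ m n r = rankForm ℂ m n r := by
    rw [rankForm_mul hrm, min_self]
  have hE₂ : rankForm ℂ m n r * rankForm ℂ n n r = rankForm ℂ m n r := by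
    rw [rankForm_mul hrn, min_self]
  have hE₃ : rankForm ℂ m n r * rankForm ℂ n m r = rankForm ℂ m m r := by
    rw [rankForm_mul hrn, min_self]
  have hE₄ : rankForm ℂ n m r * rankForm ℂ m n r = rankForm ℂ n n r := by
    rw [rankForm_mul hrm, min_self]
  constructor
  · intro hv
    ext i j
    have hab : (rankForm ℂ r m r * g') * matOf ℂ m n x * (h' * rankForm ℂ n r r) = 1 := by
      calc _ = rankForm ℂ r m r * (g' * g) * rankForm ℂ m n r * (h * h') * rankForm ℂ n r r := by
            rw [hx]; simp only [Matrix.mul_assoc]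
        _ = 1 := by
            rw [hg'g, hhh', Matrix.mul_one, Matrix.mul_one, rankForm_mul hrm, min_self,
              rankForm_mul hrn, min_self, rankForm_self]
    have hp : ((1 - rankForm ℂ m m r) * g') * matOf ℂ m n x = 0 := by
      calc _ = (1 - rankForm ℂ m m r) * (g' * g) * rankForm ℂ m n r * h := by
            rw [hx]; simp only [Matrix.mul_assoc]
        _ = 0 := by
            rw [hg'g, Matrix.mul_one, Matrix.sub_mul, hE₁, Matrix.one_mul, sub_self, Matrix.zero_mul]
    have hq : matOf ℂ m n x * (h' * (1 - rankForm ℂ n n r)) = 0 := by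
      calc _ = g * (rankForm ℂ m n r * (h * h') * (1 - rankForm ℂ n n r)) := by
            rw [hx]; simp only [Matrix.mul_assoc]
        _ = 0 := by
            rw [hhh', Matrix.mul_one, Matrix.mul_sub, hE₂, Matrix.mul_one, sub_self, Matrix.mul_zero]
    -- The rows of `(1 - E) g'` kill `x` from the left and the columns of `h' (1 - E)` from the
    -- right, where `E` is the normal-form projection of the relevant size.
    have key := dotProduct_mulVec_eq_zero_of_mem_tangentSpace hv _ _ hab
      (p := ((1 - rankForm ℂ m m r) * g') i) (q := (h' * (1 - rankForm ℂ n n r)).col j)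
      (congrFun hp i) (funext fun k => congrFun (congrFun hq k) j)
    have h2 : (1 - rankForm ℂ m m r) * (g' * matOf ℂ m n v * h') * (1 - rankForm ℂ n n r) =
        ((1 - rankForm ℂ m m r) * g') * (matOf ℂ m n v * (h' * (1 - rankForm ℂ n n r))) := by
      simp only [Matrix.mul_assoc]
    rw [h2]
    exact key
  · intro hv
    have hxr : x ∈ rankVariety m n r := by
      rw [mem_rankVariety, hx]
      exact ((Matrix.rank_mul_le_left _ _).trans (Matrix.rank_mul_le_right _ _)).trans
        (rank_rankForm hrm hrn).le
    set V := g' * matOf ℂ m n v * h' with hV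
    have hv' : matOf ℂ m n v = g * V * h := by
      calc _ = (g * g') * matOf ℂ m n v * (h' * h) := by
            rw [hgg', hh'h, Matrix.one_mul, Matrix.mul_one]
        _ = _ := by rw [hV]; simp only [Matrix.mul_assoc]
    have hV' : V = rankForm ℂ m m r * V + (V - rankForm ℂ m m r * V) * rankForm ℂ n n r := by
      rw [Matrix.mul_sub, Matrix.mul_one, Matrix.sub_mul, Matrix.one_mul, sub_eq_zero] at hv
      rw [← hv]
      abel
    have hv'' : matOf ℂ m n v = matOf ℂ m n x * (h' * rankForm ℂ n m r * V * h) +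
        (g * (V - rankForm ℂ m m r * V) * rankForm ℂ n m r * g') * matOf ℂ m n x := by
      calc matOf ℂ m n v = g * (rankForm ℂ m n r * rankForm ℂ n m r * V +
            (V - rankForm ℂ m m r * V) * (rankForm ℂ n m r * rankForm ℂ m n r)) * h := by
            rw [hE₃, hE₄, ← hV', hv']
        _ = g * rankForm ℂ m n r * (h * h') * rankForm ℂ n m r * V * h +
            g * (V - rankForm ℂ m m r * V) * rankForm ℂ n m r * (g' * g) * rankForm ℂ m n r * h := by
            rw [hhh', hg'g]
            simp only [Matrix.mul_assoc, Matrix.mul_one, Matrix.mul_add, Matrix.add_mul]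
        _ = _ := by rw [hx]; simp only [Matrix.mul_assoc]
    rw [← LinearEquiv.symm_apply_apply (matOf ℂ m n) v, hv'', map_add]
    exact add_mem (mul_mem_tangentSpace_rankVariety' hxr _) (mul_mem_tangentSpace_rankVariety hxr _)

/-- Left and right multiplication by invertible matrices moves any matrix of rank `r` to any other
and carries tangent spaces along. -/
theorem finrank_tangentSpace_rankVariety_le (hrn : r ≤ n) (hrm : r ≤ m) {x y : Fin m × Fin n → ℂ}
    (hx : (matOf ℂ m n x).rank = r) (hy : (matOf ℂ m n y).rank = r) :
    Module.finrank ℂ (tangentSpace (rankVariety m n r) x) ≤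
      Module.finrank ℂ (tangentSpace (rankVariety m n r) y) := by
  obtain ⟨g, g', h, h', hgg', hg'g, hhh', hh'h, hxg⟩ := exists_eq_mul_rankForm_mul hx
  obtain ⟨k, k', l, l', hkk', hk'k, hll', hl'l, hyk⟩ := exists_eq_mul_rankForm_mul hy
  let φ : (Fin m × Fin n → ℂ) →ₗ[ℂ] (Fin m × Fin n → ℂ) :=
    { toFun := fun v => (matOf ℂ m n).symm (k * (g' * matOf ℂ m n v * h') * l)
      map_add' := fun v w => by
        simp only [map_add, Matrix.mul_add, Matrix.add_mul]
      map_smul' := fun c v => by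
        simp only [map_smul, Matrix.mul_smul, Matrix.smul_mul, RingHom.id_apply] }
  have hφ : ∀ v, k' * matOf ℂ m n (φ v) * l' = g' * matOf ℂ m n v * h' := fun v => by
    calc k' * matOf ℂ m n (φ v) * l' = (k' * k) * (g' * matOf ℂ m n v * h') * (l * l') := by
          change k' * (k * (g' * matOf ℂ m n v * h') * l) * l' = _
          simp only [Matrix.mul_assoc]
      _ = _ := by rw [hk'k, hll', Matrix.one_mul, Matrix.mul_one]
  have hinj : Function.Injective φ := by
    intro v w hvw
    have h1 : g' * matOf ℂ m n v * h' = g' * matOf ℂ m n w * h' := by rw [← hφ, ← hφ, hvw]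
    refine (matOf ℂ m n).injective ?_
    calc matOf ℂ m n v = g * (g' * matOf ℂ m n v * h') * h := by
          rw [← Matrix.mul_assoc, ← Matrix.mul_assoc, hgg', Matrix.mul_assoc, hh'h, Matrix.one_mul,
            Matrix.mul_one]
      _ = matOf ℂ m n w := by
          rw [h1, ← Matrix.mul_assoc, ← Matrix.mul_assoc, hgg', Matrix.mul_assoc, hh'h,
            Matrix.one_mul, Matrix.mul_one]
  rw [(Submodule.equivMapOfInjective φ hinj _).finrank_eq]
  refine Submodule.finrank_mono ?_
  rintro _ ⟨v, hv, rfl⟩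
  rw [mem_tangentSpace_rankVariety_iff hrn hrm hkk' hk'k hll' hl'l hyk, hφ]
  exact (mem_tangentSpace_rankVariety_iff hrn hrm hgg' hg'g hhh' hh'h hxg).1 hv

theorem Matrix.rank_add_le {k α β : Type*} [Field k] [Fintype α] [Fintype β] (A B : Matrix α β k) :
    (A + B).rank ≤ A.rank + B.rank := by
  refine (Submodule.finrank_mono ?_).trans
    (Submodule.finrank_add_le_finrank_add_finrank (LinearMap.range A.mulVecLin)
      (LinearMap.range B.mulVecLin))
  rintro _ ⟨v, rfl⟩
  rw [Matrix.mulVecLin_add]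
  exact Submodule.add_mem_sup ⟨v, rfl⟩ ⟨v, rfl⟩

/-- Adding a multiple of a matrix unit raises the rank by at most one, so each coordinate direction
spans a line inside the variety. -/
theorem tangentSpace_rankVariety_of_lt {x : Fin m × Fin n → ℂ}
    (hx : (matOf ℂ m n x).rank < r) : tangentSpace (rankVariety m n r) x = ⊤ := by
  rw [eq_top_iff]
  intro v _
  rw [pi_eq_sum_univ v]
  refine sum_mem fun p _ => Submodule.smul_mem _ _ (mem_tangentSpace_of_line fun t => ?_)
  rw [mem_rankVariety, map_add, map_smul]
  have h1 : matOf ℂ m n (fun q => if p = q then 1 else 0) =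
      Matrix.vecMulVec (Pi.single p.1 1) (Pi.single p.2 1) := by
    ext i j
    simp only [matOf_apply, Matrix.vecMulVec_apply, Pi.single_apply, Prod.ext_iff]
    split_ifs <;> simp_all
  rw [h1, ← Matrix.smul_vecMulVec]
  refine (Matrix.rank_add_le _ _).trans ?_
  have := Matrix.rank_vecMulVec_le (t • Pi.single p.1 1 : Fin m → ℂ) (Pi.single p.2 1 : Fin n → ℂ)
  omega

theorem mem_smoothLocus_rankVariety_iff (hrn : r < n) (hnm : n ≤ m) {x : Fin m × Fin n → ℂ} :
    x ∈ smoothLocus (rankVariety m n r) ↔ (matOf ℂ m n x).rank = r := by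
  have hrm : r ≤ m := (hrn.trans_le hnm).le
  constructor
  · rintro ⟨hx, hmin⟩
    refine (mem_rankVariety.1 hx).eq_or_lt.resolve_right fun hlt => ?_
    let y := (matOf ℂ m n).symm (rankForm ℂ m n r)
    have hyE : matOf ℂ m n y =
        (1 : Matrix (Fin m) (Fin m) ℂ) * rankForm ℂ m n r * (1 : Matrix (Fin n) (Fin n) ℂ) := by
      rw [Matrix.one_mul, Matrix.mul_one]
      exact (matOf ℂ m n).apply_symm_apply _
    have hy : (matOf ℂ m n y).rank = r := by
      rw [hyE, Matrix.one_mul, Matrix.mul_one, rank_rankForm hrm hrn.le]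
    have h1 := hmin y hy.le
    rw [tangentSpace_rankVariety_of_lt hlt, finrank_top] at h1
    have h2 := Submodule.eq_top_of_finrank_eq (le_antisymm (Submodule.finrank_le _) h1)
    -- The first diagonal position after the `r` ones; it exists because `r < n`. Its matrix unit is
    -- not tangent at the normal form, so the tangent space there is proper.
    let i : Fin m := ⟨r, hrn.trans_le hnm⟩
    let j : Fin n := ⟨r, hrn⟩
    let v := (matOf ℂ m n).symm (Matrix.single i j 1)
    have hv : v ∈ tangentSpace (rankVariety m n r) y := by rw [h2]; trivial
    rw [mem_tangentSpace_rankVariety_iff hrn.le hrm (Matrix.one_mul 1) (Matrix.one_mul 1)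
      (Matrix.one_mul 1) (Matrix.one_mul 1) hyE, Matrix.one_mul, Matrix.mul_one,
      LinearEquiv.apply_symm_apply] at hv
    have h3 := congrFun (congrFun hv i) j
    have h4 : ∀ a : Fin m, rankForm ℂ m m r a i = 0 := fun a => by
      simp only [rankForm, Matrix.of_apply, ite_eq_right_iff]
      rintro ⟨h, h'⟩
      simp only [i] at h
      omega
    have h5 : ∀ b : Fin n, rankForm ℂ n n r j b = 0 := fun b => by
      simp [rankForm, j]
    have h6 : rankForm ℂ m m r * Matrix.single i j (1 : ℂ) = 0 := by
      ext a b
      by_cases hb : b = j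
      · subst hb; simp [h4]
      · simp [hb]
    have h7 : Matrix.single i j (1 : ℂ) * rankForm ℂ n n r = 0 := by
      ext a b
      by_cases ha : a = i
      · subst ha; simp [h5]
      · simp [ha]
    rw [Matrix.sub_mul, h6, Matrix.one_mul, sub_zero, Matrix.mul_sub, h7, Matrix.mul_one,
      sub_zero] at h3
    simp at h3
  · intro hx
    refine ⟨hx.le, fun y hy => ?_⟩
    rcases (mem_rankVariety.1 hy).eq_or_lt with h | h
    · exact finrank_tangentSpace_rankVariety_le hrn.le hrm hx h
    · rw [tangentSpace_rankVariety_of_lt h, finrank_top]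
      exact Submodule.finrank_le _

/-- Orthogonality to all `x B` and all `A x` gives the two matrix equations, by nondegeneracy of the
trace form. Conversely the equations confine the transformed `dᵀ` to the complementary block, where
a tangent vector vanishes, so the trace is zero. -/
theorem forall_mem_tangentSpace_rankVariety_iff (hrn : r ≤ n) (hrm : r ≤ m)
    {x d : Fin m × Fin n → ℂ} (hx : (matOf ℂ m n x).rank = r) :
    (∀ v ∈ tangentSpace (rankVariety m n r) x, d ⬝ᵥ v = 0) ↔
      (matOf ℂ m n x).transpose * matOf ℂ m n d = 0 ∧
      matOf ℂ m n d * (matOf ℂ m n x).transpose = 0 := by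
  constructor
  · intro h
    constructor
    · have h1 : (matOf ℂ m n d).transpose * matOf ℂ m n x = 0 := by
        rw [Matrix.ext_iff_trace_mul_right]
        intro B
        have := h _ (mul_mem_tangentSpace_rankVariety' (r := r) hx.le B)
        rw [dotProduct_eq_trace, LinearEquiv.apply_symm_apply, ← Matrix.mul_assoc] at this
        rw [this, Matrix.zero_mul, Matrix.trace_zero]
      have := congrArg Matrix.transpose h1
      rwa [Matrix.transpose_mul, Matrix.transpose_transpose, Matrix.transpose_zero] at this
    · have h1 : matOf ℂ m n x * (matOf ℂ m n d).transpose = 0 := by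
        rw [Matrix.ext_iff_trace_mul_right]
        intro A
        have := h _ (mul_mem_tangentSpace_rankVariety (r := r) hx.le A)
        rw [dotProduct_eq_trace, LinearEquiv.apply_symm_apply, ← Matrix.mul_assoc,
          Matrix.trace_mul_comm, ← Matrix.mul_assoc] at this
        rw [this, Matrix.zero_mul, Matrix.trace_zero]
      have := congrArg Matrix.transpose h1
      rwa [Matrix.transpose_mul, Matrix.transpose_transpose, Matrix.transpose_zero] at this
  · rintro ⟨h1, h2⟩ v hv
    obtain ⟨g, g', h, h', hgg', hg'g, hhh', hh'h, hxg⟩ := exists_eq_mul_rankForm_mul hx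
    rw [mem_tangentSpace_rankVariety_iff hrn hrm hgg' hg'g hhh' hh'h hxg] at hv
    rw [dotProduct_eq_trace]
    set D := matOf ℂ m n d
    set V := g' * matOf ℂ m n v * h' with hV
    have hv' : matOf ℂ m n v = g * V * h := by
      calc _ = (g * g') * matOf ℂ m n v * (h' * h) := by
            rw [hgg', hh'h, Matrix.one_mul, Matrix.mul_one]
        _ = _ := by rw [hV]; simp only [Matrix.mul_assoc]
    have h1' : D.transpose * matOf ℂ m n x = 0 := by
      have := congrArg Matrix.transpose h1
      rwa [Matrix.transpose_mul, Matrix.transpose_transpose, Matrix.transpose_zero] at this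
    have h2' : matOf ℂ m n x * D.transpose = 0 := by
      have := congrArg Matrix.transpose h2
      rwa [Matrix.transpose_mul, Matrix.transpose_transpose, Matrix.transpose_zero] at this
    have h3 : (h * D.transpose * g) * rankForm ℂ m m r = 0 := by
      calc _ = h * (D.transpose * matOf ℂ m n x) * (h' * rankForm ℂ n m r) := by
            rw [hxg]
            calc _ = h * D.transpose * (g * (rankForm ℂ m n r * (h * h') * rankForm ℂ n m r)) := by
                  rw [hhh', Matrix.mul_one, rankForm_mul hrn, min_self]
                  simp only [Matrix.mul_assoc]
              _ = _ := by simp only [Matrix.mul_assoc]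
        _ = 0 := by rw [h1']; simp
    have h4 : rankForm ℂ n n r * (h * D.transpose * g) = 0 := by
      calc _ = (rankForm ℂ n m r * g') * (matOf ℂ m n x * D.transpose) * g := by
            rw [hxg]
            calc _ = (rankForm ℂ n m r * (g' * g) * rankForm ℂ m n r) * h * D.transpose * g := by
                  rw [hg'g, Matrix.mul_one, rankForm_mul hrm, min_self]
                  simp only [Matrix.mul_assoc]
              _ = _ := by simp only [Matrix.mul_assoc]
        _ = 0 := by rw [h2']; simp
    have h5 : h * D.transpose * g = (1 - rankForm ℂ n n r) * (h * D.transpose * g) *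
        (1 - rankForm ℂ m m r) := by
      rw [Matrix.sub_mul, h4, Matrix.one_mul, sub_zero, Matrix.mul_sub, h3, Matrix.mul_one,
        sub_zero]
    calc (D.transpose * matOf ℂ m n v).trace = (h * D.transpose * g * V).trace := by
          rw [hv', ← Matrix.mul_assoc, Matrix.trace_mul_comm]
          simp only [Matrix.mul_assoc]
      _ = ((h * D.transpose * g) *
          ((1 - rankForm ℂ m m r) * V * (1 - rankForm ℂ n n r))).trace := by
          rw [h5, Matrix.mul_assoc, Matrix.mul_assoc, Matrix.trace_mul_comm, ← h5]
          simp only [Matrix.mul_assoc]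
      _ = 0 := by rw [hv]; simp

theorem mem_edCorrespondence_rankVariety_iff (hrn : r < n) (hnm : n ≤ m)
    {u x : Fin m × Fin n → ℂ} :
    (u, x) ∈ edCorrespondence (rankVariety m n r) ↔ (matOf ℂ m n x).rank = r ∧
      (matOf ℂ m n x).transpose * (matOf ℂ m n x - matOf ℂ m n u) = 0 ∧
      (matOf ℂ m n x - matOf ℂ m n u) * (matOf ℂ m n x).transpose = 0 := by
  change x ∈ smoothLocus (rankVariety m n r) ∧ (∀ v ∈ tangentSpace _ x, (x - u) ⬝ᵥ v = 0) ↔ _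
  rw [mem_smoothLocus_rankVariety_iff hrn hnm]
  refine and_congr_right fun hx => ?_
  rw [forall_mem_tangentSpace_rankVariety_iff hrn.le (hrn.trans_le hnm).le hx, map_sub]

/-- For `r = n` the variety is the whole space. Every point is smooth, even of rank below `n`, so
the rank criterion for smoothness does not apply, and the normal spaces are zero. -/
theorem mem_edCorrespondence_rankVariety_self_iff {u x : Fin m × Fin n → ℂ} :
    (u, x) ∈ edCorrespondence (rankVariety m n n) ↔ x = u := by
  have huniv : ∀ y, y ∈ rankVariety m n n := fun y => Matrix.rank_le_width _
  have htop : ∀ y, tangentSpace (rankVariety m n n) y = ⊤ := fun y => by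
    rw [eq_top_iff]
    exact fun v _ => mem_tangentSpace_of_line fun t => huniv _
  change x ∈ smoothLocus (rankVariety m n n) ∧ (∀ v ∈ tangentSpace _ x, (x - u) ⬝ᵥ v = 0) ↔ _
  constructor
  · rintro ⟨-, h⟩
    rw [htop] at h
    exact sub_eq_zero.1 (dotProduct_eq_zero _ fun w => h w trivial)
  · rintro rfl
    exact ⟨⟨huniv _, fun y _ => by rw [htop, htop]⟩, fun v _ => by simp⟩

end EDCorrespondence

/-! ### Irreducibility from polynomial curves -/

/-- Any two points of `Y` are joined by a polynomial curve, all but finitely many points of which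
lie in `Y`. -/
def PolyConnected {κ : Type*} (Y : Set (κ → ℂ)) : Prop :=
  ∀ y₁ ∈ Y, ∀ y₂ ∈ Y, ∃ (γ : κ → Polynomial ℂ) (q : Polynomial ℂ), q ≠ 0 ∧
    (∀ k, (γ k).eval 0 = y₁ k) ∧ (∀ k, (γ k).eval 1 = y₂ k) ∧
    ∀ t, q.eval t ≠ 0 → (fun k => (γ k).eval t) ∈ Y

/-- If a product vanishes on `Y`, its pullback to a curve in `Y` vanishes for almost all parameters,
hence identically. One factor then vanishes along the curve, in particular at both endpoints. -/
theorem PolyConnected.isPrime_vanishingIdeal {κ : Type*} {Y : Set (κ → ℂ)} (hY : PolyConnected Y)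
    (hne : Y.Nonempty) : (vanishingIdeal ℂ Y).IsPrime := by
  refine ⟨?_, ?_⟩
  · rw [Ideal.ne_top_iff_one, mem_vanishingIdeal_iff]
    intro h
    obtain ⟨y, hy⟩ := hne
    simpa using h y hy
  · intro f₁ f₂ h
    by_contra! hcon
    obtain ⟨h₁, h₂⟩ := hcon
    simp only [mem_vanishingIdeal_iff, not_forall] at h₁ h₂ h
    obtain ⟨y₁, hy₁, hf₁⟩ := h₁
    obtain ⟨y₂, hy₂, hf₂⟩ := h₂
    obtain ⟨γ, q, hq, h0, h1, hmem⟩ := hY y₁ hy₁ y₂ hy₂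
    -- The factor `q` takes care of the parameters at which the curve may leave `Y`.
    have hprod : q * (aeval γ f₁ * aeval γ f₂) = 0 := by
      refine Polynomial.funext fun t => ?_
      rw [Polynomial.eval_mul, Polynomial.eval_zero, ← map_mul, eval_aeval_polynomial]
      by_cases ht : q.eval t = 0
      · rw [ht, zero_mul]
      · have := h _ (hmem t ht)
        rw [aeval_eq_eval] at this
        exact mul_eq_zero_of_right _ this
    rcases mul_eq_zero.1 ((mul_eq_zero.1 hprod).resolve_left hq) with h' | h'
    · apply hf₁
      rw [aeval_eq_eval, ← funext h0]
      change eval _ f₁ = 0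
      rw [← eval_aeval_polynomial, h', Polynomial.eval_zero]
    · apply hf₂
      rw [aeval_eq_eval, ← funext h1]
      change eval _ f₂ = 0
      rw [← eval_aeval_polynomial, h', Polynomial.eval_zero]

/-! ### Irreducibility of the Euclidean distance correspondence -/

/-- The polynomial matrix that is linear in the variable with values `A` at `0` and `B` at `1`. -/
def lineMatrix {α β : Type*} (A B : Matrix α β ℂ) : Matrix α β (Polynomial ℂ) :=
  A.map Polynomial.C + (Polynomial.X : Polynomial ℂ) • (B - A).map Polynomial.C

theorem map_eval_lineMatrix {α β : Type*} (A B : Matrix α β ℂ) (t : ℂ) :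
    (lineMatrix A B).map (Polynomial.evalRingHom t) = A + t • (B - A) := by
  ext i j
  simp [lineMatrix]

section

variable {m n r : ℕ}

/-- The difference of data point and critical point, in terms of the parameters of the
Euclidean distance correspondence. -/
def normalParam {R : Type*} [CommRing R] (G : Matrix (Fin m) (Fin m) R)
    (H : Matrix (Fin n) (Fin n) R) (Z : Matrix (Fin m) (Fin n) R) : Matrix (Fin m) (Fin n) R :=
  G.adjugate.transpose * Z * H.adjugate.transpose

theorem map_normalParam {R S : Type*} [CommRing R] [CommRing S] (φ : R →+* S)
    (G : Matrix (Fin m) (Fin m) R) (H : Matrix (Fin n) (Fin n) R) (Z : Matrix (Fin m) (Fin n) R) :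
    (normalParam G H Z).map φ = normalParam (G.map φ) (H.map φ) (Z.map φ) := by
  have hG := φ.map_adjugate G
  have hH := φ.map_adjugate H
  simp only [RingHom.mapMatrix_apply] at hG hH
  rw [normalParam, normalParam, Matrix.map_mul, Matrix.map_mul, ← hG, ← hH, Matrix.transpose_map,
    Matrix.transpose_map]

theorem map_rankForm {R S : Type*} [CommRing R] [CommRing S] (φ : R →+* S) :
    (rankForm R m n r).map φ = rankForm S m n r := by
  ext i j
  simp [rankForm, apply_ite φ]

/-- With `x = G E H`, the transposed adjugates in `u - x` cancel `Gᵀ` and `Hᵀ` up to determinants,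
and what remains contains `Eᵀ Z` or `Z Eᵀ`. Adjugates rather than inverses keep the parametrization
polynomial. -/
theorem mem_edCorrespondence_of_param (hrn : r < n) (hnm : n ≤ m) {u x : Fin m × Fin n → ℂ}
    {G : Matrix (Fin m) (Fin m) ℂ} {H : Matrix (Fin n) (Fin n) ℂ} {Z : Matrix (Fin m) (Fin n) ℂ}
    (hG : G.det ≠ 0) (hH : H.det ≠ 0) (hZ₁ : (rankForm ℂ m n r).transpose * Z = 0)
    (hZ₂ : Z * (rankForm ℂ m n r).transpose = 0)
    (hx : matOf ℂ m n x = G * rankForm ℂ m n r * H)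
    (hu : matOf ℂ m n u = matOf ℂ m n x + normalParam G H Z) :
    (u, x) ∈ edCorrespondence (rankVariety m n r) := by
  have hrm : r ≤ m := (hrn.trans_le hnm).le
  rw [mem_edCorrespondence_rankVariety_iff hrn hnm]
  refine ⟨?_, ?_, ?_⟩
  · rw [hx, Matrix.rank_mul_eq_left_of_isUnit_det _ _ hH.isUnit,
      Matrix.rank_mul_eq_right_of_isUnit_det _ _ hG.isUnit, rank_rankForm hrm hrn.le]
  · rw [hu, sub_add_cancel_left, Matrix.mul_neg, neg_eq_zero, hx, normalParam]
    simp only [Matrix.transpose_mul]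
    calc _ = H.transpose * ((rankForm ℂ m n r).transpose * (G.adjugate * G).transpose * Z) *
          H.adjugate.transpose := by
            rw [Matrix.transpose_mul]; simp only [Matrix.mul_assoc]
      _ = 0 := by
        rw [Matrix.adjugate_mul, Matrix.transpose_smul, Matrix.transpose_one, Matrix.mul_smul,
          Matrix.mul_one, Matrix.smul_mul, hZ₁]
        simp
  · rw [hu, sub_add_cancel_left, Matrix.neg_mul, neg_eq_zero, hx, normalParam]
    simp only [Matrix.transpose_mul]
    calc _ = G.adjugate.transpose * (Z * (H * H.adjugate).transpose *
          (rankForm ℂ m n r).transpose) * G.transpose := by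
            rw [Matrix.transpose_mul]; simp only [Matrix.mul_assoc]
      _ = 0 := by
        rw [Matrix.mul_adjugate, Matrix.transpose_smul, Matrix.transpose_one, Matrix.mul_smul,
          Matrix.mul_one, Matrix.smul_mul, hZ₂]
        simp

theorem exists_param_of_mem_edCorrespondence (hrn : r < n) (hnm : n ≤ m)
    {u x : Fin m × Fin n → ℂ} (h : (u, x) ∈ edCorrespondence (rankVariety m n r)) :
    ∃ (G : Matrix (Fin m) (Fin m) ℂ) (H : Matrix (Fin n) (Fin n) ℂ) (Z : Matrix (Fin m) (Fin n) ℂ),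
      G.det ≠ 0 ∧ H.det ≠ 0 ∧ (rankForm ℂ m n r).transpose * Z = 0 ∧
      Z * (rankForm ℂ m n r).transpose = 0 ∧ matOf ℂ m n x = G * rankForm ℂ m n r * H ∧
      matOf ℂ m n u = matOf ℂ m n x + normalParam G H Z := by
  rw [mem_edCorrespondence_rankVariety_iff hrn hnm] at h
  obtain ⟨hx, h1, h2⟩ := h
  obtain ⟨g, g', h, h', hgg', hg'g, hhh', hh'h, hxg⟩ := exists_eq_mul_rankForm_mul hx
  have hdg : g.det ≠ 0 := fun h0 => by
    have := congrArg Matrix.det hgg'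
    rw [Matrix.det_mul, h0, zero_mul, Matrix.det_one] at this
    exact zero_ne_one this
  have hdh : h.det ≠ 0 := fun h0 => by
    have := congrArg Matrix.det hhh'
    rw [Matrix.det_mul, h0, zero_mul, Matrix.det_one] at this
    exact zero_ne_one this
  set D := matOf ℂ m n u - matOf ℂ m n x with hD
  rw [← neg_sub, ← hD, Matrix.mul_neg, neg_eq_zero, hxg] at h1
  rw [← neg_sub, ← hD, Matrix.neg_mul, neg_eq_zero, hxg] at h2
  simp only [Matrix.transpose_mul] at h1 h2
  -- The scalar offsets the two determinants by which adjugates differ from inverses.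
  refine ⟨g, h, (g.det⁻¹ * h.det⁻¹) • (g.transpose * D * h.transpose), hdg, hdh, ?_, ?_, hxg, ?_⟩
  · rw [Matrix.mul_smul]
    have : (rankForm ℂ m n r).transpose * (g.transpose * D * h.transpose) =
        h'.transpose * (h.transpose * ((rankForm ℂ m n r).transpose * g.transpose) * D) *
          h.transpose := by
      have e : h'.transpose * h.transpose = 1 := by
        rw [← Matrix.transpose_mul, hhh', Matrix.transpose_one]
      rw [← Matrix.mul_assoc, ← Matrix.mul_assoc, ← Matrix.mul_assoc, ← Matrix.mul_assoc, e,
        Matrix.one_mul]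
    rw [this, h1]
    simp
  · rw [Matrix.smul_mul]
    have : g.transpose * D * h.transpose * (rankForm ℂ m n r).transpose =
        g.transpose * (D * (h.transpose * ((rankForm ℂ m n r).transpose * g.transpose))) *
          g'.transpose := by
      have e : g.transpose * g'.transpose = 1 := by
        rw [← Matrix.transpose_mul, hg'g, Matrix.transpose_one]
      simp only [Matrix.mul_assoc]
      rw [e, Matrix.mul_one]
    rw [this, h2]
    simp
  · have e₁ : g.adjugate.transpose * g.transpose = g.det • (1 : Matrix (Fin m) (Fin m) ℂ) := by
      rw [← Matrix.transpose_mul, Matrix.mul_adjugate, Matrix.transpose_smul, Matrix.transpose_one]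
    have e₂ : h.transpose * h.adjugate.transpose = h.det • (1 : Matrix (Fin n) (Fin n) ℂ) := by
      rw [← Matrix.transpose_mul, Matrix.adjugate_mul, Matrix.transpose_smul, Matrix.transpose_one]
    have : normalParam g h ((g.det⁻¹ * h.det⁻¹) • (g.transpose * D * h.transpose)) = D := by
      calc _ = (g.det⁻¹ * h.det⁻¹) • ((g.adjugate.transpose * g.transpose) * D *
            (h.transpose * h.adjugate.transpose)) := by
              rw [normalParam, Matrix.mul_smul, Matrix.smul_mul]
              simp only [Matrix.mul_assoc]
        _ = D := by
          rw [e₁, e₂, Matrix.smul_mul, Matrix.one_mul, Matrix.mul_smul, Matrix.mul_one, smul_smul,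
            smul_smul]
          have : g.det⁻¹ * h.det⁻¹ * (h.det * g.det) = 1 := by field_simp
          rw [← mul_assoc] at this
          rw [this, one_smul]
    rw [this, hD]
    abel

/-- For `r < n` the parameters `(G, H, Z)` range over the open set `det G · det H ≠ 0` of a linear
space, so a line between two parameter points maps to the required curve. For `r = n` the
correspondence is the diagonal. -/
theorem polyConnected_edCorrespondence (hrn : r ≤ n) (hnm : n ≤ m) :
    PolyConnected ((fun p : (Fin m × Fin n → ℂ) × (Fin m × Fin n → ℂ) => Sum.elim p.1 p.2) ''
      edCorrespondence (rankVariety m n r)) := by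
  rintro _ ⟨⟨u₁, x₁⟩, h₁, rfl⟩ _ ⟨⟨u₂, x₂⟩, h₂, rfl⟩
  rcases hrn.eq_or_lt with rfl | hrn
  · rw [mem_edCorrespondence_rankVariety_self_iff] at h₁ h₂
    subst h₁ h₂
    let γ : Fin m × Fin r → Polynomial ℂ := fun p =>
      Polynomial.C (x₁ p) + Polynomial.X * Polynomial.C (x₂ p - x₁ p)
    refine ⟨Sum.elim γ γ, 1, one_ne_zero, ?_, ?_, fun t _ => ⟨(fun p => (γ p).eval t,
      fun p => (γ p).eval t), mem_edCorrespondence_rankVariety_self_iff.2 rfl, ?_⟩⟩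
    · rintro (p | p) <;> simp [γ]
    · rintro (p | p) <;> simp [γ]
    · ext (p | p) <;> rfl
  obtain ⟨G₁, H₁, Z₁, hG₁, hH₁, hEZ₁, hZE₁, hx₁, hu₁⟩ :=
    exists_param_of_mem_edCorrespondence hrn hnm h₁
  obtain ⟨G₂, H₂, Z₂, hG₂, hH₂, hEZ₂, hZE₂, hx₂, hu₂⟩ :=
    exists_param_of_mem_edCorrespondence hrn hnm h₂
  let G := lineMatrix G₁ G₂
  let H := lineMatrix H₁ H₂
  let Z := lineMatrix Z₁ Z₂
  let x := G * rankForm (Polynomial ℂ) m n r * H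
  let u := x + normalParam G H Z
  have hx : ∀ t, x.map (Polynomial.evalRingHom t) = G.map (Polynomial.evalRingHom t) *
      rankForm ℂ m n r * H.map (Polynomial.evalRingHom t) := fun t => by
    rw [Matrix.map_mul, Matrix.map_mul, map_rankForm]
  have hu : ∀ t, u.map (Polynomial.evalRingHom t) = x.map (Polynomial.evalRingHom t) +
      normalParam (G.map (Polynomial.evalRingHom t)) (H.map (Polynomial.evalRingHom t))
        (Z.map (Polynomial.evalRingHom t)) := fun t => by
    rw [← map_normalParam, Matrix.map_add _ (map_add _)]
  have hdet : ∀ (k : ℕ) (M : Matrix (Fin k) (Fin k) (Polynomial ℂ)) (t : ℂ),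
      M.det.eval t = (M.map (Polynomial.evalRingHom t)).det := fun k M t =>
    (Polynomial.evalRingHom t).map_det M
  have h0 : ∀ (k l : ℕ) (A B : Matrix (Fin k) (Fin l) ℂ),
      (lineMatrix A B).map (Polynomial.evalRingHom 0) = A := fun k l A B => by
    rw [map_eval_lineMatrix, zero_smul, add_zero]
  have h1 : ∀ (k l : ℕ) (A B : Matrix (Fin k) (Fin l) ℂ),
      (lineMatrix A B).map (Polynomial.evalRingHom 1) = B := fun k l A B => by
    rw [map_eval_lineMatrix, one_smul, add_sub_cancel]
  refine ⟨Sum.elim (fun p => u p.1 p.2) (fun p => x p.1 p.2), G.det * H.det, ?_, ?_, ?_, ?_⟩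
  · intro h
    have := congrArg (Polynomial.eval 0) h
    rw [Polynomial.eval_mul, hdet, hdet, h0, h0, Polynomial.eval_zero] at this
    exact mul_ne_zero hG₁ hH₁ this
  · have hx0 := hx 0
    have hu0 := hu 0
    rw [h0, h0, ← hx₁] at hx0
    rw [h0, h0, h0, hx0, ← hu₁] at hu0
    rintro (p | p)
    · exact congrFun (congrFun hu0 p.1) p.2
    · exact congrFun (congrFun hx0 p.1) p.2
  · have hx0 := hx 1
    have hu0 := hu 1
    rw [h1, h1, ← hx₂] at hx0
    rw [h1, h1, h1, hx0, ← hu₂] at hu0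
    rintro (p | p)
    · exact congrFun (congrFun hu0 p.1) p.2
    · exact congrFun (congrFun hx0 p.1) p.2
  · intro t ht
    rw [Polynomial.eval_mul, hdet, hdet, mul_ne_zero_iff] at ht
    refine ⟨((matOf ℂ m n).symm (u.map (Polynomial.evalRingHom t)),
      (matOf ℂ m n).symm (x.map (Polynomial.evalRingHom t))), ?_, ?_⟩
    · refine mem_edCorrespondence_of_param hrn hnm (Z := Z.map (Polynomial.evalRingHom t))
        ht.1 ht.2 ?_ ?_ ?_ ?_
      · rw [map_eval_lineMatrix, Matrix.mul_add, Matrix.mul_smul, Matrix.mul_sub, hEZ₁, hEZ₂]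
        simp
      · rw [map_eval_lineMatrix, Matrix.add_mul, Matrix.smul_mul, Matrix.sub_mul, hZE₁, hZE₂]
        simp
      · rw [LinearEquiv.apply_symm_apply, hx]
      · rw [LinearEquiv.apply_symm_apply, LinearEquiv.apply_symm_apply, hu]
    · ext (p | p) <;> rfl

end

/-! ### Division-free Gram–Schmidt orthogonalization -/

section GramSchmidt

variable {R S : Type*} [CommRing R] [CommRing S] {κ : Type*} [Fintype κ]

/-- Gram–Schmidt orthogonalization with the denominators cleared. -/
def divFreeGramSchmidt (g : ℕ → κ → R) (k : ℕ) : κ → R :=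
  (∏ i : Fin k, divFreeGramSchmidt g i ⬝ᵥ divFreeGramSchmidt g i) • g k -
    ∑ i : Fin k, ((g k ⬝ᵥ divFreeGramSchmidt g i) * ∏ j ∈ Finset.univ.erase i,
      divFreeGramSchmidt g j ⬝ᵥ divFreeGramSchmidt g j) • divFreeGramSchmidt g i
termination_by k
decreasing_by all_goals exact Fin.is_lt _

theorem divFreeGramSchmidt_dotProduct_of_lt (g : ℕ → κ → R) (k : ℕ) :
    ∀ i < k, divFreeGramSchmidt g k ⬝ᵥ divFreeGramSchmidt g i = 0 := by
  induction k using Nat.strong_induction_on with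
  | _ k ih =>
    intro i hi
    rw [divFreeGramSchmidt, sub_dotProduct, smul_dotProduct, sum_dotProduct,
      Finset.sum_eq_single (⟨i, hi⟩ : Fin k)]
    · rw [smul_dotProduct, smul_eq_mul, smul_eq_mul,
        ← Finset.mul_prod_erase Finset.univ _ (Finset.mem_univ (⟨i, hi⟩ : Fin k))]
      ring
    · intro j _ hj
      rw [smul_dotProduct]
      have : divFreeGramSchmidt g j ⬝ᵥ divFreeGramSchmidt g i = 0 := by
        rcases lt_trichotomy j.val i with h | h | h
        · rw [dotProduct_comm]; exact ih i hi _ h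
        · exact absurd (Fin.ext h) hj
        · exact ih j j.2 _ h
      rw [this, smul_zero]
    · simp

theorem divFreeGramSchmidt_dotProduct (g : ℕ → κ → R) {i j : ℕ} (h : i ≠ j) :
    divFreeGramSchmidt g i ⬝ᵥ divFreeGramSchmidt g j = 0 := by
  rcases h.lt_or_gt with h | h
  · rw [dotProduct_comm]; exact divFreeGramSchmidt_dotProduct_of_lt g j i h
  · exact divFreeGramSchmidt_dotProduct_of_lt g i j h

theorem map_dotProduct (φ : R →+* S) (v w : κ → R) : φ (v ⬝ᵥ w) = (φ ∘ v) ⬝ᵥ (φ ∘ w) := by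
  simp [dotProduct]

/-- The absence of division makes the construction commute with evaluating polynomial entries, which
identifies the endpoints of the curve built from it. -/
theorem map_divFreeGramSchmidt (φ : R →+* S) (g : ℕ → κ → R) (k : ℕ) :
    φ ∘ divFreeGramSchmidt g k = divFreeGramSchmidt (fun i => φ ∘ g i) k := by
  induction k using Nat.strong_induction_on with
  | _ k ih =>
    ext a
    rw [divFreeGramSchmidt, divFreeGramSchmidt]
    simp only [Function.comp_apply, Pi.sub_apply, Pi.smul_apply, Finset.sum_apply, smul_eq_mul,
      map_sub, map_mul, map_prod, map_sum, map_dotProduct]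
    have ih' : ∀ (i : Fin k), φ ∘ divFreeGramSchmidt g i =
        divFreeGramSchmidt (fun i => φ ∘ g i) i := fun i => ih i i.2
    have ih'' : ∀ (i : Fin k) (a : κ), φ (divFreeGramSchmidt g i a) =
        divFreeGramSchmidt (fun i => φ ∘ g i) i a := fun i a => congrFun (ih' i) a
    simp only [ih', ih'']

theorem divFreeGramSchmidt_of_orthogonal {g : ℕ → κ → R}
    (hg : ∀ i j, i ≠ j → g i ⬝ᵥ g j = 0) (k : ℕ) :
    divFreeGramSchmidt g k =
      (∏ i : Fin k, divFreeGramSchmidt g i ⬝ᵥ divFreeGramSchmidt g i) • g k := by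
  induction k using Nat.strong_induction_on with
  | _ k ih =>
    conv_lhs => rw [divFreeGramSchmidt]
    rw [Finset.sum_eq_zero, sub_zero]
    intro i _
    have : g k ⬝ᵥ divFreeGramSchmidt g i = 0 := by
      rw [ih i i.2, dotProduct_smul, hg k i i.2.ne', smul_zero]
    rw [this, zero_mul, zero_smul]

/-- On an orthogonal family the process only rescales. The scale factors are nonzero because the
vectors are not isotropic, which over a general field has to be assumed. -/
theorem exists_divFreeGramSchmidt_eq_smul {k : Type*} [Field k] {g : ℕ → κ → k}
    (hg : ∀ i j, i ≠ j → g i ⬝ᵥ g j = 0) (n : ℕ) (hn : ∀ i < n, g i ⬝ᵥ g i ≠ 0) :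
    ∀ l ≤ n, ∃ c : k, c ≠ 0 ∧ divFreeGramSchmidt g l = c • g l := by
  intro l
  induction l using Nat.strong_induction_on with
  | _ l ih =>
    intro hl
    refine ⟨_, ?_, divFreeGramSchmidt_of_orthogonal hg l⟩
    rw [Finset.prod_ne_zero_iff]
    intro i _
    obtain ⟨c, hc, h⟩ := ih i i.2 (i.2.le.trans hl)
    rw [h, smul_dotProduct, dotProduct_smul]
    exact mul_ne_zero hc (mul_ne_zero hc (hn i (i.2.trans_le hl)))

end GramSchmidt

/-- Two matrices with orthonormal columns are joined, up to scaling of the columns, by a polynomial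
curve of matrices with orthogonal columns. -/
theorem exists_orthogonal_curve {κ : Type*} [Fintype κ] {n : ℕ} {A B : Matrix κ (Fin n) ℂ}
    (hA : A.transpose * A = 1) (hB : B.transpose * B = 1) :
    ∃ (V : Matrix κ (Fin n) (Polynomial ℂ)) (b : Fin n → Polynomial ℂ) (c d : Fin n → ℂ),
      V.transpose * V = Matrix.diagonal b ∧ (∀ i, c i ≠ 0) ∧ (∀ i, d i ≠ 0) ∧
      V.map (Polynomial.evalRingHom 0) = A * Matrix.diagonal c ∧
      V.map (Polynomial.evalRingHom 1) = B * Matrix.diagonal d := by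
  let L := lineMatrix A B
  -- Gram–Schmidt is applied to the columns of the line from `A` to `B`. The zero padding past `n`
  -- only serves the indexing by `ℕ`.
  let g : ℕ → κ → Polynomial ℂ := fun i a => if h : i < n then L a ⟨i, h⟩ else 0
  let V : Matrix κ (Fin n) (Polynomial ℂ) := Matrix.of fun a i => divFreeGramSchmidt g i a
  have key : ∀ (t : ℂ) (M : Matrix κ (Fin n) ℂ), L.map (Polynomial.evalRingHom t) = M →
      M.transpose * M = 1 → ∃ c : Fin n → ℂ, (∀ i, c i ≠ 0) ∧
        V.map (Polynomial.evalRingHom t) = M * Matrix.diagonal c := by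
    intro t M hM hMM
    let g' : ℕ → κ → ℂ := fun i a => if h : i < n then M a ⟨i, h⟩ else 0
    have hg : (fun i => Polynomial.evalRingHom t ∘ g i) = g' := by
      funext i a
      simp only [g, g', Function.comp_apply]
      split_ifs with h
      · rw [← hM]; rfl
      · exact map_zero _
    have hdot : ∀ (i j : ℕ) (hi : i < n) (hj : j < n),
        g' i ⬝ᵥ g' j = (1 : Matrix (Fin n) (Fin n) ℂ) ⟨i, hi⟩ ⟨j, hj⟩ := by
      intro i j hi hj
      rw [← hMM]
      simp only [g', hi, hj, dif_pos]
      rfl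
    have horth : ∀ i j, i ≠ j → g' i ⬝ᵥ g' j = 0 := by
      intro i j hij
      by_cases hi : i < n
      · by_cases hj : j < n
        · rw [hdot i j hi hj, Matrix.one_apply_ne]
          simpa using hij
        · have : g' j = 0 := by funext a; simp [g', hj]
          rw [this, dotProduct_zero]
      · have : g' i = 0 := by funext a; simp [g', hi]
        rw [this, zero_dotProduct]
    have hne : ∀ i < n, g' i ⬝ᵥ g' i ≠ 0 := by
      intro i hi
      rw [hdot i i hi hi, Matrix.one_apply_eq]
      exact one_ne_zero
    choose c hc hcV using fun i : Fin n =>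
      exists_divFreeGramSchmidt_eq_smul horth n hne i i.2.le
    refine ⟨c, hc, ?_⟩
    ext a i
    have h1 := congrFun (map_divFreeGramSchmidt (Polynomial.evalRingHom t) g i) a
    rw [hg, hcV] at h1
    rw [Matrix.mul_diagonal]
    refine h1.trans ?_
    simp [g', mul_comm]
  obtain ⟨c, hc, hcV⟩ := key 0 A (by rw [map_eval_lineMatrix]; simp) hA
  obtain ⟨d, hd, hdV⟩ := key 1 B (by rw [map_eval_lineMatrix]; simp) hB
  refine ⟨V, fun i => divFreeGramSchmidt g i ⬝ᵥ divFreeGramSchmidt g i, c, d, ?_, hc, hd, hcV, hdV⟩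
  ext1 i j
  by_cases hij : i = j
  · subst hij
    rw [Matrix.diagonal_apply_eq]
    rfl
  · rw [Matrix.diagonal_apply_ne _ hij]
    exact divFreeGramSchmidt_dotProduct g (fun h => hij (Fin.ext h))

/-! ### Matrices with labelled squares of singular values -/

/-- The pairs `(u, l)` such that `uᵀ u` is invertible with distinct eigenvalues, listed by `l`. -/
def eigenSet (m n : ℕ) : Set ((Fin m × Fin n → ℂ) × (Fin n → ℂ)) :=
  {p | ((matOf ℂ m n p.1).transpose * matOf ℂ m n p.1).charpoly =
    ∏ i, (Polynomial.X - Polynomial.C (p.2 i)) ∧ Function.Injective p.2 ∧ ∀ i, p.2 i ≠ 0}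

section EigenSet

variable {m n : ℕ}

theorem charpoly_eq_of_mul_eq_mul_diagonal {k : Type*} [Field k] {S V : Matrix (Fin n) (Fin n) k}
    {l : Fin n → k} (h : S * V = V * Matrix.diagonal l) (hV : V.det ≠ 0) :
    S.charpoly = ∏ i, (Polynomial.X - Polynomial.C (l i)) := by
  have h1 : S = V * Matrix.diagonal l * V⁻¹ := by
    rw [← h, Matrix.mul_nonsing_inv_cancel_right _ _ hV.isUnit]
  have hu : IsUnit V := (Matrix.isUnit_iff_isUnit_det V).2 hV.isUnit
  obtain ⟨M, rfl⟩ := hu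
  rw [h1, Matrix.charpoly_units_conj, Matrix.charpoly_diagonal]

/-- A complex symmetric matrix with distinct eigenvalues has an orthonormal eigenbasis. -/
theorem exists_orthogonal_diagonalization {S : Matrix (Fin n) (Fin n) ℂ} (hS : S.transpose = S)
    {l : Fin n → ℂ} (hl : Function.Injective l)
    (hchar : S.charpoly = ∏ i, (Polynomial.X - Polynomial.C (l i))) :
    ∃ V : Matrix (Fin n) (Fin n) ℂ, V.transpose * V = 1 ∧ V * V.transpose = 1 ∧
      S = V * Matrix.diagonal l * V.transpose := by
  have hev : ∀ i, Module.End.HasEigenvalue (Matrix.toLin' S) (l i) := by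
    intro i
    rw [Module.End.hasEigenvalue_iff_isRoot_charpoly, Matrix.charpoly_toLin',
      hchar, Polynomial.IsRoot, Polynomial.eval_prod]
    exact Finset.prod_eq_zero (Finset.mem_univ i) (by simp)
  choose v hv using fun i => (hev i).exists_hasEigenvector
  have hindep := Module.End.eigenvectors_linearIndependent' _ l hl v hv
  let A : Matrix (Fin n) (Fin n) ℂ := Matrix.of fun a i => v i a
  have hSA : S * A = A * Matrix.diagonal l := by
    ext a i
    rw [Matrix.mul_diagonal]
    have := congrFun (hv i).apply_eq_smul a
    simpa [mul_comm, A, Matrix.mul_apply, Matrix.mulVec, dotProduct] using this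
  have hdet : A.det ≠ 0 := by
    have : LinearIndependent ℂ A.col := hindep
    rw [Matrix.linearIndependent_cols_iff_isUnit] at this
    exact ((Matrix.isUnit_iff_isUnit_det A).1 this).ne_zero
  have hAS : A.transpose * S = Matrix.diagonal l * A.transpose := by
    have := congrArg Matrix.transpose hSA
    rwa [Matrix.transpose_mul, Matrix.transpose_mul, hS, Matrix.diagonal_transpose] at this
  -- Symmetry of `S` makes `Aᵀ A` commute with a diagonal matrix with distinct entries, so it is
  -- itself diagonal.
  have hcomm : Matrix.diagonal l * (A.transpose * A) = (A.transpose * A) * Matrix.diagonal l := by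
    rw [← Matrix.mul_assoc, ← hAS, Matrix.mul_assoc, hSA, Matrix.mul_assoc]
  let d : Fin n → ℂ := fun i => (A.transpose * A) i i
  have hd : A.transpose * A = Matrix.diagonal d := by
    ext i j
    by_cases hij : i = j
    · subst hij; simp [d]
    · rw [Matrix.diagonal_apply_ne _ hij]
      have := congrFun (congrFun hcomm i) j
      rw [Matrix.diagonal_mul, Matrix.mul_diagonal, mul_comm, ← sub_eq_zero, ← mul_sub] at this
      exact (mul_eq_zero.1 this).resolve_right (sub_ne_zero.2 fun h => hij (hl h))
  have hdne : ∀ i, d i ≠ 0 := by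
    have : (A.transpose * A).det ≠ 0 := by
      rw [Matrix.det_mul, Matrix.det_transpose]
      exact mul_ne_zero hdet hdet
    rw [hd, Matrix.det_diagonal, Finset.prod_ne_zero_iff] at this
    exact fun i => this i (Finset.mem_univ i)
  -- Since `A` is invertible, no eigenvector is isotropic, and complex square roots normalize them.
  choose c hc using fun i => IsAlgClosed.exists_pow_nat_eq (d i)⁻¹ (n := 2) two_pos
  let V := A * Matrix.diagonal c
  have hVV : V.transpose * V = 1 := by
    have : V.transpose * V = Matrix.diagonal c * (A.transpose * A) * Matrix.diagonal c := by
      simp only [V, Matrix.transpose_mul, Matrix.diagonal_transpose, Matrix.mul_assoc]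
    rw [this, hd, Matrix.diagonal_mul_diagonal, Matrix.diagonal_mul_diagonal, ← Matrix.diagonal_one]
    congr 1
    funext i
    have h1 : c i * d i * c i = c i ^ 2 * d i := by ring
    rw [h1, hc, inv_mul_cancel₀ (hdne i)]
  have hVV' : V * V.transpose = 1 := mul_eq_one_comm.1 hVV
  refine ⟨V, hVV, hVV', ?_⟩
  have hSV : S * V = V * Matrix.diagonal l := by
    simp only [V]
    rw [← Matrix.mul_assoc, hSA, Matrix.mul_assoc, Matrix.mul_assoc, Matrix.diagonal_mul_diagonal,
      Matrix.diagonal_mul_diagonal]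
    simp only [mul_comm]
  rw [← hSV, Matrix.mul_assoc, hVV', Matrix.mul_one]

theorem exists_orthogonal_diagonalization_of_mem_eigenSet
    {p : (Fin m × Fin n → ℂ) × (Fin n → ℂ)} (hp : p ∈ eigenSet m n) :
    ∃ V : Matrix (Fin n) (Fin n) ℂ, V.transpose * V = 1 ∧ V * V.transpose = 1 ∧
      (matOf ℂ m n p.1).transpose * matOf ℂ m n p.1 =
        V * Matrix.diagonal p.2 * V.transpose :=
  exists_orthogonal_diagonalization (by rw [Matrix.transpose_mul, Matrix.transpose_transpose])
    hp.2.1 hp.1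

/-- Singular values are arbitrary square roots `s` of the eigenvalues. These are nonzero, so `W = u
V diag(s)⁻¹` makes sense and has orthonormal columns. -/
theorem exists_svd_of_mem_eigenSet {p : (Fin m × Fin n → ℂ) × (Fin n → ℂ)}
    (hp : p ∈ eigenSet m n) : ∃ (W : Matrix (Fin m) (Fin n) ℂ) (V : Matrix (Fin n) (Fin n) ℂ)
      (s : Fin n → ℂ), W.transpose * W = 1 ∧ V.transpose * V = 1 ∧ (∀ i, s i ^ 2 = p.2 i) ∧
      matOf ℂ m n p.1 = W * Matrix.diagonal s * V.transpose := by
  obtain ⟨V, hV, hV', hS⟩ := exists_orthogonal_diagonalization_of_mem_eigenSet hp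
  choose s hs using fun i => IsAlgClosed.exists_pow_nat_eq (p.2 i) (n := 2) two_pos
  have hs0 : ∀ i, s i ≠ 0 := fun i h => hp.2.2 i (by rw [← hs, h]; simp)
  have hdiag : Matrix.diagonal (fun i => (s i)⁻¹) * Matrix.diagonal s = 1 := by
    rw [Matrix.diagonal_mul_diagonal, ← Matrix.diagonal_one]
    congr 1
    funext i
    exact inv_mul_cancel₀ (hs0 i)
  refine ⟨matOf ℂ m n p.1 * V * Matrix.diagonal fun i => (s i)⁻¹, V, s, ?_, hV, hs, ?_⟩
  · have : (matOf ℂ m n p.1 * V * Matrix.diagonal fun i => (s i)⁻¹).transpose *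
        (matOf ℂ m n p.1 * V * Matrix.diagonal fun i => (s i)⁻¹) =
        (Matrix.diagonal fun i => (s i)⁻¹) * (V.transpose *
          ((matOf ℂ m n p.1).transpose * matOf ℂ m n p.1) * V) *
          Matrix.diagonal fun i => (s i)⁻¹ := by
      simp only [Matrix.transpose_mul, Matrix.diagonal_transpose, Matrix.mul_assoc]
    have h2 : V.transpose * (V * Matrix.diagonal p.2 * V.transpose) * V = Matrix.diagonal p.2 := by
      calc _ = (V.transpose * V) * Matrix.diagonal p.2 * (V.transpose * V) := by
            simp only [Matrix.mul_assoc]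
        _ = _ := by rw [hV, Matrix.one_mul, Matrix.mul_one]
    rw [this, hS, h2, Matrix.diagonal_mul_diagonal, Matrix.diagonal_mul_diagonal,
      ← Matrix.diagonal_one]
    congr 1
    funext i
    have := hs0 i
    rw [← hs]
    field_simp
  · rw [Matrix.mul_assoc _ (Matrix.diagonal _) (Matrix.diagonal s), hdiag, Matrix.mul_one,
      Matrix.mul_assoc, hV', Matrix.mul_one]

theorem transpose_mul_self_mul_of_orthogonal {R : Type*} [CommRing R] {W : Matrix (Fin m) (Fin n) R}
    {V : Matrix (Fin n) (Fin n) R} {a b : Fin n → R} (s : Fin n → R)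
    (hW : W.transpose * W = Matrix.diagonal a) (hV : V.transpose * V = Matrix.diagonal b) :
    ((W * Matrix.diagonal s * V.transpose).transpose * (W * Matrix.diagonal s * V.transpose)) * V =
      V * Matrix.diagonal fun i => s i ^ 2 * a i * b i := by
  calc _ = V * (Matrix.diagonal s * (W.transpose * W) * Matrix.diagonal s *
        (V.transpose * V)) := by
        simp only [Matrix.transpose_mul, Matrix.transpose_transpose, Matrix.diagonal_transpose,
          Matrix.mul_assoc]
    _ = _ := by
      rw [hW, hV, Matrix.diagonal_mul_diagonal, Matrix.diagonal_mul_diagonal,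
        Matrix.diagonal_mul_diagonal]
      congr 2
      funext i
      ring

/-- The orthogonal factors of two decompositions `W diag(s) Vᵀ` move along orthogonal curves and `s`
along a line. The columns stay orthogonal with self-products `a` and `b`, so the eigenvalues `s² a
b` remain polynomial in the parameter, with their labelling. -/
theorem polyConnected_eigenSet (m n : ℕ) :
    PolyConnected ((fun p : (Fin m × Fin n → ℂ) × (Fin n → ℂ) => Sum.elim p.1 p.2) ''
      eigenSet m n) := by
  rintro _ ⟨⟨u₁, l₁⟩, h₁, rfl⟩ _ ⟨⟨u₂, l₂⟩, h₂, rfl⟩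
  obtain ⟨W₁, V₁, s₁, hW₁, hV₁, hs₁, hu₁⟩ := exists_svd_of_mem_eigenSet h₁
  obtain ⟨W₂, V₂, s₂, hW₂, hV₂, hs₂, hu₂⟩ := exists_svd_of_mem_eigenSet h₂
  obtain ⟨V, b, c₁, c₂, hVb, hc₁, hc₂, hV0, hV1⟩ := exists_orthogonal_curve hV₁ hV₂
  obtain ⟨W, a, d₁, d₂, hWa, hd₁, hd₂, hW0, hW1⟩ := exists_orthogonal_curve hW₁ hW₂
  -- Dividing by `c d` undoes the column scalings that the orthogonal curves introduce at their
  -- endpoints.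
  let t₁ : Fin n → ℂ := fun i => s₁ i / (c₁ i * d₁ i)
  let t₂ : Fin n → ℂ := fun i => s₂ i / (c₂ i * d₂ i)
  let s : Fin n → Polynomial ℂ := fun i =>
    Polynomial.C (t₁ i) + Polynomial.X * Polynomial.C (t₂ i - t₁ i)
  let u := W * Matrix.diagonal s * V.transpose
  let l : Fin n → Polynomial ℂ := fun i => s i ^ 2 * a i * b i
  let ev := Polynomial.evalRingHom (R := ℂ)
  have hdiag : ∀ (f : Fin n → Polynomial ℂ) (t : ℂ),
      (Matrix.diagonal f).map (ev t) = Matrix.diagonal fun i => (f i).eval t := fun f t => by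
    rw [Matrix.diagonal_map (map_zero _)]
    rfl
  have hu : ∀ t, u.map (ev t) = W.map (ev t) * Matrix.diagonal (fun i => (s i).eval t) *
      (V.map (ev t)).transpose := fun t => by
    simp only [u]
    rw [Matrix.map_mul, Matrix.map_mul, hdiag, Matrix.transpose_map]
  have horth : ∀ {k : ℕ} {M : Matrix (Fin k) (Fin n) (Polynomial ℂ)} {f : Fin n → Polynomial ℂ}
      (t : ℂ), M.transpose * M = Matrix.diagonal f →
      (M.map (ev t)).transpose * M.map (ev t) = Matrix.diagonal fun i => (f i).eval t := by
    intro k M f t h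
    rw [← hdiag, ← h, Matrix.map_mul, Matrix.transpose_map]
  have hsq : ∀ {k : ℕ} {M : Matrix (Fin k) (Fin n) (Polynomial ℂ)} {f : Fin n → Polynomial ℂ}
      {M₀ : Matrix (Fin k) (Fin n) ℂ} {e : Fin n → ℂ} (t : ℂ), M.transpose * M = Matrix.diagonal f →
      M₀.transpose * M₀ = 1 → M.map (ev t) = M₀ * Matrix.diagonal e →
      ∀ i, (f i).eval t = e i ^ 2 := by
    intro k M f M₀ e t h h' h'' i
    have h1 := horth t h
    rw [h''] at h1
    have h2 : (M₀ * Matrix.diagonal e).transpose * (M₀ * Matrix.diagonal e) =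
        Matrix.diagonal e * (M₀.transpose * M₀) * Matrix.diagonal e := by
      simp only [Matrix.transpose_mul, Matrix.diagonal_transpose, Matrix.mul_assoc]
    rw [h2, h', Matrix.mul_one, Matrix.diagonal_mul_diagonal] at h1
    exact (congrFun (Matrix.diagonal_injective h1) i).symm.trans (sq _).symm
  have hend : ∀ (t : ℂ) (W₀ : Matrix (Fin m) (Fin n) ℂ) (V₀ : Matrix (Fin n) (Fin n) ℂ)
      (s₀ c₀ d₀ : Fin n → ℂ) (u₀ : Fin m × Fin n → ℂ) (l₀ : Fin n → ℂ),
      W₀.transpose * W₀ = 1 → V₀.transpose * V₀ = 1 →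
      (∀ i, c₀ i ≠ 0) → (∀ i, d₀ i ≠ 0) → (∀ i, (s i).eval t = s₀ i / (c₀ i * d₀ i)) →
      V.map (ev t) = V₀ * Matrix.diagonal c₀ → W.map (ev t) = W₀ * Matrix.diagonal d₀ →
      matOf ℂ m n u₀ = W₀ * Matrix.diagonal s₀ * V₀.transpose → (∀ i, s₀ i ^ 2 = l₀ i) →
      u.map (ev t) = matOf ℂ m n u₀ ∧ ∀ i, (l i).eval t = l₀ i := by
    intro t W₀ V₀ s₀ c₀ d₀ u₀ l₀ hW₀ hV₀ hc hd hs hVt hWt hu₀ hs₀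
    constructor
    · rw [hu, hVt, hWt, hu₀, Matrix.transpose_mul, Matrix.diagonal_transpose]
      calc _ = W₀ * (Matrix.diagonal d₀ * Matrix.diagonal (fun i => (s i).eval t) *
            Matrix.diagonal c₀) * V₀.transpose := by simp only [Matrix.mul_assoc]
        _ = _ := by
          rw [Matrix.diagonal_mul_diagonal, Matrix.diagonal_mul_diagonal]
          congr 3
          funext i
          have := hc i
          have := hd i
          rw [hs]
          field_simp
    · intro i
      have := hc i
      have := hd i
      simp only [l, Polynomial.eval_mul, Polynomial.eval_pow]
      rw [hsq t hWa hW₀ hWt, hsq t hVb hV₀ hVt, hs, ← hs₀]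
      field_simp
  obtain ⟨hu0, hl0⟩ := hend 0 W₁ V₁ s₁ c₁ d₁ u₁ l₁ hW₁ hV₁ hc₁ hd₁ (by simp [s, t₁]) hV0 hW0 hu₁ hs₁
  obtain ⟨hu1, hl1⟩ := hend 1 W₂ V₂ s₂ c₂ d₂ u₂ l₂ hW₂ hV₂ hc₂ hd₂ (by simp [s, t₂]) hV1 hW1 hu₂ hs₂
  have hdet : ∀ t, V.det.eval t = (V.map (ev t)).det := fun t => (ev t).map_det V
  -- Off the zeros of `q`, the matrix `V` is invertible and the eigenvalues are nonzero and
  -- distinct. Since `q` does not vanish at `0`, it is not the zero polynomial.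
  let q : Polynomial ℂ := V.det * (∏ i, l i) *
    ∏ p ∈ (Finset.univ : Finset (Fin n × Fin n)).filter (fun p => p.1 ≠ p.2), (l p.1 - l p.2)
  have hq : ∀ t, q.eval t ≠ 0 ↔ (V.map (ev t)).det ≠ 0 ∧ (∀ i, (l i).eval t ≠ 0) ∧
      Function.Injective fun i => (l i).eval t := by
    intro t
    simp only [q, Polynomial.eval_mul, hdet, Polynomial.eval_prod, mul_ne_zero_iff,
      Finset.prod_ne_zero_iff, Finset.mem_univ, true_imp_iff, Finset.mem_filter, true_and,
      Polynomial.eval_sub, sub_ne_zero, and_assoc]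
    refine and_congr_right fun _ => and_congr_right fun _ => ?_
    exact ⟨fun h i j hij => by_contra fun hne => h (i, j) hne hij,
      fun h p hp hp' => hp (h hp')⟩
  refine ⟨Sum.elim (fun p => u p.1 p.2) l, q, ?_, ?_, ?_, ?_⟩
  · intro h0
    have : q.eval 0 ≠ 0 := by
      rw [hq]
      refine ⟨?_, fun i => ?_, ?_⟩
      · rw [hV0, Matrix.det_mul, Matrix.det_diagonal]
        refine mul_ne_zero (fun h => ?_) (Finset.prod_ne_zero_iff.2 fun i _ => hc₁ i)
        have := congrArg Matrix.det hV₁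
        rw [Matrix.det_mul, h, mul_zero, Matrix.det_one] at this
        exact zero_ne_one this
      · rw [hl0]
        exact h₁.2.2 i
      · rw [funext hl0]
        exact h₁.2.1
    rw [h0] at this
    simp at this
  · rintro (p | i)
    · exact congrFun (congrFun hu0 p.1) p.2
    · exact hl0 i
  · rintro (p | i)
    · exact congrFun (congrFun hu1 p.1) p.2
    · exact hl1 i
  · intro t ht
    rw [hq] at ht
    refine ⟨((matOf ℂ m n).symm (u.map (ev t)), fun i => (l i).eval t), ⟨?_, ht.2.2, ht.2.1⟩, ?_⟩
    · change ((u.map (ev t)).transpose * u.map (ev t)).charpoly = _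
      refine charpoly_eq_of_mul_eq_mul_diagonal ?_ ht.1
      rw [hu, transpose_mul_self_mul_of_orthogonal _ (horth t hWa) (horth t hVb)]
      simp [l]
    · ext (p | p) <;> rfl

theorem eigenSet_nonempty (hnm : n ≤ m) : (eigenSet m n).Nonempty := by
  let s : Fin n → ℂ := fun i => (i.val : ℂ) + 1
  have hpos : ∀ i, s i ^ 2 = (((i.val + 1) ^ 2 : ℕ) : ℂ) := fun i => by simp [s]
  refine ⟨((matOf ℂ m n).symm (rankForm ℂ m n n * Matrix.diagonal s), fun i => s i ^ 2),
    ?_, ?_, ?_⟩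
  · rw [LinearEquiv.apply_symm_apply, ← Matrix.charpoly_diagonal, Matrix.transpose_mul,
      rankForm_transpose, Matrix.diagonal_transpose, Matrix.mul_assoc, ← Matrix.mul_assoc _ _
      (Matrix.diagonal s), rankForm_mul hnm, min_self, rankForm_self, Matrix.one_mul,
      Matrix.diagonal_mul_diagonal]
    simp only [sq]
  · intro i j hij
    simp only [hpos, Nat.cast_inj] at hij
    have := Nat.pow_left_injective (by norm_num : 2 ≠ 0) hij
    exact Fin.ext (Nat.succ_injective this)
  · intro i
    simp only [hpos]
    exact Nat.cast_ne_zero.2 (by positivity)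

end EigenSet

/-! ### The generic fibre of the Euclidean distance correspondence -/

section GenericFibre

variable {m n r : ℕ}

/-- The invertible matrices `uᵀ u` with distinct eigenvalues are given by the nonvanishing of a
polynomial in `u`. -/
theorem exists_genericity_polynomial (m n : ℕ) : ∃ g : MvPolynomial (Fin m × Fin n) ℂ,
    ∀ u : Fin m × Fin n → ℂ, eval u g ≠ 0 ↔ ∃ l, (u, l) ∈ eigenSet m n := by
  let U := matOf (MvPolynomial (Fin m × Fin n) ℂ) m n X
  let P := (U.transpose * U).charpoly
  -- The constant coefficient detects the eigenvalue zero and the resultant detects repeated roots.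
  -- Fixing the degrees `n` and `n - 1` makes the resultant commute with specialization.
  refine ⟨P.coeff 0 * P.resultant (Polynomial.derivative P) n (n - 1), fun u => ?_⟩
  set Q := ((matOf ℂ m n u).transpose * matOf ℂ m n u).charpoly with hQ
  have hU : U.map (eval u) = matOf ℂ m n u := by
    ext i j
    simp [U, matOf_apply]
  have hPQ : P.map (eval u) = Q := by
    rw [← Matrix.charpoly_map, Matrix.map_mul, Matrix.transpose_map, hU]
  have hdeg : Q.natDegree = n := by
    rw [hQ, Matrix.charpoly_natDegree_eq_dim, Fintype.card_fin]
  have hmonic : Q.Monic := Matrix.charpoly_monic _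
  have hdeg' : (Polynomial.derivative Q).natDegree = n - 1 := by
    rw [Polynomial.natDegree_derivative, hdeg]
  have h1 : eval u (P.coeff 0 * P.resultant (Polynomial.derivative P) n (n - 1)) =
      Q.coeff 0 * Q.resultant (Polynomial.derivative Q) := by
    rw [map_mul, ← Polynomial.coeff_map, hPQ, ← Polynomial.resultant_map_map, hPQ,
      ← Polynomial.derivative_map, hPQ, hdeg, hdeg']
  rw [h1, mul_ne_zero_iff, ← isUnit_iff_ne_zero (a := Polynomial.resultant _ _),
    Polynomial.isUnit_resultant_iff_isCoprime hmonic]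
  change _ ∧ Q.Separable ↔ _
  have hsplit : Q.Splits := IsAlgClosed.splits Q
  constructor
  · rintro ⟨h0, hsep⟩
    have hnodup := Polynomial.nodup_roots hsep
    have hcard : Q.roots.toFinset.card = n := by
      rw [Multiset.toFinset_card_of_nodup hnodup, ← hdeg, hsplit.natDegree_eq_card_roots]
    let e := (Finset.equivFinOfCardEq hcard).symm
    have hprod : Q = ∏ i, (Polynomial.X - Polynomial.C ((e i : ℂ))) := by
      rw [Equiv.prod_comp e (fun a => Polynomial.X - Polynomial.C (a : ℂ)),
        Finset.prod_coe_sort Q.roots.toFinset (fun a => Polynomial.X - Polynomial.C (a : ℂ)),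
        Finset.prod_eq_multiset_prod, Multiset.toFinset_val, hnodup.dedup]
      exact hsplit.eq_prod_roots_of_monic hmonic
    refine ⟨fun i => (e i : ℂ), hprod, Subtype.val_injective.comp e.injective, fun i hi => h0 ?_⟩
    have hi' : (e i : ℂ) = 0 := hi
    have := (Polynomial.mem_roots hmonic.ne_zero).1 (Multiset.mem_toFinset.1 (e i).2)
    rwa [hi', Polynomial.IsRoot, ← Polynomial.coeff_zero_eq_eval_zero] at this
  · rintro ⟨l, hl, hinj, hne⟩
    change Q = _ at hl
    constructor
    · rw [Polynomial.coeff_zero_eq_eval_zero, hl, Polynomial.eval_prod, Finset.prod_ne_zero_iff]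
      intro i _
      simpa using hne i
    · rw [hl, Polynomial.separable_prod_X_sub_C_iff]
      exact hinj

/-- The diagonal projection onto the coordinates in `I`. -/
def diagProj (I : Finset (Fin n)) : Matrix (Fin n) (Fin n) ℂ :=
  Matrix.diagonal fun i => if i ∈ I then 1 else 0

theorem diagProj_mul_one_sub (I : Finset (Fin n)) (l : Fin n → ℂ) :
    diagProj I * Matrix.diagonal l * (1 - diagProj I) = 0 := by
  rw [diagProj, ← Matrix.diagonal_one, Matrix.diagonal_sub, Matrix.diagonal_mul_diagonal,
    Matrix.diagonal_mul_diagonal, ← Matrix.diagonal_zero]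
  congr 1
  funext i
  split_ifs <;> simp

theorem rank_diagProj (I : Finset (Fin n)) : (diagProj I).rank = I.card := by
  classical
  rw [diagProj, Matrix.rank_diagonal]
  simp

/-- Solutions `Y` of the critical equations for `U` with `Uᵀ U` diagonal with distinct nonzero
entries are obtained from `U` by deleting columns. -/
theorem eq_mul_diagProj_of_critical {U Y : Matrix (Fin m) (Fin n) ℂ} {l : Fin n → ℂ}
    (hl : Function.Injective l) (hl0 : ∀ i, l i ≠ 0)
    (hU : U.transpose * U = Matrix.diagonal l) (h1 : Y.transpose * (U - Y) = 0)
    (h2 : (U - Y) * Y.transpose = 0) : ∃ I : Finset (Fin n), Y = U * diagProj I := by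
  have h1' : (U - Y).transpose * Y = 0 := by
    have := congrArg Matrix.transpose h1
    rwa [Matrix.transpose_mul, Matrix.transpose_transpose, Matrix.transpose_zero] at this
  have h2' : Y * (U - Y).transpose = 0 := by
    have := congrArg Matrix.transpose h2
    rwa [Matrix.transpose_mul, Matrix.transpose_transpose, Matrix.transpose_zero] at this
  obtain ⟨M, hM⟩ : ∃ M, M = Y.transpose * Y := ⟨_, rfl⟩
  have hUY : U * Y.transpose = Y * Y.transpose := by
    rw [Matrix.sub_mul, sub_eq_zero] at h2; exact h2
  have hUtY : U.transpose * Y = M := by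
    rw [Matrix.transpose_sub, Matrix.sub_mul, sub_eq_zero] at h1'; rw [h1', hM]
  have hMY : M * Y.transpose = Matrix.diagonal l * Y.transpose := by
    rw [← hUtY, Matrix.mul_assoc, ← hUY, ← Matrix.mul_assoc, hU]
  have hMM : M * M = Matrix.diagonal l * M := by
    nth_rw 2 3 [hM]
    rw [← Matrix.mul_assoc, ← Matrix.mul_assoc, hMY]
  have hMsymm : M.transpose = M := by rw [hM, Matrix.transpose_mul, Matrix.transpose_transpose]
  have hcomm : Matrix.diagonal l * M = M * Matrix.diagonal l := by
    have := congrArg Matrix.transpose hMM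
    rw [Matrix.transpose_mul, Matrix.transpose_mul, hMsymm, Matrix.diagonal_transpose, hMM] at this
    exact this
  have hdiag : M = Matrix.diagonal fun i => M i i := by
    ext i j
    by_cases hij : i = j
    · subst hij; simp
    · rw [Matrix.diagonal_apply_ne _ hij]
      have := congrFun (congrFun hcomm i) j
      rw [Matrix.diagonal_mul, Matrix.mul_diagonal, mul_comm, ← sub_eq_zero, ← mul_sub] at this
      exact (mul_eq_zero.1 this).resolve_right (sub_ne_zero.2 fun h => hij (hl h))
  have hcol : ∀ k i, (M i i - l i) * Y k i = 0 := by
    intro k i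
    have := congrFun (congrFun hMY i) k
    rw [hdiag, Matrix.diagonal_mul, Matrix.diagonal_mul, Matrix.transpose_apply] at this
    rw [sub_mul, this, sub_self]
  set N := (U - Y).transpose * (U - Y) with hN
  have hMN : N = Matrix.diagonal l - M := by
    have : U.transpose * U = (U - Y).transpose * (U - Y) + Y.transpose * (U - Y) +
        U.transpose * Y := by
      rw [Matrix.transpose_sub]
      simp only [Matrix.sub_mul, Matrix.mul_sub]
      abel
    rw [hU, h1, add_zero, hUtY] at this
    rw [this, hN, add_sub_cancel_right]
  have hND : N * (U - Y).transpose = Matrix.diagonal l * (U - Y).transpose := by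
    rw [hMN, Matrix.sub_mul, hM, Matrix.mul_assoc, h2', Matrix.mul_zero, sub_zero]
  have hUtD : Matrix.diagonal l * (U - Y).transpose = N * (U - Y).transpose := hND.symm
  -- Where `M i i = l i`, the relation `M (U - Y)ᵀ = 0` makes the columns of `U` and `Y` agree.
  -- Elsewhere `hcol` makes the column of `Y` zero.
  refine ⟨Finset.univ.filter fun i => M i i = l i, ?_⟩
  ext k i
  rw [diagProj, Matrix.mul_diagonal]
  by_cases hi : M i i = l i
  · rw [if_pos (by simpa using hi), mul_one]
    have h3 : M * (U - Y).transpose = 0 := by rw [hM, Matrix.mul_assoc, h2', Matrix.mul_zero]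
    have h4 := congrFun (congrFun h3 i) k
    rw [hdiag, Matrix.diagonal_mul, hi, Matrix.transpose_apply] at h4
    exact (sub_eq_zero.1 ((mul_eq_zero.1 h4).resolve_left (hl0 i))).symm
  · rw [if_neg (by simpa using hi), mul_zero]
    exact (mul_eq_zero.1 (hcol k i)).resolve_left (sub_ne_zero.2 hi)

theorem mul_diagProj_injective {U : Matrix (Fin m) (Fin n) ℂ} {V : Matrix (Fin n) (Fin n) ℂ}
    {l : Fin n → ℂ} (hl0 : ∀ i, l i ≠ 0) (hV : V.transpose * V = 1)
    (hU : U.transpose * U = V * Matrix.diagonal l * V.transpose) {I J : Finset (Fin n)}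
    (h : U * (V * diagProj I * V.transpose) = U * (V * diagProj J * V.transpose)) : I = J := by
  have key : ∀ I : Finset (Fin n), V.transpose * U.transpose *
      (U * (V * diagProj I * V.transpose)) * V = Matrix.diagonal l * diagProj I := by
    intro I
    calc _ = V.transpose * (U.transpose * U) * V * diagProj I * (V.transpose * V) := by
          simp only [Matrix.mul_assoc]
      _ = (V.transpose * V) * Matrix.diagonal l * (V.transpose * V) * diagProj I *
          (V.transpose * V) := by rw [hU]; simp only [Matrix.mul_assoc]
      _ = _ := by rw [hV]; simp
  have h1 := key I
  rw [h, key J, diagProj, diagProj, Matrix.diagonal_mul_diagonal, Matrix.diagonal_mul_diagonal] at h1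
  ext i
  have := congrFun (Matrix.diagonal_injective h1) i
  simp only [mul_ite, mul_one, mul_zero] at this
  by_cases hi : i ∈ I <;> by_cases hj : i ∈ J <;>
    simp [hi, hj, hl0 i, (hl0 i).symm] at this ⊢

/-- Eckart–Young over `ℂ`: the matrix `u V` has orthogonal columns, and the critical equations allow
only keeping or deleting each of them. The rank counts the kept columns because `uᵀ u` is
invertible. -/
theorem mem_edCorrespondence_iff_of_mem_eigenSet (hrn : r ≤ n) (hnm : n ≤ m)
    {u x : Fin m × Fin n → ℂ} {l : Fin n → ℂ} (hul : (u, l) ∈ eigenSet m n)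
    {V : Matrix (Fin n) (Fin n) ℂ} (hV : V.transpose * V = 1)
    (hS : (matOf ℂ m n u).transpose * matOf ℂ m n u = V * Matrix.diagonal l * V.transpose) :
    (u, x) ∈ edCorrespondence (rankVariety m n r) ↔ ∃ I : Finset (Fin n), I.card = r ∧
      matOf ℂ m n x = matOf ℂ m n u * (V * diagProj I * V.transpose) := by
  have hV' : V * V.transpose = 1 := mul_eq_one_comm.1 hV
  have hl0 : ∀ i, l i ≠ 0 := hul.2.2
  rcases hrn.eq_or_lt with rfl | hrn
  · rw [mem_edCorrespondence_rankVariety_self_iff]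
    have huniv : V * diagProj Finset.univ * V.transpose = 1 := by
      rw [diagProj]; simp [hV']
    constructor
    · rintro rfl
      exact ⟨Finset.univ, by simp, by rw [huniv, Matrix.mul_one]⟩
    · rintro ⟨I, hI, h⟩
      rw [(Finset.card_eq_iff_eq_univ I).1 (by simpa using hI), huniv, Matrix.mul_one] at h
      exact (matOf ℂ m r).injective h
  set U := matOf ℂ m n u with hU
  have hUV : (U * V).transpose * (U * V) = Matrix.diagonal l := by
    calc _ = V.transpose * (U.transpose * U) * V := by
          simp only [Matrix.transpose_mul, Matrix.mul_assoc]
      _ = (V.transpose * V) * Matrix.diagonal l * (V.transpose * V) := by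
          rw [hS]; simp only [Matrix.mul_assoc]
      _ = _ := by rw [hV, Matrix.one_mul, Matrix.mul_one]
  have hrank : ∀ I : Finset (Fin n), (U * (V * diagProj I * V.transpose)).rank = I.card := by
    intro I
    have hdetV : IsUnit V.det := IsUnit.of_mul_eq_one V.transpose.det (by
      rw [← Matrix.det_mul, hV', Matrix.det_one])
    have hdetV' : IsUnit V.transpose.det := by rwa [Matrix.det_transpose]
    have hdetS : IsUnit (U.transpose * U).det := by
      rw [hS, Matrix.det_mul, Matrix.det_mul]
      refine (hdetV.mul ?_).mul hdetV'
      rw [Matrix.det_diagonal]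
      exact (Finset.prod_ne_zero_iff.2 fun i _ => hl0 i).isUnit
    have h1 : (V * diagProj I * V.transpose).rank = I.card := by
      rw [Matrix.rank_mul_eq_left_of_isUnit_det _ _ hdetV',
        Matrix.rank_mul_eq_right_of_isUnit_det _ _ hdetV, rank_diagProj]
    refine le_antisymm ((Matrix.rank_mul_le_right _ _).trans h1.le) ?_
    have h2 := Matrix.rank_mul_le_right U.transpose (U * (V * diagProj I * V.transpose))
    rwa [← Matrix.mul_assoc, Matrix.rank_mul_eq_right_of_isUnit_det _ _ hdetS, h1] at h2
  rw [mem_edCorrespondence_rankVariety_iff hrn hnm, ← hU]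
  constructor
  · rintro ⟨hrk, h1, h2⟩
    set X := matOf ℂ m n x
    obtain ⟨I, hI⟩ := eq_mul_diagProj_of_critical (U := U * V) (Y := X * V) hul.2.1 hl0 hUV
      (by
        calc _ = -(V.transpose * (X.transpose * (X - U)) * V) := by
              rw [Matrix.transpose_mul, ← Matrix.sub_mul, ← neg_sub X U]
              simp only [Matrix.mul_assoc, Matrix.neg_mul, Matrix.mul_neg]
          _ = 0 := by rw [h1]; simp)
      (by
        calc _ = -((X - U) * (V * V.transpose) * X.transpose) := by
              rw [Matrix.transpose_mul, ← Matrix.sub_mul, ← neg_sub X U]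
              simp only [Matrix.mul_assoc, Matrix.neg_mul]
          _ = 0 := by rw [hV', Matrix.mul_one, h2, neg_zero])
    have hX : X = U * (V * diagProj I * V.transpose) := by
      calc X = (X * V) * V.transpose := by rw [Matrix.mul_assoc, hV', Matrix.mul_one]
        _ = _ := by rw [hI]; simp only [Matrix.mul_assoc]
    refine ⟨I, ?_, hX⟩
    rw [← hrank I, ← hX, hrk]
  · rintro ⟨I, hI, hX⟩
    rw [hX, hrank, hI]
    have hsub : U * (V * diagProj I * V.transpose) - U =
        -(U * V * (1 - diagProj I) * V.transpose) := by
      rw [Matrix.mul_sub, Matrix.mul_one, Matrix.sub_mul, Matrix.mul_assoc U V V.transpose, hV',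
        Matrix.mul_one, neg_sub]
      simp only [Matrix.mul_assoc]
    have htr : (U * (V * diagProj I * V.transpose)).transpose =
        V * diagProj I * (U * V).transpose := by
      simp only [Matrix.transpose_mul, Matrix.transpose_transpose, diagProj,
        Matrix.diagonal_transpose, Matrix.mul_assoc]
    have hidem : (1 - diagProj I) * diagProj I = 0 := by
      have := congrArg Matrix.transpose (diagProj_mul_one_sub I 1)
      simpa [diagProj, Matrix.diagonal_one', Pi.one_def] using this
    refine ⟨rfl, ?_, ?_⟩
    · rw [hsub, htr, Matrix.mul_neg, neg_eq_zero]
      calc _ = V * (diagProj I * ((U * V).transpose * (U * V)) * (1 - diagProj I)) *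
            V.transpose := by simp only [Matrix.mul_assoc]
        _ = 0 := by rw [hUV, diagProj_mul_one_sub]; simp
    · rw [hsub, htr, Matrix.neg_mul, neg_eq_zero]
      calc _ = U * V * ((1 - diagProj I) * (V.transpose * V) * diagProj I) *
            (U * V).transpose := by simp only [Matrix.mul_assoc]
        _ = 0 := by rw [hV, Matrix.mul_one, hidem]; simp

theorem hasDegree_edCorrespondence (hrn : r ≤ n) (hnm : n ≤ m) :
    HasDegree (edCorrespondence (rankVariety m n r)) (n.choose r) := by
  obtain ⟨g, hg⟩ := exists_genericity_polynomial m n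
  refine ⟨g, ?_, fun u hu => ?_⟩
  · rintro rfl
    obtain ⟨⟨u, l⟩, h⟩ := eigenSet_nonempty hnm
    exact (hg u).2 ⟨l, h⟩ (map_zero _)
  · obtain ⟨l, hul⟩ := (hg u).1 hu
    obtain ⟨V, hV, -, hS⟩ := exists_orthogonal_diagonalization_of_mem_eigenSet hul
    let F : Finset (Fin n) → (Fin m × Fin n → ℂ) := fun I =>
      (matOf ℂ m n).symm (matOf ℂ m n u * (V * diagProj I * V.transpose))
    have hF : Function.Injective F := fun I J h =>
      mul_diagProj_injective hul.2.2 hV hS ((matOf ℂ m n).symm.injective h)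
    have : {x | (u, x) ∈ edCorrespondence (rankVariety m n r)} =
        F '' (Finset.powersetCard r (Finset.univ : Finset (Fin n)) : Finset (Finset (Fin n))) := by
      ext x
      rw [Set.mem_ofPred_eq, mem_edCorrespondence_iff_of_mem_eigenSet hrn hnm hul hV hS]
      simp only [Set.mem_image, Finset.mem_coe, Finset.mem_powersetCard_univ, F,
        LinearEquiv.symm_apply_eq, eq_comm (a := matOf ℂ m n x)]
    rw [this, hF.encard_image, Set.encard_coe_eq_coe_finsetCard, Finset.card_powersetCard,
      Finset.card_univ, Fintype.card_fin]

end GenericFibre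

/-! ### The ring of regular functions on the labelled eigenvalue set -/

/-- The coordinates of a point of the labelled eigenvalue set. -/
def eigenPoint {m n : ℕ} (z : eigenSet m n) : (Fin m × Fin n) ⊕ Fin n → ℂ :=
  Sum.elim z.1.1 z.1.2

/-- The functions on the labelled eigenvalue set that are quotients of polynomials, with
denominators vanishing nowhere. -/
def eigenRing (m n : ℕ) : Subalgebra ℂ (eigenSet m n → ℂ) where
  carrier := {φ | ∃ b d : MvPolynomial ((Fin m × Fin n) ⊕ Fin n) ℂ,
    (∀ z, eval (eigenPoint z) d ≠ 0) ∧ ∀ z, φ z * eval (eigenPoint z) d = eval (eigenPoint z) b}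
  mul_mem' := by
    rintro φ ψ ⟨b, d, hd, h⟩ ⟨b', d', hd', h'⟩
    refine ⟨b * b', d * d', fun z => ?_, fun z => ?_⟩
    · rw [map_mul]; exact mul_ne_zero (hd z) (hd' z)
    · rw [map_mul, map_mul, ← h, ← h', Pi.mul_apply]; ring
  add_mem' := by
    rintro φ ψ ⟨b, d, hd, h⟩ ⟨b', d', hd', h'⟩
    refine ⟨b * d' + b' * d, d * d', fun z => ?_, fun z => ?_⟩
    · rw [map_mul]; exact mul_ne_zero (hd z) (hd' z)
    · rw [map_mul, map_add, map_mul, map_mul, ← h, ← h', Pi.add_apply]; ring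
  algebraMap_mem' c := ⟨C c, 1, fun z => by simp, fun z => by simp⟩

section EigenRing

variable {m n : ℕ}

theorem eigenRing_ext {a b : eigenRing m n} (h : ∀ z, a.1 z = b.1 z) : a = b :=
  Subtype.ext (funext h)

/-- Evaluation of a regular function at a point. -/
def eigenEval (z : eigenSet m n) : eigenRing m n →+* ℂ :=
  (Pi.evalRingHom (fun _ => ℂ) z).comp (eigenRing m n).val.toRingHom

theorem eigenEval_apply (z : eigenSet m n) (a : eigenRing m n) : eigenEval z a = a.1 z := rfl

theorem eigenRing_ext_iff {a b : eigenRing m n} :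
    a = b ↔ ∀ z, eigenEval z a = eigenEval z b :=
  ⟨fun h _ => by rw [h], eigenRing_ext⟩

/-- Polynomials in the parameters and the eigenvalues, as regular functions. -/
def eigenPoly (m n : ℕ) : MvPolynomial ((Fin m × Fin n) ⊕ Fin n) ℂ →ₐ[ℂ] eigenRing m n :=
  aeval fun k => ⟨fun z => eigenPoint z k, X k, 1, fun z => by simp, fun z => by simp⟩

theorem eigenEval_eigenPoly (z : eigenSet m n) (f : MvPolynomial ((Fin m × Fin n) ⊕ Fin n) ℂ) :
    eigenEval z (eigenPoly m n f) = eval (eigenPoint z) f := by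
  have : (eigenEval z).comp (eigenPoly m n).toRingHom = eval (eigenPoint z) := by
    ext k
    · simp [eigenPoly, eigenEval]
    · simp [eigenPoly, eigenEval]
  exact congrArg (fun φ => φ f) this

theorem exists_eigenPoly_mul_eq (a : eigenRing m n) :
    ∃ b d : MvPolynomial ((Fin m × Fin n) ⊕ Fin n) ℂ, (∀ z, eval (eigenPoint z) d ≠ 0) ∧
      a * eigenPoly m n d = eigenPoly m n b := by
  obtain ⟨b, d, hd, h⟩ := a.2
  refine ⟨b, d, hd, eigenRing_ext_iff.2 fun z => ?_⟩
  rw [map_mul, eigenEval_eigenPoly, eigenEval_eigenPoly]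
  exact h z

/-- Denominators vanish nowhere, so a zero product forces the product of the numerators to vanish on
`eigenSet`. Irreducibility kills one numerator. Thus all labellings live in one field, and so every
permutation of the eigenvalues is realized by monodromy. -/
theorem isDomain_eigenRing (hnm : n ≤ m) : IsDomain (eigenRing m n) := by
  have hprime := (polyConnected_eigenSet m n).isPrime_vanishingIdeal
    ((eigenSet_nonempty hnm).image _)
  have hmem : ∀ f, f ∈ vanishingIdeal ℂ ((fun p : (Fin m × Fin n → ℂ) × (Fin n → ℂ) =>
      Sum.elim p.1 p.2) '' eigenSet m n) ↔ ∀ z, eval (eigenPoint z) f = 0 := by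
    intro f
    rw [mem_vanishingIdeal_iff]
    constructor
    · intro h z
      have := h (eigenPoint z) ⟨z.1, z.2, rfl⟩
      rwa [aeval_eq_eval] at this
    · rintro h _ ⟨p, hp, rfl⟩
      rw [aeval_eq_eval]
      exact h ⟨p, hp⟩
  have : Nontrivial (eigenRing m n) := by
    obtain ⟨z, hz⟩ := eigenSet_nonempty hnm
    refine ⟨0, 1, fun h => ?_⟩
    have := eigenRing_ext_iff.1 h ⟨z, hz⟩
    simp at this
  have : NoZeroDivisors (eigenRing m n) := by
    refine ⟨fun {a b} hab => ?_⟩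
    obtain ⟨f, d, hd, hf⟩ := a.2
    obtain ⟨f', d', hd', hf'⟩ := b.2
    have h1 : f * f' ∈ vanishingIdeal ℂ ((fun p : (Fin m × Fin n → ℂ) × (Fin n → ℂ) =>
        Sum.elim p.1 p.2) '' eigenSet m n) := by
      rw [hmem]
      intro z
      have h2 := eigenRing_ext_iff.1 hab z
      rw [map_mul, map_zero, eigenEval_apply, eigenEval_apply] at h2
      rw [map_mul, ← hf, ← hf', mul_mul_mul_comm, h2, zero_mul]
    rcases hprime.mem_or_mem h1 with h | h
    · left
      refine eigenRing_ext fun z => ?_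
      have h3 := hf z
      rw [(hmem f).1 h z] at h3
      exact (mul_eq_zero.1 h3).resolve_right (hd z)
    · right
      refine eigenRing_ext fun z => ?_
      have h3 := hf' z
      rw [(hmem f').1 h z] at h3
      exact (mul_eq_zero.1 h3).resolve_right (hd' z)
  exact NoZeroDivisors.to_isDomain _

/-- The eigenvalues as regular functions. -/
def eigenvalueFn (i : Fin n) : eigenRing m n := eigenPoly m n (X (Sum.inr i))

theorem eigenEval_eigenvalueFn (z : eigenSet m n) (i : Fin n) :
    eigenEval z (eigenvalueFn i) = z.1.2 i := by
  rw [eigenvalueFn, eigenEval_eigenPoly, eval_X]; rfl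

theorem eigenvalueFn_injective (hnm : n ≤ m) :
    Function.Injective (eigenvalueFn : Fin n → eigenRing m n) := by
  intro i j hij
  obtain ⟨z, hz⟩ := eigenSet_nonempty hnm
  have := eigenRing_ext_iff.1 hij ⟨z, hz⟩
  rw [eigenEval_eigenvalueFn, eigenEval_eigenvalueFn] at this
  exact hz.2.1 this

/-- The inverses of the differences of the eigenvalues as regular functions. -/
def eigenDiffInv (i j : Fin n) : eigenRing m n :=
  -- The value `0` agrees with `0⁻¹ = 0`, so evaluation has a uniform formula; Lagrange
  -- interpolation omits the diagonal.
  if h : i = j then 0 else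
  ⟨fun z => (z.1.2 i - z.1.2 j)⁻¹, 1, X (Sum.inr i) - X (Sum.inr j), fun z => by
    rw [map_sub, eval_X, eval_X]
    exact sub_ne_zero.2 fun h' => h (z.2.2.1 h'), fun z => by
    rw [map_sub, eval_X, eval_X, map_one]
    exact inv_mul_cancel₀ (sub_ne_zero.2 fun h' => h (z.2.2.1 h'))⟩

theorem eigenEval_eigenDiffInv (z : eigenSet m n) (i j : Fin n) :
    eigenEval z (eigenDiffInv i j) = (z.1.2 i - z.1.2 j)⁻¹ := by
  rw [eigenDiffInv]
  split_ifs with h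
  · subst h; simp
  · rfl

/-- The data matrix with entries in the regular functions. -/
def eigenMatrix (m n : ℕ) : Matrix (Fin m) (Fin n) (eigenRing m n) :=
  Matrix.of fun i j => eigenPoly m n (X (Sum.inl (i, j)))

theorem map_eigenMatrix (z : eigenSet m n) :
    (eigenMatrix m n).map (eigenEval z) = matOf ℂ m n z.1.1 := by
  ext i j
  simp only [eigenMatrix, Matrix.map_apply, Matrix.of_apply, eigenEval_eigenPoly, eval_X]
  rfl

/-- The Lagrange interpolation polynomial with value `1` at the nodes in `I` and value `0` at the
other nodes; `d i j` is the inverse of `l i - l j`. -/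
def lagrangeSum {R : Type*} [CommRing R] (l : Fin n → R) (d : Fin n → Fin n → R)
    (I : Finset (Fin n)) : Polynomial R :=
  ∑ i ∈ I, ∏ j ∈ Finset.univ.erase i, Polynomial.C (d i j) * (Polynomial.X - Polynomial.C (l j))

theorem map_lagrangeSum {R S : Type*} [CommRing R] [CommRing S] (φ : R →+* S) (l : Fin n → R)
    (d : Fin n → Fin n → R) (I : Finset (Fin n)) :
    (lagrangeSum l d I).map φ = lagrangeSum (φ ∘ l) (fun i j => φ (d i j)) I := by
  simp [lagrangeSum, Polynomial.map_sum, Polynomial.map_prod]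

theorem eval_lagrangeSum {l : Fin n → ℂ} (hl : Function.Injective l) (I : Finset (Fin n))
    (k : Fin n) : (lagrangeSum l (fun i j => (l i - l j)⁻¹) I).eval (l k) =
      if k ∈ I then 1 else 0 := by
  have h1 : ∀ i, (∏ j ∈ Finset.univ.erase i, Polynomial.C (l i - l j)⁻¹ *
      (Polynomial.X - Polynomial.C (l j))).eval (l k) = if i = k then 1 else 0 := by
    intro i
    rw [Polynomial.eval_prod]
    split_ifs with h
    · subst h
      refine Finset.prod_eq_one fun j hj => ?_
      have : l i - l j ≠ 0 := sub_ne_zero.2 fun h => (Finset.ne_of_mem_erase hj) (hl h.symm)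
      simp [this]
    · refine Finset.prod_eq_zero (Finset.mem_erase.2 ⟨Ne.symm h, Finset.mem_univ k⟩) ?_
      simp
  rw [lagrangeSum, Polynomial.eval_finsetSum, Finset.sum_congr rfl fun i _ => h1 i,
    Finset.sum_ite_eq']

/-- The critical point for the set `I` of singular values, as a matrix of regular functions. -/
def criticalMatrix (m : ℕ) {n : ℕ} (I : Finset (Fin n)) : Matrix (Fin m) (Fin n) (eigenRing m n) :=
  eigenMatrix m n * Polynomial.aeval (R := eigenRing m n)
    ((eigenMatrix m n).transpose * eigenMatrix m n) (lagrangeSum eigenvalueFn eigenDiffInv I)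

theorem map_aeval_matrix {ι R S : Type*} [Fintype ι] [DecidableEq ι] [CommRing R] [CommRing S]
    (φ : R →+* S) (M : Matrix ι ι R) (p : Polynomial R) :
    (Polynomial.aeval M p).map φ = Polynomial.aeval (M.map φ) (p.map φ) := by
  refine Polynomial.map_aeval_eq_aeval_map (S := Matrix ι ι R) (φ := φ)
    (ψ := φ.mapMatrix (m := ι)) ?_ p M
  ext a i j
  by_cases hij : i = j
  · subst hij; simp [Matrix.algebraMap_matrix_apply]
  · simp [Matrix.algebraMap_matrix_apply, hij]

theorem map_criticalMatrix (I : Finset (Fin n)) (z : eigenSet m n) :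
    (criticalMatrix m I).map (eigenEval z) = matOf ℂ m n z.1.1 *
      Polynomial.aeval ((matOf ℂ m n z.1.1).transpose * matOf ℂ m n z.1.1)
        (lagrangeSum z.1.2 (fun i j => (z.1.2 i - z.1.2 j)⁻¹) I) := by
  have h1 : eigenEval z ∘ eigenvalueFn = z.1.2 := funext fun i => eigenEval_eigenvalueFn z i
  have h2 : (fun i j => eigenEval z (eigenDiffInv i j)) = fun i j => (z.1.2 i - z.1.2 j)⁻¹ :=
    funext fun i => funext fun j => eigenEval_eigenDiffInv z i j
  rw [criticalMatrix, Matrix.map_mul, map_aeval_matrix, Matrix.map_mul, Matrix.transpose_map,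
    map_eigenMatrix, map_lagrangeSum, h1, h2]

theorem aeval_orthogonal_conj {V : Matrix (Fin n) (Fin n) ℂ} (hV : V.transpose * V = 1)
    (l : Fin n → ℂ) (p : Polynomial ℂ) :
    Polynomial.aeval (V * Matrix.diagonal l * V.transpose) p =
      V * Matrix.diagonal (fun i => p.eval (l i)) * V.transpose := by
  have hV' : V * V.transpose = 1 := mul_eq_one_comm.1 hV
  have hpow : ∀ k : ℕ, (V * Matrix.diagonal l * V.transpose) ^ k =
      V * Matrix.diagonal (fun i => l i ^ k) * V.transpose := by
    intro k
    induction k with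
    | zero => simp [hV']
    | succ k ih =>
      rw [pow_succ, ih]
      calc _ = V * (Matrix.diagonal (fun i => l i ^ k) * (V.transpose * V) *
            Matrix.diagonal l) * V.transpose := by simp only [Matrix.mul_assoc]
        _ = _ := by
          rw [hV, Matrix.mul_one, Matrix.diagonal_mul_diagonal]
          simp only [pow_succ]
  induction p using Polynomial.induction_on' with
  | add p q hp hq =>
    rw [map_add, hp, hq, ← Matrix.add_mul, ← Matrix.mul_add, Matrix.diagonal_add]
    simp only [Polynomial.eval_add]
  | monomial k a =>
    rw [Polynomial.aeval_monomial, hpow, ← Algebra.smul_def, ← Matrix.smul_mul, ← Matrix.mul_smul,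
      ← Matrix.diagonal_smul]
    simp only [Polynomial.eval_monomial]
    rfl

/-! ### The symmetric group acting on the ring of regular functions -/

/-- The relabelling of the eigenvalues by a permutation. -/
def relabel (σ : Equiv.Perm (Fin n)) (z : eigenSet m n) : eigenSet m n :=
  ⟨(z.1.1, z.1.2 ∘ σ), by
    obtain ⟨h1, h2, h3⟩ := z.2
    refine ⟨h1.trans ?_, h2.comp σ.injective, fun i => h3 (σ i)⟩
    exact (Equiv.prod_comp σ fun i => Polynomial.X - Polynomial.C (z.1.2 i)).symm⟩

/-- The Lagrange polynomial for the labels `l ∘ σ` is `1` at the eigenvalues indexed by `σ(I)` and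
`0` at the others. Applied to `uᵀ u` it is the spectral projection for `σ(I)`, expressed in the
eigenbasis `V` of the original labelling. -/
theorem map_criticalMatrix_relabel (I : Finset (Fin n)) (z : eigenSet m n)
    (σ : Equiv.Perm (Fin n)) {V : Matrix (Fin n) (Fin n) ℂ} (hV : V.transpose * V = 1)
    (hS : (matOf ℂ m n z.1.1).transpose * matOf ℂ m n z.1.1 =
      V * Matrix.diagonal z.1.2 * V.transpose) :
    (criticalMatrix m I).map (eigenEval (relabel σ z)) =
      matOf ℂ m n z.1.1 * (V * diagProj (I.map σ.toEmbedding) * V.transpose) := by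
  rw [map_criticalMatrix]
  change matOf ℂ m n z.1.1 * Polynomial.aeval
    ((matOf ℂ m n z.1.1).transpose * matOf ℂ m n z.1.1) _ = _
  rw [hS, aeval_orthogonal_conj hV]
  congr 4
  funext k
  have h := eval_lagrangeSum (relabel σ z).2.2.1 I (σ.symm k)
  have h2 : (relabel σ z).1.2 (σ.symm k) = z.1.2 k := by simp [relabel]
  rw [h2] at h
  rw [h]
  simp [Finset.mem_map_equiv]

/-- The action of the symmetric group on the regular functions by relabelling the eigenvalues. -/
instance : MulSemiringAction (Equiv.Perm (Fin n)) (eigenRing m n) where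
  smul σ a := ⟨fun z => a.1 (relabel σ z), by
    obtain ⟨b, d, hd, h⟩ := a.2
    have hr : ∀ (z : eigenSet m n) (f : MvPolynomial ((Fin m × Fin n) ⊕ Fin n) ℂ),
        eval (eigenPoint z) (rename (Sum.map id σ) f) = eval (eigenPoint (relabel σ z)) f := by
      intro z f
      rw [eval_rename]
      congr 2
      funext k
      rcases k with k | k <;> rfl
    refine ⟨rename (Sum.map id σ) b, rename (Sum.map id σ) d, fun z => ?_, fun z => ?_⟩
    · rw [hr]; exact hd _
    · rw [hr, hr]; exact h _⟩
  one_smul _ := rfl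
  -- Relabelling is a right action on points, so pullback of functions is a left action.
  mul_smul _ _ _ := rfl
  smul_zero _ := rfl
  smul_add _ _ _ := rfl
  smul_one _ := rfl
  smul_mul _ _ _ := rfl

theorem eigenEval_smul (σ : Equiv.Perm (Fin n)) (a : eigenRing m n) (z : eigenSet m n) :
    eigenEval z (σ • a) = eigenEval (relabel σ z) a := rfl

theorem smul_eigenvalueFn (σ : Equiv.Perm (Fin n)) (i : Fin n) :
    σ • (eigenvalueFn i : eigenRing m n) = eigenvalueFn (σ i) := by
  rw [eigenRing_ext_iff]
  intro z
  rw [eigenEval_smul, eigenEval_eigenvalueFn, eigenEval_eigenvalueFn]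
  rfl

/-- Distinct label sets give distinct critical points over any single point of `eigenSet`, so one
evaluation already detects `σ(I) ≠ I`. -/
theorem smul_criticalMatrix_eq_iff (hnm : n ≤ m) (σ : Equiv.Perm (Fin n)) (I : Finset (Fin n)) :
    (∀ i j, σ • criticalMatrix m I i j = criticalMatrix m I i j) ↔
      I.map σ.toEmbedding = I := by
  constructor
  · intro h
    obtain ⟨p, hp⟩ := eigenSet_nonempty hnm
    obtain ⟨V, hV, -, hS⟩ := exists_orthogonal_diagonalization_of_mem_eigenSet hp
    have h1 := map_criticalMatrix_relabel I ⟨p, hp⟩ σ hV hS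
    have h2 := map_criticalMatrix_relabel I ⟨p, hp⟩ 1 hV hS
    have h3 : (criticalMatrix m I).map (eigenEval (relabel σ ⟨p, hp⟩)) =
        (criticalMatrix m I).map (eigenEval (relabel 1 ⟨p, hp⟩)) := by
      ext i j
      rw [Matrix.map_apply, Matrix.map_apply, ← eigenEval_smul, h]
      rfl
    rw [h1, h2] at h3
    have h4 := mul_diagProj_injective hp.2.2 hV hS h3
    rw [h4]
    ext i
    simp only [Finset.mem_map_equiv]
    rfl
  · intro h i j
    rw [eigenRing_ext_iff]
    intro z
    obtain ⟨V, hV, -, hS⟩ := exists_orthogonal_diagonalization_of_mem_eigenSet z.2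
    have h1 := map_criticalMatrix_relabel I z σ hV hS
    have h2 := map_criticalMatrix_relabel I z 1 hV hS
    have h3 : I.map (1 : Equiv.Perm (Fin n)).toEmbedding = I := by
      ext i
      simp only [Finset.mem_map_equiv]
      rfl
    rw [h] at h1
    rw [h3, ← h1] at h2
    exact (congrFun (congrFun h2 i) j).symm

end EigenRing

/-! ### Fraction fields generated by permuted roots -/

theorem algHom_eq_of_adjoin_eq_top {K F L : Type*} [Field K] [Field F] [Field L] [Algebra K F]
    [Algebra K L] {s : Set F} (hs : IntermediateField.adjoin K s = ⊤) {φ ψ : F →ₐ[K] L}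
    (h : ∀ x ∈ s, φ x = ψ x) : φ = ψ := by
  ext x
  have hx : x ∈ IntermediateField.adjoin K s := hs ▸ IntermediateField.mem_top
  induction hx using IntermediateField.adjoin_induction with
  | mem x hx => exact h x hx
  | algebraMap a => simp
  | add x y _ _ hx hy => rw [map_add, map_add, hx, hy]
  | inv x _ hx => rw [map_inv₀, map_inv₀, hx]
  | mul x y _ _ hx hy => rw [map_mul, map_mul, hx, hy]

section PermutedRoots

variable {A B K F ι : Type*} [CommRing A] [CommRing B] [Field K] [Field F]
  [Algebra A B] [Algebra A K] [Algebra A F] [Algebra B F] [Algebra K F] [IsFractionRing A K]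
  [IsFractionRing B F] [IsScalarTower A B F] [IsScalarTower A K F] [Fintype ι]
  {l : ι → B} {χ : Polynomial A}

omit [IsFractionRing A K] [IsFractionRing B F] in
theorem map_map_algebraMap_eq_prod
    (hχ : χ.map (algebraMap A B) = ∏ i, (Polynomial.X - Polynomial.C (l i))) :
    (χ.map (algebraMap A K)).map (algebraMap K F) =
      ∏ i, (Polynomial.X - Polynomial.C (algebraMap B F (l i))) := by
  rw [Polynomial.map_map, ← IsScalarTower.algebraMap_eq, IsScalarTower.algebraMap_eq A B F,
    ← Polynomial.map_map, hχ]
  simp [Polynomial.map_prod]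

omit [IsFractionRing A K] [Fintype ι] in
theorem adjoin_range_algebraMap_eq_top
    (hfrac : ∀ b : B, ∃ p ∈ Algebra.adjoin A (Set.range l), ∃ q ∈ Algebra.adjoin A (Set.range l),
      p ≠ 0 ∧ b * p = q) :
    IntermediateField.adjoin K (Set.range fun i => algebraMap B F (l i)) = ⊤ := by
  set E := IntermediateField.adjoin K (Set.range fun i => algebraMap B F (l i))
  have h1 : ∀ p ∈ Algebra.adjoin A (Set.range l), algebraMap B F p ∈ E := by
    intro p hp
    induction hp using Algebra.adjoin_induction with
    | mem x hx =>
      obtain ⟨i, rfl⟩ := hx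
      exact IntermediateField.subset_adjoin _ _ ⟨i, rfl⟩
    | algebraMap a =>
      rw [← IsScalarTower.algebraMap_apply, IsScalarTower.algebraMap_apply A K F]
      exact E.algebraMap_mem _
    | add x y _ _ hx hy => rw [map_add]; exact E.add_mem hx hy
    | mul x y _ _ hx hy => rw [map_mul]; exact E.mul_mem hx hy
  have h2 : ∀ b, algebraMap B F b ∈ E := by
    intro b
    obtain ⟨p, hp, q, hq, hp0, h⟩ := hfrac b
    have h3 : algebraMap B F p ≠ 0 := fun h =>
      hp0 (IsFractionRing.injective B F (h.trans (map_zero _).symm))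
    have h4 : algebraMap B F b = algebraMap B F q / algebraMap B F p := by
      rw [← h, map_mul, mul_div_cancel_right₀ _ h3]
    rw [h4]
    exact E.div_mem (h1 q hq) (h1 p hp)
  rw [eq_top_iff]
  rintro x -
  obtain ⟨a, b, -, rfl⟩ := IsFractionRing.div_surjective B x
  exact E.div_mem (h2 a) (h2 b)

omit [IsFractionRing A K] in
theorem isSplittingField_of_permuted_roots
    (hχ : χ.map (algebraMap A B) = ∏ i, (Polynomial.X - Polynomial.C (l i)))
    (hfrac : ∀ b : B, ∃ p ∈ Algebra.adjoin A (Set.range l), ∃ q ∈ Algebra.adjoin A (Set.range l),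
      p ≠ 0 ∧ b * p = q) : (χ.map (algebraMap A K)).IsSplittingField K F := by
  have hprod := map_map_algebraMap_eq_prod (K := K) (F := F) hχ
  rw [isSplittingField_iff_intermediateField, hprod]
  refine ⟨Polynomial.Splits.prod fun i _ => Polynomial.Splits.X_sub_C _, ?_⟩
  rw [← adjoin_range_algebraMap_eq_top (K := K) (F := F) hfrac]
  congr 1
  ext x
  have hne : χ.map (algebraMap A K) ≠ 0 := by
    intro h
    rw [h, Polynomial.map_zero] at hprod
    exact Finset.prod_ne_zero_iff.2 (fun i _ => Polynomial.X_sub_C_ne_zero _) hprod.symm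
  rw [Polynomial.mem_rootSet, ← Polynomial.eval_map_algebraMap, hprod, Polynomial.eval_prod,
    Finset.prod_eq_zero_iff]
  simp only [ne_eq, hne, not_false_eq_true, true_and, Finset.mem_univ, Polynomial.eval_sub,
    Polynomial.eval_X, Polynomial.eval_C, sub_eq_zero, Set.mem_range]
  exact exists_congr fun _ => eq_comm

variable [MulSemiringAction (Equiv.Perm ι) B] [SMulCommClass (Equiv.Perm ι) A B]

/-- An automorphism permutes the roots `l i`, which generate `F`. It therefore agrees with the
action of the permutation it induces. -/
theorem exists_surjective_permutations_of_roots (hl : Function.Injective l)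
    (hσ : ∀ (σ : Equiv.Perm ι) i, σ • l i = l (σ i))
    (hχ : χ.map (algebraMap A B) = ∏ i, (Polynomial.X - Polynomial.C (l i)))
    (hfrac : ∀ b : B, ∃ p ∈ Algebra.adjoin A (Set.range l), ∃ q ∈ Algebra.adjoin A (Set.range l),
      p ≠ 0 ∧ b * p = q) :
    ∃ ρ : Equiv.Perm ι →* (F ≃ₐ[K] F), Function.Surjective ρ ∧
      ∀ σ b, ρ σ (algebraMap B F b) = algebraMap B F (σ • b) := by
  let ρ : Equiv.Perm ι →* (F ≃ₐ[K] F) := (IsFractionRing.fieldEquivOfAlgEquivHom K F).comp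
    (MulSemiringAction.toAlgAut (Equiv.Perm ι) A B)
  have hρ : ∀ σ b, ρ σ (algebraMap B F b) = algebraMap B F (σ • b) := fun σ b =>
    IsFractionRing.fieldEquivOfAlgEquiv_algebraMap K F F _ b
  refine ⟨ρ, fun φ => ?_, hρ⟩
  have hprod := map_map_algebraMap_eq_prod (K := K) (F := F) hχ
  have hroot : ∀ i, ∃ j, algebraMap B F (l j) = φ (algebraMap B F (l i)) := by
    intro i
    have h1 : Polynomial.aeval (φ (algebraMap B F (l i))) (χ.map (algebraMap A K)) = 0 := by
      rw [← AlgEquiv.coe_toAlgHom, Polynomial.aeval_algHom_apply, ← Polynomial.eval_map_algebraMap,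
        hprod, Polynomial.eval_prod, Finset.prod_eq_zero (Finset.mem_univ i), map_zero]
      simp
    rw [← Polynomial.eval_map_algebraMap, hprod, Polynomial.eval_prod,
      Finset.prod_eq_zero_iff] at h1
    obtain ⟨j, -, hj⟩ := h1
    refine ⟨j, ?_⟩
    rw [Polynomial.eval_sub, Polynomial.eval_X, Polynomial.eval_C, sub_eq_zero] at hj
    exact hj.symm
  choose s hs using hroot
  have hinj : Function.Injective (algebraMap B F) := IsFractionRing.injective B F
  have hsinj : Function.Injective s := by
    intro i j hij
    have := hs i
    rw [hij, hs j] at this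
    exact (hl (hinj (φ.injective this))).symm
  let σ := Equiv.ofBijective s (Finite.injective_iff_bijective.1 hsinj)
  refine ⟨σ, ?_⟩
  refine AlgEquiv.ext fun x => ?_
  refine congrArg (fun ψ => ψ x) (algHom_eq_of_adjoin_eq_top (φ := (ρ σ : F →ₐ[K] F))
    (ψ := (φ : F →ₐ[K] F)) (adjoin_range_algebraMap_eq_top (K := K) (F := F) hfrac) ?_)
  rintro _ ⟨i, rfl⟩
  change ρ σ (algebraMap B F (l i)) = φ (algebraMap B F (l i))
  rw [hρ, hσ, ← hs i]
  rfl

end PermutedRoots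

/-! ### Monodromy groups of branched covers dominated by permuted roots -/

section Dominated

variable {ι κ τ : Type} (W : Set ((ι → ℂ) × (κ → ℂ))) {B : Type*} [CommRing B] [IsDomain B]
  [Algebra (MvPolynomial ι ℂ) B] [Fintype τ] {l : τ → B} {χ : Polynomial (MvPolynomial ι ℂ)}

attribute [local instance] FractionRing.liftAlgebra

theorem isAlgebraic_of_permuted_roots [FaithfulSMul (MvPolynomial ι ℂ) B]
    (hχ : χ.map (algebraMap _ B) = ∏ i, (Polynomial.X - Polynomial.C (l i)))
    (hfrac : ∀ b : B, ∃ p ∈ Algebra.adjoin (MvPolynomial ι ℂ) (Set.range l),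
      ∃ q ∈ Algebra.adjoin (MvPolynomial ι ℂ) (Set.range l), p ≠ 0 ∧ b * p = q) :
    Algebra.IsAlgebraic (MvPolynomial ι ℂ) B := by
  have := isSplittingField_of_permuted_roots (K := BaseField ι) (F := FractionRing B) hχ hfrac
  have : FiniteDimensional (BaseField ι) (FractionRing B) :=
    Polynomial.IsSplittingField.finiteDimensional _ (χ.map (algebraMap _ (BaseField ι)))
  have : Algebra.IsAlgebraic (BaseField ι) (FractionRing B) := inferInstance
  have : Algebra.IsAlgebraic (MvPolynomial ι ℂ) (FractionRing B) :=
    (IsFractionRing.comap_isAlgebraic_iff (A := MvPolynomial ι ℂ) (K := BaseField ι)).2 this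
  exact Algebra.IsAlgebraic.of_injective (IsScalarTower.toAlgHom _ B (FractionRing B))
    (IsFractionRing.injective B (FractionRing B))

variable [IsBranchedCover W] [MulSemiringAction (Equiv.Perm τ) B]
  [SMulCommClass (Equiv.Perm τ) (MvPolynomial ι ℂ) B]

/-- Through `θ` the function field of `W` becomes a subfield of the splitting field `Frac B`. A
relabelling fixes a primitive element exactly when it fixes that subfield, that is, the image of the
coordinate ring; `hstab` translates this into the stabilizer of `a`. -/
theorem permGroupIso_galoisMonodromyGroup_of_permuted_roots (hl : Function.Injective l)
    (hσ : ∀ (σ : Equiv.Perm τ) i, σ • l i = l (σ i))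
    (hχ : χ.map (algebraMap _ B) = ∏ i, (Polynomial.X - Polynomial.C (l i)))
    (hfrac : ∀ b : B, ∃ p ∈ Algebra.adjoin (MvPolynomial ι ℂ) (Set.range l),
      ∃ q ∈ Algebra.adjoin (MvPolynomial ι ℂ) (Set.range l), p ≠ 0 ∧ b * p = q)
    (θ : CoordRing W →ₐ[MvPolynomial ι ℂ] B) (hθ : Function.Injective θ)
    {α : Type*} [MulAction (Equiv.Perm τ) α] [MulAction.IsPretransitive (Equiv.Perm τ) α] (a : α)
    (hstab : ∀ σ : Equiv.Perm τ, (∀ c, σ • θ c = θ c) ↔ σ • a = a)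
    {f : Polynomial (BaseField ι)} (hf : IsEliminant W f) :
    PermGroupIso (galoisMonodromyGroup f) (MulAction.toPermHom (Equiv.Perm τ) α).range := by
  have hinj : Function.Injective (algebraMap (MvPolynomial ι ℂ) B) := by
    have := hθ.comp (IsBranchedCover.dominant (W := W))
    rwa [← AlgHom.coe_toRingHom, ← RingHom.coe_comp, AlgHom.comp_algebraMap] at this
  have : FaithfulSMul (MvPolynomial ι ℂ) B := (faithfulSMul_iff_algebraMap_injective _ _).2 hinj
  have hspl := isSplittingField_of_permuted_roots (K := BaseField ι) (F := FractionRing B) hχ hfrac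
  have hnormal : Normal (BaseField ι) (FractionRing B) :=
    Normal.of_isSplittingField (χ.map (algebraMap _ (BaseField ι)))
  obtain ⟨ρ, hρ, hρB⟩ := exists_surjective_permutations_of_roots (K := BaseField ι)
    (F := FractionRing B) hl hσ hχ hfrac
  have hψinj : Function.Injective ((algebraMap B (FractionRing B)).comp (θ : CoordRing W →+* B)) :=
    (IsFractionRing.injective B (FractionRing B)).comp hθ
  let ψ₀ : CoverField W →+* FractionRing B := IsFractionRing.lift hψinj
  have hψ₀ : ∀ c, ψ₀ (algebraMap (CoordRing W) (CoverField W) c) =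
      algebraMap B (FractionRing B) (θ c) := fun c => IsFractionRing.lift_algebraMap hψinj c
  have hcomm : ψ₀.comp (algebraMap (BaseField ι) (CoverField W)) =
      algebraMap (BaseField ι) (FractionRing B) := by
    refine IsLocalization.ringHom_ext (nonZeroDivisors (MvPolynomial ι ℂ)) (RingHom.ext fun p => ?_)
    have h1 : algebraMap (BaseField ι) (CoverField W) (algebraMap (MvPolynomial ι ℂ) _ p) =
        algebraMap (CoordRing W) (CoverField W) (algebraMap (MvPolynomial ι ℂ) _ p) :=
      IsFractionRing.lift_algebraMap (base_injective W) p
    rw [RingHom.comp_apply, RingHom.comp_apply, RingHom.comp_apply, h1, hψ₀, AlgHom.commutes,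
      ← IsScalarTower.algebraMap_apply, ← IsScalarTower.algebraMap_apply]
  let ψ : CoverField W →ₐ[BaseField ι] FractionRing B :=
    { ψ₀ with commutes' := fun x => congrArg (fun φ => φ x) hcomm }
  obtain ⟨y, hy, rfl⟩ := hf
  have hint : IsIntegral (BaseField ι) y := by
    have h1 : IsIntegral (BaseField ι) (ψ y) := hnormal.isIntegral _
    exact (isIntegral_algHom_iff ψ ψ.injective).1 h1
  refine permGroupIso_galoisMonodromyGroup (minpoly.irreducible hint) ρ hρ (y := ψ y) ?_ a
    fun σ => ?_
  · rw [Polynomial.aeval_algHom_apply, minpoly.aeval, map_zero]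
  · rw [← hstab]
    constructor
    · intro h c
      have h1 : ((ρ σ : FractionRing B →ₐ[BaseField ι] FractionRing B).comp ψ) = ψ :=
        algHom_eq_of_adjoin_eq_top hy (by rintro _ rfl; exact h)
      have h2 := congrArg (fun φ => φ (algebraMap (CoordRing W) (CoverField W) c)) h1
      have h3 : ψ (algebraMap (CoordRing W) (CoverField W) c) =
        algebraMap B (FractionRing B) (θ c) := hψ₀ c
      change ρ σ (ψ (algebraMap (CoordRing W) (CoverField W) c)) = ψ _ at h2
      rw [h3, hρB] at h2
      exact IsFractionRing.injective B (FractionRing B) h2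
    · intro h
      obtain ⟨c, d, -, rfl⟩ := IsFractionRing.div_surjective (CoordRing W) y
      have h3 : ∀ c, ψ (algebraMap (CoordRing W) (CoverField W) c) =
        algebraMap B (FractionRing B) (θ c) := hψ₀
      rw [map_div₀, map_div₀, h3, h3, hρB, hρB, h, h]

end Dominated

/-! ### The Euclidean distance correspondence and the labelled eigenvalues -/

section EuclideanDistanceMonodromy

open scoped Pointwise

variable {m n r : ℕ}

instance : Algebra (MvPolynomial (Fin m × Fin n) ℂ) (eigenRing m n) :=
  ((eigenPoly m n).toRingHom.comp (rename (R := ℂ) Sum.inl).toRingHom).toAlgebra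

theorem eigenEval_algebraMap (z : eigenSet m n) (f : MvPolynomial (Fin m × Fin n) ℂ) :
    eigenEval z (algebraMap _ _ f) = eval z.1.1 f := by
  change eigenEval z (eigenPoly m n (rename Sum.inl f)) = _
  rw [eigenEval_eigenPoly, eval_rename]
  rfl

instance : SMulCommClass (Equiv.Perm (Fin n)) (MvPolynomial (Fin m × Fin n) ℂ)
    (eigenRing m n) where
  smul_comm σ f a := by
    rw [eigenRing_ext_iff]
    intro z
    rw [Algebra.smul_def, Algebra.smul_def, eigenEval_smul, map_mul, map_mul, eigenEval_algebraMap,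
      eigenEval_algebraMap, eigenEval_smul]
    rfl

/-- The characteristic polynomial of `uᵀ u`, with polynomial coefficients. -/
def gramCharpoly (m n : ℕ) : Polynomial (MvPolynomial (Fin m × Fin n) ℂ) :=
  ((matOf (MvPolynomial (Fin m × Fin n) ℂ) m n X).transpose *
    matOf (MvPolynomial (Fin m × Fin n) ℂ) m n X).charpoly

theorem map_gramCharpoly :
    (gramCharpoly m n).map (algebraMap _ (eigenRing m n)) =
      ∏ i, (Polynomial.X - Polynomial.C (eigenvalueFn i)) := by
  have h : ∀ z : eigenSet m n, ((gramCharpoly m n).map (algebraMap _ (eigenRing m n))).map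
      (eigenEval z) = (∏ i, (Polynomial.X - Polynomial.C (eigenvalueFn i))).map (eigenEval z) := by
    intro z
    have h1 : (eigenEval z).comp (algebraMap (MvPolynomial (Fin m × Fin n) ℂ) (eigenRing m n)) =
        eval z.1.1 := RingHom.ext (eigenEval_algebraMap z)
    have h2 : (matOf (MvPolynomial (Fin m × Fin n) ℂ) m n X).map (eval z.1.1) =
        matOf ℂ m n z.1.1 := by
      ext i j
      simp [matOf_apply]
    rw [Polynomial.map_map, h1, gramCharpoly, ← Matrix.charpoly_map, Matrix.map_mul,
      Matrix.transpose_map, h2, z.2.1]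
    simp [Polynomial.map_prod, eigenEval_eigenvalueFn]
  ext k : 1
  rw [eigenRing_ext_iff]
  intro z
  rw [← Polynomial.coeff_map, ← Polynomial.coeff_map, h]

theorem eigenPoly_mem_adjoin (f : MvPolynomial ((Fin m × Fin n) ⊕ Fin n) ℂ) :
    eigenPoly m n f ∈ Algebra.adjoin (MvPolynomial (Fin m × Fin n) ℂ)
      (Set.range (eigenvalueFn : Fin n → eigenRing m n)) := by
  induction f using MvPolynomial.induction_on with
  | C c =>
    have : eigenPoly m n (C c) = algebraMap (MvPolynomial (Fin m × Fin n) ℂ) _ (C c) := by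
      rw [eigenRing_ext_iff]
      intro z
      rw [eigenEval_eigenPoly, eigenEval_algebraMap, eval_C, eval_C]
    rw [this]
    exact Subalgebra.algebraMap_mem _ _
  | add p q hp hq => rw [map_add]; exact Subalgebra.add_mem _ hp hq
  | mul_X p k hp =>
    rw [map_mul]
    refine Subalgebra.mul_mem _ hp ?_
    rcases k with k | i
    · have : eigenPoly m n (X (Sum.inl k)) = algebraMap (MvPolynomial (Fin m × Fin n) ℂ) _ (X k) := by
        rw [eigenRing_ext_iff]
        intro z
        rw [eigenEval_eigenPoly, eigenEval_algebraMap, eval_X, eval_X]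
        rfl
      rw [this]
      exact Subalgebra.algebraMap_mem _ _
    · exact Algebra.subset_adjoin ⟨i, rfl⟩

theorem exists_mul_eq_of_eigenRing (hnm : n ≤ m) (a : eigenRing m n) :
    ∃ p ∈ Algebra.adjoin (MvPolynomial (Fin m × Fin n) ℂ)
        (Set.range (eigenvalueFn : Fin n → eigenRing m n)),
      ∃ q ∈ Algebra.adjoin (MvPolynomial (Fin m × Fin n) ℂ)
        (Set.range (eigenvalueFn : Fin n → eigenRing m n)), p ≠ 0 ∧ a * p = q := by
  obtain ⟨b, d, hd, h⟩ := exists_eigenPoly_mul_eq a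
  refine ⟨_, eigenPoly_mem_adjoin d, _, eigenPoly_mem_adjoin b, fun h0 => ?_, h⟩
  obtain ⟨z, hz⟩ := eigenSet_nonempty hnm
  have h1 := eigenRing_ext_iff.1 h0 ⟨z, hz⟩
  rw [eigenEval_eigenPoly, map_zero] at h1
  exact hd _ h1

/-- Every `u` off a hypersurface `g = 0` admits a labelling, so a polynomial in the kernel satisfies
`f * g = 0`. -/
theorem algebraMap_eigenRing_injective (hnm : n ≤ m) :
    Function.Injective (algebraMap (MvPolynomial (Fin m × Fin n) ℂ) (eigenRing m n)) := by
  rw [injective_iff_map_eq_zero]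
  intro f hf
  obtain ⟨g, hg⟩ := exists_genericity_polynomial m n
  have hg0 : g ≠ 0 := by
    rintro rfl
    obtain ⟨⟨u, l⟩, h⟩ := eigenSet_nonempty hnm
    exact (hg u).2 ⟨l, h⟩ (map_zero _)
  refine (mul_eq_zero.1 (MvPolynomial.funext fun u => ?_ : f * g = 0)).resolve_right hg0
  rw [map_mul, map_zero, mul_eq_zero, or_iff_not_imp_right]
  intro hu
  obtain ⟨l, hl⟩ := (hg u).1 hu
  have := eigenRing_ext_iff.1 hf ⟨(u, l), hl⟩
  rwa [eigenEval_algebraMap, map_zero] at this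

/-- The labels of the critical point of the correspondence that is given by the first `r`
eigenvalues. -/
def firstLabels (n r : ℕ) : Finset (Fin n) := Finset.univ.filter fun i => i.1 < r

theorem card_firstLabels (hrn : r ≤ n) : (firstLabels n r).card = r := by
  rw [firstLabels, Fin.card_filter_val_lt, min_eq_right hrn]

/-- The pullback of polynomial functions to the labelled eigenvalue set, along the map to the
Euclidean distance correspondence that is given by the first `r` eigenvalues. -/
def criticalPullback (m n r : ℕ) :
    MvPolynomial ((Fin m × Fin n) ⊕ (Fin m × Fin n)) ℂ →ₐ[ℂ] eigenRing m n :=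
  aeval (Sum.elim (fun p => eigenPoly m n (X (Sum.inl p)))
    fun p => criticalMatrix m (firstLabels n r) p.1 p.2)

theorem eigenEval_criticalPullback (z : eigenSet m n)
    (f : MvPolynomial ((Fin m × Fin n) ⊕ (Fin m × Fin n)) ℂ) :
    eigenEval z (criticalPullback m n r f) = eval (Sum.elim z.1.1
      ((matOf ℂ m n).symm ((criticalMatrix m (firstLabels n r)).map (eigenEval z)))) f := by
  have : (eigenEval z).comp (criticalPullback m n r).toRingHom = eval (Sum.elim z.1.1
      ((matOf ℂ m n).symm ((criticalMatrix m (firstLabels n r)).map (eigenEval z)))) := by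
    ext k
    · simp [criticalPullback, eigenEval]
    · rcases k with k | k
      · simp [criticalPullback, eigenEval_eigenPoly, eigenPoint]
      · simp [criticalPullback]
        rfl
  exact congrArg (fun φ => φ f) this

theorem mem_idealOf_iff {ι κ : Type} {W : Set ((ι → ℂ) × (κ → ℂ))} {f : MvPolynomial (ι ⊕ κ) ℂ} :
    f ∈ idealOf W ↔ ∀ u x, (u, x) ∈ W → eval (Sum.elim u x) f = 0 := by
  rw [idealOf, mem_vanishingIdeal_iff]
  constructor
  · intro h u x hux
    have := h _ ⟨(u, x), hux, rfl⟩
    rwa [aeval_eq_eval] at this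
  · rintro h _ ⟨⟨u, x⟩, hux, rfl⟩
    rw [aeval_eq_eval]
    exact h u x hux

theorem perm_smul_finset_eq_map {α : Type*} [DecidableEq α] (σ : Equiv.Perm α) (I : Finset α) :
    σ • I = I.map σ.toEmbedding := by
  rw [Finset.map_eq_image]
  rfl

theorem mem_edCorrespondence_critical (hrn : r ≤ n) (hnm : n ≤ m) (z : eigenSet m n) :
    (z.1.1, (matOf ℂ m n).symm ((criticalMatrix m (firstLabels n r)).map (eigenEval z))) ∈
      edCorrespondence (rankVariety m n r) := by
  obtain ⟨V, hV, -, hS⟩ := exists_orthogonal_diagonalization_of_mem_eigenSet z.2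
  refine (mem_edCorrespondence_iff_of_mem_eigenSet hrn hnm z.2 hV hS).2
    ⟨(firstLabels n r).map (1 : Equiv.Perm (Fin n)).toEmbedding, ?_, ?_⟩
  · rw [Finset.card_map, card_firstLabels hrn]
  · rw [LinearEquiv.apply_symm_apply]
    exact map_criticalMatrix_relabel (firstLabels n r) z 1 hV hS

/-- `Sₙ` is transitive on `r`-subsets, so relabelling turns the critical point of the first `r`
labels into any other one over the same `u`. -/
theorem exists_label_of_mem_edCorrespondence (hrn : r ≤ n) (hnm : n ≤ m)
    {u x : Fin m × Fin n → ℂ} {l : Fin n → ℂ} (hul : (u, l) ∈ eigenSet m n)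
    (hx : (u, x) ∈ edCorrespondence (rankVariety m n r)) :
    ∃ z : eigenSet m n, z.1.1 = u ∧
      (matOf ℂ m n).symm ((criticalMatrix m (firstLabels n r)).map (eigenEval z)) = x := by
  obtain ⟨V, hV, -, hS⟩ := exists_orthogonal_diagonalization_of_mem_eigenSet hul
  obtain ⟨J, hJ, hxJ⟩ := (mem_edCorrespondence_iff_of_mem_eigenSet hrn hnm hul hV hS).1 hx
  have := Set.powersetCard.isPretransitive (α := Fin n) (n := r)
  obtain ⟨σ, hσ⟩ := MulAction.exists_smul_eq (Equiv.Perm (Fin n))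
    (⟨firstLabels n r, card_firstLabels hrn⟩ : Set.powersetCard (Fin n) r) ⟨J, hJ⟩
  have hσJ : (firstLabels n r).map σ.toEmbedding = J := by
    have := congrArg Subtype.val hσ
    rw [Set.powersetCard.coe_smul] at this
    exact (perm_smul_finset_eq_map σ _).symm.trans this
  refine ⟨relabel σ ⟨(u, l), hul⟩, rfl, ?_⟩
  rw [map_criticalMatrix_relabel (firstLabels n r) ⟨(u, l), hul⟩ σ hV hS, hσJ, ← hxJ,
    LinearEquiv.symm_apply_apply]

theorem isPrime_idealOf_edCorrespondence (hrn : r ≤ n) (hnm : n ≤ m) :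
    (idealOf (edCorrespondence (rankVariety m n r))).IsPrime := by
  obtain ⟨p, hp⟩ := eigenSet_nonempty hnm
  exact (polyConnected_edCorrespondence hrn hnm).isPrime_vanishingIdeal
    (Set.Nonempty.image _ ⟨_, mem_edCorrespondence_critical hrn hnm ⟨p, hp⟩⟩)

/-- The pullback sees only points of the correspondence over generic `u`, so its kernel a priori
consists of `f` with `f * g` in the ideal. Irreducibility of the correspondence removes the factor
`g`. -/
theorem criticalPullback_eq_zero_iff (hrn : r ≤ n) (hnm : n ≤ m)
    (f : MvPolynomial ((Fin m × Fin n) ⊕ (Fin m × Fin n)) ℂ) :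
    criticalPullback m n r f = 0 ↔ f ∈ idealOf (edCorrespondence (rankVariety m n r)) := by
  constructor
  · intro hf
    obtain ⟨g, hg⟩ := exists_genericity_polynomial m n
    have hfg : f * rename Sum.inl g ∈ idealOf (edCorrespondence (rankVariety m n r)) := by
      rw [mem_idealOf_iff]
      intro u x hux
      rw [map_mul, eval_rename, Sum.elim_comp_inl, mul_eq_zero, or_iff_not_imp_right]
      intro hu
      obtain ⟨l, hul⟩ := (hg u).1 hu
      obtain ⟨z, rfl, rfl⟩ := exists_label_of_mem_edCorrespondence hrn hnm hul hux
      rw [← eigenEval_criticalPullback, hf, map_zero]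
    refine ((isPrime_idealOf_edCorrespondence hrn hnm).mem_or_mem hfg).resolve_right fun h => ?_
    obtain ⟨p, hp⟩ := eigenSet_nonempty hnm
    have h1 := mem_idealOf_iff.1 h _ _ (mem_edCorrespondence_critical hrn hnm ⟨p, hp⟩)
    rw [eval_rename, Sum.elim_comp_inl] at h1
    exact (hg p.1).2 ⟨p.2, hp⟩ h1
  · intro hf
    rw [eigenRing_ext_iff]
    intro z
    rw [eigenEval_criticalPullback, map_zero]
    exact mem_idealOf_iff.1 hf _ _ (mem_edCorrespondence_critical hrn hnm z)

/-- The inclusion of the coordinate ring of the correspondence in the ring of regular functions on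
the labelled eigenvalue set. -/
def coordRingToEigenRing (hrn : r ≤ n) (hnm : n ≤ m) :
    CoordRing (edCorrespondence (rankVariety m n r)) →ₐ[MvPolynomial (Fin m × Fin n) ℂ]
      eigenRing m n where
  __ := Ideal.Quotient.lift _ (criticalPullback m n r).toRingHom
    fun f hf => (criticalPullback_eq_zero_iff hrn hnm f).2 hf
  commutes' f := by
    change criticalPullback m n r (rename Sum.inl f) = _
    rw [eigenRing_ext_iff]
    intro z
    rw [eigenEval_criticalPullback, eval_rename, Sum.elim_comp_inl, eigenEval_algebraMap]

theorem coordRingToEigenRing_mk (hrn : r ≤ n) (hnm : n ≤ m)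
    (f : MvPolynomial ((Fin m × Fin n) ⊕ (Fin m × Fin n)) ℂ) :
    coordRingToEigenRing hrn hnm (Ideal.Quotient.mk _ f) = criticalPullback m n r f := rfl

theorem coordRingToEigenRing_injective (hrn : r ≤ n) (hnm : n ≤ m) :
    Function.Injective (coordRingToEigenRing (r := r) hrn hnm) := by
  rw [injective_iff_map_eq_zero]
  intro c hc
  obtain ⟨f, rfl⟩ := Ideal.Quotient.mk_surjective c
  rw [coordRingToEigenRing_mk, criticalPullback_eq_zero_iff hrn hnm] at hc
  exact Ideal.Quotient.eq_zero_iff_mem.2 hc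

/-- Injectivity of `ℂ[u]` into the coordinate ring and algebraicity over it are both inherited from
`eigenRing`, which contains the coordinate ring over `ℂ[u]`. -/
theorem isBranchedCover_edCorrespondence (hrn : r ≤ n) (hnm : n ≤ m) :
    IsBranchedCover (edCorrespondence (rankVariety m n r)) where
  irreducible := isPrime_idealOf_edCorrespondence hrn hnm
  dominant := by
    have h := algebraMap_eigenRing_injective hnm
    rw [← AlgHom.comp_algebraMap (coordRingToEigenRing (r := r) hrn hnm)] at h
    rw [RingHom.coe_comp] at h
    exact Function.Injective.of_comp h
  equidimensional := by
    have := isDomain_eigenRing hnm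
    have : FaithfulSMul (MvPolynomial (Fin m × Fin n) ℂ) (eigenRing m n) :=
      (faithfulSMul_iff_algebraMap_injective _ _).2 (algebraMap_eigenRing_injective hnm)
    have := isAlgebraic_of_permuted_roots (map_gramCharpoly (m := m) (n := n))
      (exists_mul_eq_of_eigenRing hnm)
    exact Algebra.IsAlgebraic.of_injective _ (coordRingToEigenRing_injective hrn hnm)

theorem smul_coordRingToEigenRing_eq_iff (hrn : r ≤ n) (hnm : n ≤ m) (σ : Equiv.Perm (Fin n)) :
    (∀ c, σ • coordRingToEigenRing (r := r) hrn hnm c = coordRingToEigenRing hrn hnm c) ↔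
      σ • (⟨firstLabels n r, card_firstLabels hrn⟩ : Set.powersetCard (Fin n) r) =
        ⟨firstLabels n r, card_firstLabels hrn⟩ := by
  have h1 : σ • (⟨firstLabels n r, card_firstLabels hrn⟩ : Set.powersetCard (Fin n) r) =
      ⟨firstLabels n r, card_firstLabels hrn⟩ ↔
      (firstLabels n r).map σ.toEmbedding = firstLabels n r := by
    rw [← Subtype.val_inj, Set.powersetCard.coe_smul]
    exact Eq.congr_left (perm_smul_finset_eq_map σ _)
  rw [h1, ← smul_criticalMatrix_eq_iff hnm]
  constructor
  · intro h i j
    have h2 := h (Ideal.Quotient.mk _ (X (Sum.inr (i, j))))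
    rwa [coordRingToEigenRing_mk, criticalPullback, aeval_X] at h2
  · intro h c
    obtain ⟨f, rfl⟩ := Ideal.Quotient.mk_surjective c
    rw [coordRingToEigenRing_mk]
    induction f using MvPolynomial.induction_on with
    | C c =>
      rw [eigenRing_ext_iff]
      intro z
      rw [eigenEval_smul, eigenEval_criticalPullback, eigenEval_criticalPullback, eval_C, eval_C]
    | add p q hp hq => rw [map_add, smul_add, hp, hq]
    | mul_X p k hp =>
      rw [map_mul, smul_mul', hp]
      congr 1
      rcases k with k | k
      · rw [eigenRing_ext_iff]
        intro z
        rw [eigenEval_smul, eigenEval_criticalPullback, eigenEval_criticalPullback, eval_X, eval_X]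
        rfl
      · rw [criticalPullback, aeval_X]
        exact h k.1 k.2

end EuclideanDistanceMonodromy

end

/-! ### The branched cover, its degree, monodromy group and Galois width -/

theorem theorem4p4 (m n r : ℕ) (hr : 1 ≤ r) (hrn : r ≤ n) (hnm : n ≤ m) :
    ∃ _ : IsBranchedCover (edCorrespondence (rankVariety m n r)),
      (∀ f : Polynomial (BaseField (Fin m × Fin n)),
        IsEliminant (edCorrespondence (rankVariety m n r)) f →
          PermGroupIso (galoisMonodromyGroup f) (symmOnSubsets n r) ∧
          (r < n → galoisWidth (galoisMonodromyGroup f) = if n = 4 then 3 else n) ∧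
          (r = n → galoisWidth (galoisMonodromyGroup f) = 1)) ∧
      HasDegree (edCorrespondence (rankVariety m n r)) (n.choose r) := by
  have hcover := isBranchedCover_edCorrespondence hrn hnm
  refine ⟨hcover, fun f hf => ?_, hasDegree_edCorrespondence hrn hnm⟩
  have hdomain := isDomain_eigenRing hnm
  have hiso : PermGroupIso (galoisMonodromyGroup f) (symmOnSubsets n r) :=
    have := Set.powersetCard.isPretransitive (α := Fin n) (n := r)
    permGroupIso_galoisMonodromyGroup_of_permuted_roots _ (eigenvalueFn_injective hnm)
      smul_eigenvalueFn map_gramCharpoly (exists_mul_eq_of_eigenRing hnm)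
      (coordRingToEigenRing hrn hnm) (coordRingToEigenRing_injective hrn hnm)
      ⟨firstLabels n r, card_firstLabels hrn⟩ (smul_coordRingToEigenRing_eq_iff hrn hnm) hf
  refine ⟨hiso, fun h => galoisWidth_of_permGroupIso_symmOnSubsets hr h hiso, ?_⟩
  rintro rfl
  exact galoisWidth_of_permGroupIso_symmOnSubsets_self hiso
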